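/- Let $N\ge 3$ be an integer and let $p,q\ge 1$, $0\le\alpha<N$ and $\beta>\alpha-N$ be real numbers. Put $$K_{\alpha,\beta}(x)=|x|^{-\alpha}\log^{\beta}(1+|x|),\qquad (K_{\alpha,\beta}*u^p)(x)=\int_{\mathbb R^N}K_{\alpha,\beta}(x-y)\,u(y)^p\,dy .$$ For $\lambda>0$ consider the inequality $$(P^+)\qquad \Delta^2u-\lambda\Delta u\ \ge\ (K_{\alpha,\beta}*u^p)\,u^q\quad\text{in }\mathbb R^N .$$ A non-negative solution of $(P^+)$ is a function $u\in C^4(\mathbb R^N)$ with $u\ge 0$, $u\not\equiv 0$ and $(K_{\alpha,\beta}*u^p)(x)<\infty$ for all $x\in\mathbb R^N$, which satisfies $(P^+)$ pointwise in $\mathbb R^N$. (i) If $\beta<-2$, then there exists $\lambda>0$ such that $(P^+)$ has a non-negative solution if and only if $$p,\,q\ \ge\ \frac{N-\alpha}{N-2}\quad\text{and}\quad p+q\ \ge\ \frac{2N-\alpha}{N-2}.$$ (ii) If $\beta>-1+\frac1q$, then there exists $\lambda>0$ such that $(P^+)$ has a non-negative solution if and only if $$p,\,q\ >\ \frac{N-\alpha}{N-2}\quad\text{and}\quad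 p+q\ >\ \frac{2N-\alpha}{N-2}.$$ -/

import Mathlib

open MeasureTheory
open scoped ENNReal

noncomputable section

/-- The kernel `K_{α,β}(x) = |x|^{-α} log^β (1 + |x|)` on `ℝ^N`. -/
def logRieszKernel {N : ℕ} (α β : ℝ) (x : EuclideanSpace ℝ (Fin N)) : ℝ :=
  ‖x‖ ^ (-α) * Real.log (1 + ‖x‖) ^ β

/-- The convolution `(K_{α,β} * u^p)(x) = ∫ K_{α,β}(x - y) u(y)^p dy`, with values in `[0, ∞]`
(used for non-negative continuous `u`). -/
def kernelConv {N : ℕ} (α β p : ℝ) (u : EuclideanSpace ℝ (Fin N) → ℝ)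
    (x : EuclideanSpace ℝ (Fin N)) : ℝ≥0∞ :=
  ∫⁻ y, ENNReal.ofReal (logRieszKernel α β (x - y) * u y ^ p)

/-- `u` is a classical non-negative solution in `ℝ^N` of the inequality
`Δ² u - lam Δ u ≥ (K_{α,β} * u^p) u^q`: it is of class `C⁴`, non-negative, the convolution is finite
at every point, and the inequality holds pointwise. -/
structure IsNonnegSolutionPPlus {N : ℕ} (α β p q lam : ℝ)
    (u : EuclideanSpace ℝ (Fin N) → ℝ) : Prop where
  contDiff : ContDiff ℝ 4 u
  nonneg : ∀ x, 0 ≤ u x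
  conv_lt_top : ∀ x, kernelConv α β p u x < ∞
  ineq : ∀ x, (kernelConv α β p u x).toReal * u x ^ q ≤
    Laplacian.laplacian (Laplacian.laplacian u) x - lam * Laplacian.laplacian u x

/-- For some `lam > 0` the inequality `Δ² u - lam Δ u ≥ (K_{α,β} * u^p) u^q` has a non-negative
solution in `ℝ^N` other than the zero function, which always solves it when `p, q > 0`. -/
def HasNonnegSolutionPPlus (N : ℕ) (α β p q : ℝ) : Prop :=
  ∃ lam : ℝ, 0 < lam ∧ ∃ u : EuclideanSpace ℝ (Fin N) → ℝ,
    IsNonnegSolutionPPlus α β p q lam u ∧ u ≠ 0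

end

/-! ### Second-order calculus for the Laplacian: coordinates, symmetries, radial functions, Green's
identity. -/

section LaplacianCalculus

open Laplacian InnerProductSpace Module

variable {E : Type*} [NormedAddCommGroup E] [InnerProductSpace ℝ E] [FiniteDimensional ℝ E]

/-! Necessity. Finiteness of the convolution at one point makes the averages of `u` over unit balls
grow at most polynomially. A maximum principle for `Δ w ≤ lam * w`, applied to a mollification of
`-Δ u`, then gives `Δ u ≤ 0` (`laplacian_nonpos_of_growth`), so `u` dominates a multiple of
`|x|^(2-N)` far away (`exists_le_of_laplacian_nonpos`). Finiteness of the convolution now forces `N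
≤ α + (N-2)p`, strictly if `β ≥ -1`.

The mass of `u^p` near the origin bounds the convolution below by `|x|^(-θ) log^β|x|` with `θ = α`,
and its mass at distance of order `|x|` does so with `θ = α + (N-2)p - N`. Set `V = lam u - Δ u ≥
0`, so that `-Δ V ≥ c |x|^(-θ) log^β|x| u^q`. Write `u^q = u^(q-1) u`, bound `u^(q-1)` below, and
test on a ball of radius `|ξ|/2` centred at a far point `ξ` (`mul_sq_le_of_neg_laplacian_ge`): the
potential multiplying `u` is at most of order `|ξ|^(-2)`, which means `N ≤ θ + (N-2)q`. The two
values of `θ` give the conditions on `q` and on `p + q`. In case of equality with `β > -1`, the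
right-hand side is at least of order `|x|^(-N) log^β|x|`. This improves the lower bound of `u` by
the factor `log^(β+1)|x|` (`exists_log_improvement`), and testing again yields `q(β+1) ≤ 1`. For `β
> -1 + 1/q` this is impossible, so the inequalities are strict.

Sufficiency. Only a decaying `u` is needed for which `-Δ u` dominates both `|Δ² u|` and `(K * u^p)
u^q` up to constants: a large `lam` absorbs `Δ² u`, and multiplying `u` by a small constant settles
the superlinear right-hand side (`hasNonnegSolutionPPlus_of_supersolution`). Under strict
inequalities a power decaying slightly more slowly than `|x|^(2-N)` works. In the critical case with
`β < -2`, the choice `|x|^(2-N) (1 - m log^(β+2)|x|)`, suitably regularised, has `-Δ u` of order at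
least `|x|^(-N) log^(β+1)|x|`, which is the size of the convolution term given by
`exists_kernelConv_le`. -/

theorem laplacian_eq_sum_fderiv {ι : Type*} [Fintype ι] (b : OrthonormalBasis ι ℝ E) {f : E → ℝ}
    (hf : ContDiff ℝ 2 f) (x : E) :
    Δ f x = ∑ i, fderiv ℝ (fun y => fderiv ℝ f y (b i)) x (b i) := by
  rw [laplacian_eq_iteratedFDeriv_orthonormalBasis f b]
  refine Finset.sum_congr rfl fun i _ => ?_
  have hd : DifferentiableAt ℝ (fderiv ℝ f) x :=
    (hf.fderiv_right (m := 1) (by norm_num)).differentiable (by norm_num) x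
  rw [iteratedFDeriv_two_apply]
  simp [fderiv_clm_apply hd (differentiableAt_const _)]

omit [FiniteDimensional ℝ E] in
theorem contDiff_fderiv_const_apply {f : E → ℝ} {n m : WithTop ℕ∞} (hf : ContDiff ℝ n f)
    (h : m + 1 ≤ n) (v : E) : ContDiff ℝ m (fun y => fderiv ℝ f y v) :=
  (hf.fderiv_right h).clm_apply contDiff_const

theorem ContDiff.laplacian {f : E → ℝ} {n m : WithTop ℕ∞} (hf : ContDiff ℝ n f) (h : m + 2 ≤ n) :
    ContDiff ℝ m (Δ f) := by
  have h2 : ContDiff ℝ 2 f := hf.of_le (le_add_self.trans h)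
  have : Δ f = fun x => ∑ i, fderiv ℝ (fun y => fderiv ℝ f y (stdOrthonormalBasis ℝ E i)) x
      (stdOrthonormalBasis ℝ E i) := funext fun x => laplacian_eq_sum_fderiv _ h2 x
  rw [this]
  refine ContDiff.sum fun i _ => contDiff_fderiv_const_apply (n := m + 1) ?_ le_rfl _
  exact contDiff_fderiv_const_apply hf (by rwa [add_assoc, one_add_one_eq_two]) _

theorem laplacian_comp_add_right {f : E → ℝ} (hf : ContDiff ℝ 2 f) (a x : E) :
    Δ (fun y => f (y + a)) x = Δ f (x + a) := by
  have h1 : ContDiff ℝ 2 (fun y => f (y + a)) := hf.comp (contDiff_id.add contDiff_const)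
  rw [laplacian_eq_sum_fderiv (stdOrthonormalBasis ℝ E) h1,
    laplacian_eq_sum_fderiv (stdOrthonormalBasis ℝ E) hf]
  refine Finset.sum_congr rfl fun i _ => ?_
  simp only [fderiv_comp_add_right]
  rw [fderiv_comp_add_right (f := fun y => fderiv ℝ f y (stdOrthonormalBasis ℝ E i))]

omit [FiniteDimensional ℝ E] in
theorem fderiv_comp_const_sub_apply {f : E → ℝ} (hf : Differentiable ℝ f) (a x v : E) :
    fderiv ℝ (fun y => f (a - y)) x v = - fderiv ℝ f (a - x) v := by
  have h : HasFDerivAt (fun y => f (a - y)) ((fderiv ℝ f (a - x)).comp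
      (-ContinuousLinearMap.id ℝ E)) x := by
    refine (hf (a - x)).hasFDerivAt.comp x ?_
    simpa using (hasFDerivAt_id x).const_sub a
  rw [h.fderiv]; simp

theorem laplacian_comp_const_sub {f : E → ℝ} (hf : ContDiff ℝ 2 f) (a x : E) :
    Δ (fun y => f (a - y)) x = Δ f (a - x) := by
  have h1 : ContDiff ℝ 2 (fun y => f (a - y)) := hf.comp (contDiff_const.sub contDiff_id)
  rw [laplacian_eq_sum_fderiv (stdOrthonormalBasis ℝ E) h1,
    laplacian_eq_sum_fderiv (stdOrthonormalBasis ℝ E) hf]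
  refine Finset.sum_congr rfl fun i _ => ?_
  have hd : Differentiable ℝ (fun y => fderiv ℝ f y (stdOrthonormalBasis ℝ E i)) :=
    (contDiff_fderiv_const_apply (m := 1) hf (by norm_num) _).differentiable (by norm_num)
  simp only [fderiv_comp_const_sub_apply (hf.differentiable (by norm_num))]
  rw [fderiv_fun_neg, neg_apply, fderiv_comp_const_sub_apply hd, neg_neg]

/-- The Laplacian is non-negative at a local minimum. -/
theorem laplacian_nonneg_of_isLocalMin {f : E → ℝ} (hf : ContDiff ℝ 2 f) {x : E}
    (hx : IsLocalMin f x) : 0 ≤ Δ f x := by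
  rw [laplacian_eq_sum_fderiv (stdOrthonormalBasis ℝ E) hf]
  refine Finset.sum_nonneg fun i _ => ?_
  set v := stdOrthonormalBasis ℝ E i
  by_contra! hneg
  set g : ℝ → ℝ := fun t => f (x + t • v)
  have hl : ∀ t : ℝ, HasDerivAt (fun t : ℝ => x + t • v) v t := fun t => by
    simpa using ((hasDerivAt_id t).smul_const v).const_add x
  have hg1 : ∀ t, HasDerivAt g (fderiv ℝ f (x + t • v) v) t := fun t =>
    ((hf.differentiable (by norm_num) _).hasFDerivAt).comp_hasDerivAt t (hl t)
  have hd : Differentiable ℝ (fun y => fderiv ℝ f y v) :=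
    (contDiff_fderiv_const_apply (m := 1) hf (by norm_num) _).differentiable (by norm_num)
  have hg1' : deriv g = fun t => fderiv ℝ f (x + t • v) v := funext fun t => (hg1 t).deriv
  have hg2 : HasDerivAt (deriv g) (fderiv ℝ (fun y => fderiv ℝ f y v) x v) 0 := by
    rw [hg1']
    simpa [Function.comp_def] using ((hd (x + (0 : ℝ) • v)).hasFDerivAt).comp_hasDerivAt 0 (hl 0)
  have hmin : IsLocalMin g 0 := by
    have hc : ContinuousAt (fun t : ℝ => x + t • v) 0 := (hl 0).continuousAt
    have : Filter.Tendsto (fun t : ℝ => x + t • v) (nhds 0) (nhds x) := by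
      simpa [ContinuousAt] using hc
    have h2 := this.eventually hx
    filter_upwards [h2] with t ht
    simpa [g] using ht
  -- A negative second derivative would make `0` a local maximum as well; `g` would then be constant
  -- near `0` and have zero second derivative.
  have hmax : IsLocalMax g 0 := isLocalMax_of_deriv_deriv_neg (by rw [hg2.deriv]; exact hneg)
    hmin.deriv_eq_zero (hg1 0).continuousAt
  have hconst : g =ᶠ[nhds 0] fun _ => g 0 := by
    filter_upwards [hmin, hmax] with t h1 h2 using le_antisymm h2 h1
  have h3 : deriv g =ᶠ[nhds 0] fun _ => (0 : ℝ) := by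
    have := hconst.deriv
    simpa using this
  have h4 : deriv (deriv g) 0 = 0 := by rw [h3.deriv_eq]; simp
  rw [hg2.deriv] at h4
  linarith

/-- The Laplacian of a radial function, written as a function of `A + ‖x‖ ^ 2`. -/
theorem laplacian_radial {φ φ' φ'' : ℝ → ℝ} {A : ℝ}
    (h1 : ∀ s, A ≤ s → HasDerivAt φ (φ' s) s) (h2 : ∀ s, A ≤ s → HasDerivAt φ' (φ'' s) s)
    (hf : ContDiff ℝ 2 fun x : E => φ (A + ‖x‖ ^ 2)) (x : E) :
    Δ (fun x : E => φ (A + ‖x‖ ^ 2)) x =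
      4 * ‖x‖ ^ 2 * φ'' (A + ‖x‖ ^ 2) + 2 * finrank ℝ E * φ' (A + ‖x‖ ^ 2) := by
  have hA : ∀ x : E, A ≤ A + ‖x‖ ^ 2 := fun x => by nlinarith [sq_nonneg ‖x‖]
  have hn : ∀ x : E, HasFDerivAt (fun x : E => A + ‖x‖ ^ 2) (2 • innerSL ℝ x) x := fun x => by
    simpa using ((hasStrictFDerivAt_norm_sq x).hasFDerivAt).const_add A
  have hf1 : ∀ x v : E, fderiv ℝ (fun x : E => φ (A + ‖x‖ ^ 2)) x v
      = φ' (A + ‖x‖ ^ 2) * (2 * inner ℝ x v) := fun x v => by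
    have := (h1 _ (hA x)).comp_hasFDerivAt x (hn x)
    have e : (fun x : E => φ (A + ‖x‖ ^ 2)) = φ ∘ fun x : E => A + ‖x‖ ^ 2 := rfl
    rw [e, this.fderiv]; simp
  have hf2 : ∀ x v : E, fderiv ℝ (fun y => fderiv ℝ (fun x : E => φ (A + ‖x‖ ^ 2)) y v) x v
      = 4 * φ'' (A + ‖x‖ ^ 2) * (inner ℝ x v) ^ 2 + 2 * φ' (A + ‖x‖ ^ 2) * inner ℝ v v := fun x v => by
    simp only [hf1]
    have h3 := (h2 _ (hA x)).comp_hasFDerivAt x (hn x)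
    have h4 : HasFDerivAt (fun y : E => 2 * inner ℝ y v) ((2 : ℝ) • innerSL ℝ v) x := by
      have := ((innerSL ℝ v).hasFDerivAt (x := x)).const_mul 2
      refine this.congr_of_eventuallyEq (Filter.Eventually.of_forall fun y => ?_)
      simp [real_inner_comm]
    have h5 := h3.mul h4
    have e : (fun y : E => φ' (A + ‖y‖ ^ 2) * (2 * inner ℝ y v))
      = (φ' ∘ fun x : E => A + ‖x‖ ^ 2) * (fun y : E => 2 * inner ℝ y v) := rfl
    rw [e, h5.fderiv]
    simp
    ring
  rw [laplacian_eq_sum_fderiv (stdOrthonormalBasis ℝ E) hf]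
  simp only [hf2]
  rw [Finset.sum_add_distrib, ← Finset.mul_sum]
  have := OrthonormalBasis.sum_sq_inner_right (stdOrthonormalBasis ℝ E) x
  have h6 : ∑ i, inner ℝ x (stdOrthonormalBasis ℝ E i) ^ 2 = ‖x‖ ^ 2 := by
    rw [← this]
    exact Finset.sum_congr rfl fun i _ => by rw [real_inner_comm]
  rw [h6]
  simp
  ring

variable [MeasurableSpace E] [BorelSpace E]

theorem integrable_mul_of_hasCompactSupport {f g : E → ℝ} (hf : Continuous f) (hg : Continuous g)
    (hc : HasCompactSupport f) : Integrable (fun x => f x * g x) :=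
  (hf.mul hg).integrable_of_hasCompactSupport (hc.mul_right)

/-- Green's identity for a compactly supported function. -/
theorem integral_mul_laplacian {f g : E → ℝ} (hf : ContDiff ℝ 2 f) (hg : ContDiff ℝ 2 g)
    (hc : HasCompactSupport f) : ∫ x, f x * Δ g x = ∫ x, Δ f x * g x := by
  have key : ∀ {f g : E → ℝ}, ContDiff ℝ 1 f → ContDiff ℝ 1 g → HasCompactSupport f → ∀ v,
      ∫ x, f x * fderiv ℝ g x v = - ∫ x, fderiv ℝ f x v * g x := by
    intro f g hf hg hc v
    have hcf := (contDiff_fderiv_const_apply (m := 0) hf (by simp) v).continuous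
    have hcg := (contDiff_fderiv_const_apply (m := 0) hg (by simp) v).continuous
    exact integral_mul_fderiv_eq_neg_fderiv_mul_of_integrable
      (integrable_mul_of_hasCompactSupport hcf hg.continuous (hc.fderiv_apply ℝ v))
      (integrable_mul_of_hasCompactSupport hf.continuous hcg hc)
      (integrable_mul_of_hasCompactSupport hf.continuous hg.continuous hc)
      (fun x _ => hf.differentiable (by norm_num) x) (fun x _ => hg.differentiable (by norm_num) x)
  set b := stdOrthonormalBasis ℝ E
  have hf1 : ∀ v, ContDiff ℝ 1 fun y => fderiv ℝ f y v := fun v => by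
    exact contDiff_fderiv_const_apply hf (by norm_num) v
  have hg1 : ∀ v, ContDiff ℝ 1 fun y => fderiv ℝ g y v := fun v => by
    exact contDiff_fderiv_const_apply hg (by norm_num) v
  have hf2 : ∀ v, Continuous fun x => fderiv ℝ (fun y => fderiv ℝ f y v) x v := fun v =>
    (contDiff_fderiv_const_apply (m := 0) (hf1 v) (by simp) v).continuous
  have hg2 : ∀ v, Continuous fun x => fderiv ℝ (fun y => fderiv ℝ g y v) x v := fun v =>
    (contDiff_fderiv_const_apply (m := 0) (hg1 v) (by simp) v).continuous
  simp only [laplacian_eq_sum_fderiv b hf, laplacian_eq_sum_fderiv b hg, Finset.mul_sum,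
    Finset.sum_mul]
  rw [integral_finsetSum, integral_finsetSum]
  · refine Finset.sum_congr rfl fun i _ => ?_
    rw [key (hf.of_le (by norm_num)) (hg1 _) hc, ← neg_eq_iff_eq_neg.2
      (key (hf1 (b i)) (hg.of_le (by norm_num)) (hc.fderiv_apply ℝ _) (b i))]
  · intro i _
    exact integrable_mul_of_hasCompactSupport (hf2 _) hg.continuous
      ((hc.fderiv_apply ℝ _).fderiv_apply ℝ _)
  · intro i _
    exact integrable_mul_of_hasCompactSupport hf.continuous (hg2 _) hc

end LaplacianCalculus

/-! ### Maximum principles on the whole space and superharmonicity of solutions. -/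

section MaximumPrinciples

open Laplacian InnerProductSpace Module Filter Topology

variable {E : Type*} [NormedAddCommGroup E] [InnerProductSpace ℝ E] [FiniteDimensional ℝ E]

/-- If `g` were negative somewhere, the condition at infinity would give a global minimum with
negative value, where the Laplacian cannot be negative. All comparison arguments below reduce to
this. -/
theorem nonneg_of_laplacian_neg {g : E → ℝ} (hg : ContDiff ℝ 2 g)
    (hinf : ∀ ε > 0, ∀ᶠ x in cocompact E, -ε ≤ g x) (h : ∀ x, g x < 0 → Δ g x < 0) (x : E) :
    0 ≤ g x := by
  by_contra! hx
  obtain ⟨y, hy⟩ := hg.continuous.exists_forall_le' x (by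
    filter_upwards [hinf (-g x) (by linarith)] with z hz
    linarith)
  have h1 := laplacian_nonneg_of_isLocalMin hg (x := y) (Eventually.of_forall hy)
  have h2 := h y ((hy x).trans_lt hx)
  linarith

theorem laplacian_add_norm_sq_pow (A : ℝ) (M : ℕ) (x : E) :
    Δ (fun x : E => (A + ‖x‖ ^ 2) ^ (M + 2)) x =
      4 * ‖x‖ ^ 2 * ((M + 2) * (M + 1) * (A + ‖x‖ ^ 2) ^ M)
        + 2 * finrank ℝ E * ((M + 2) * (A + ‖x‖ ^ 2) ^ (M + 1)) := by
  refine laplacian_radial (φ := fun s => s ^ (M + 2)) (φ' := fun s => (M + 2) * s ^ (M + 1))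
    (φ'' := fun s => (M + 2) * (M + 1) * s ^ M) (fun s _ => ?_) (fun s _ => ?_) ?_ x
  · simpa using hasDerivAt_pow (M + 2) s
  · simpa [mul_assoc] using (hasDerivAt_pow (M + 1) s).const_mul ((M : ℝ) + 2)
  · exact (contDiff_const.add (contDiff_norm_sq ℝ)).pow _

/-- A function of polynomial growth with `Δ g ≤ lam * g` is non-negative. -/
theorem nonneg_of_laplacian_le_mul {g : E → ℝ} {lam C : ℝ} {M : ℕ} (hlam : 0 < lam)
    (hg : ContDiff ℝ 2 g) (h : ∀ x, Δ g x ≤ lam * g x) (hb : ∀ x, |g x| ≤ C * (1 + ‖x‖) ^ M)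
    (x : E) : 0 ≤ g x := by
  have hC : 0 ≤ C := by
    have := (abs_nonneg _).trans (hb 0)
    simpa using this
  set n : ℝ := (finrank ℝ E : ℝ)
  have hn : 0 ≤ n := Nat.cast_nonneg _
  set D : ℝ := 4 * ((M + 2) * (M + 1)) + 2 * n * (M + 2)
  have hD : 0 ≤ D := by positivity
  -- `D` bounds the coefficients of `Δ H` for the barrier `H` below; this shift `A` makes `2 * Δ H ≤
  -- lam * H`. The exponent `M + 2` makes `H` outgrow `(1 + ‖x‖) ^ M`.
  set A : ℝ := 1 + 2 * D / lam
  have hA1 : 1 ≤ A := by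
    have : 0 ≤ 2 * D / lam := by positivity
    linarith
  have hDA : 2 * D ≤ lam * A := by
    simp only [A]; field_simp; nlinarith
  set H : E → ℝ := fun x => (A + ‖x‖ ^ 2) ^ (M + 2)
  have hHc : ContDiff ℝ 2 H := (contDiff_const.add (contDiff_norm_sq ℝ)).pow _
  have hHpos : ∀ x, 0 < H x := fun x => by positivity
  have hHl : ∀ x, 2 * Δ H x ≤ lam * H x := fun x => by
    rw [laplacian_add_norm_sq_pow]
    have h0 : 0 ≤ ‖x‖ ^ 2 := by positivity
    have ht : 0 < A + ‖x‖ ^ 2 := by positivity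
    have hx_le : ‖x‖ ^ 2 ≤ A + ‖x‖ ^ 2 := by linarith
    have hA_le : A ≤ A + ‖x‖ ^ 2 := by linarith
    set t := A + ‖x‖ ^ 2
    have h1 : ‖x‖ ^ 2 * t ^ M ≤ t ^ (M + 1) := by
      rw [pow_succ' t]
      exact mul_le_mul_of_nonneg_right hx_le (by positivity)
    have h2 : H x = t * t ^ (M + 1) := by rw [← pow_succ']
    have h3 : lam * A * t ^ (M + 1) ≤ lam * H x := by
      rw [h2, mul_assoc]
      exact mul_le_mul_of_nonneg_left (mul_le_mul_of_nonneg_right hA_le (by positivity)) hlam.le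
    have h4 : 2 * D * t ^ (M + 1) ≤ lam * A * t ^ (M + 1) :=
      mul_le_mul_of_nonneg_right hDA (by positivity)
    refine le_trans ?_ (h4.trans h3)
    have h5 : (4 * (((M : ℝ) + 2) * (M + 1))) * (‖x‖ ^ 2 * t ^ M)
        ≤ (4 * (((M : ℝ) + 2) * (M + 1))) * t ^ (M + 1) :=
      mul_le_mul_of_nonneg_left h1 (by positivity)
    simp only [D]
    nlinarith
  -- Adding `δ * H` gives the right behaviour at infinity and keeps the differential inequality, now
  -- strictly. A small `δ` then contradicts `g x < 0`.
  have key : ∀ δ > 0, 0 ≤ g x + δ * H x := by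
    intro δ hδ
    refine nonneg_of_laplacian_neg (g := g + δ • H) (hg.add (hHc.const_smul δ)) (fun ε hε => ?_)
      (fun y hy => ?_) x
    · have : ∀ᶠ y in cocompact E, C * 2 ^ M / δ ≤ ‖y‖ :=
        (tendsto_norm_cocompact_atTop (E := E)).eventually_ge_atTop _
      filter_upwards [this] with y hy
      have hy0 := norm_nonneg y
      have h1 : (1 + ‖y‖) ^ 2 ≤ 2 * (A + ‖y‖ ^ 2) := by nlinarith [sq_nonneg (1 - ‖y‖)]
      have h2 : (1 + ‖y‖) ^ M ≤ 2 ^ M * (A + ‖y‖ ^ 2) ^ M := by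
        rw [← mul_pow]
        exact pow_le_pow_left₀ (by positivity) (le_trans (by nlinarith) h1) _
      have h3 : C * 2 ^ M ≤ δ * (A + ‖y‖ ^ 2) ^ 2 := by
        rw [div_le_iff₀' hδ] at hy
        refine hy.trans (mul_le_mul_of_nonneg_left ?_ hδ.le)
        nlinarith [sq_nonneg (1 - ‖y‖), sq_nonneg (A + ‖y‖ ^ 2 - 1)]
      have h4 := neg_le_of_abs_le (hb y)
      have h5 : C * (1 + ‖y‖) ^ M ≤ δ * H y := by
        calc C * (1 + ‖y‖) ^ M ≤ C * (2 ^ M * (A + ‖y‖ ^ 2) ^ M) :=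
              mul_le_mul_of_nonneg_left h2 hC
          _ = C * 2 ^ M * (A + ‖y‖ ^ 2) ^ M := by ring
          _ ≤ δ * (A + ‖y‖ ^ 2) ^ 2 * (A + ‖y‖ ^ 2) ^ M :=
              mul_le_mul_of_nonneg_right h3 (by positivity)
          _ = δ * H y := by simp only [H]; ring
      simp only [Pi.add_apply, Pi.smul_apply, smul_eq_mul]
      linarith
    · simp only [Pi.add_apply, Pi.smul_apply, smul_eq_mul] at hy
      have hHδ : ContDiff ℝ 2 (δ • H) := hHc.const_smul δ
      rw [ContDiffAt.laplacian_add hg.contDiffAt hHδ.contDiffAt,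
        laplacian_smul δ hHc.contDiffAt, smul_eq_mul]
      have h1 := h y
      have h2 := mul_le_mul_of_nonneg_left (hHl y) hδ.le
      have h3 : 0 < δ * (lam * H y) := by have := hHpos y; positivity
      nlinarith
  by_contra! hx
  have h1 := key (-g x / (2 * H x)) (div_pos (by linarith) (by have := hHpos x; positivity))
  have h2 : -g x / (2 * H x) * H x = -g x / 2 := by
    have := (hHpos x).ne'
    field_simp
  linarith

variable [MeasurableSpace E] [BorelSpace E]

theorem contDiff_integral_mul_comp_sub {h u : E → ℝ} {n : ℕ∞} (hh : ContDiff ℝ n h)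
    (hc : HasCompactSupport h) (hu : Continuous u) :
    ContDiff ℝ n fun x => ∫ y, h y * u (x - y) :=
  hc.contDiff_convolution_left (ContinuousLinearMap.mul ℝ ℝ) hh hu.locallyIntegrable

theorem fderiv_integral_mul_comp_sub {h u : E → ℝ} (hh : ContDiff ℝ 1 h)
    (hc : HasCompactSupport h) (hu : Continuous u) (x v : E) :
    fderiv ℝ (fun x => ∫ y, h y * u (x - y)) x v = ∫ y, fderiv ℝ h y v * u (x - y) := by
  have h1 := (hc.hasFDerivAt_convolution_left (μ := volume) (ContinuousLinearMap.mul ℝ ℝ) hh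
    hu.locallyIntegrable x).fderiv
  have e : (fun x => ∫ y, h y * u (x - y)) =
    convolution h u (ContinuousLinearMap.mul ℝ ℝ) volume := rfl
  rw [e, h1, convolution, ContinuousLinearMap.integral_apply]
  · rfl
  · have hcont : Continuous fun t => (ContinuousLinearMap.precompL E (ContinuousLinearMap.mul ℝ ℝ))
        (fderiv ℝ h t) (u (x - t)) := by
      have := hh.continuous_fderiv (by norm_num)
      fun_prop
    refine hcont.integrable_of_hasCompactSupport ?_
    refine (hc.fderiv ℝ).mono fun t ht h0 => ht ?_
    simp only [h0]
    simp

theorem laplacian_integral_mul_comp_sub {h u : E → ℝ} (hh : ContDiff ℝ 2 h)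
    (hc : HasCompactSupport h) (hu : Continuous u) (x : E) :
    Δ (fun x => ∫ y, h y * u (x - y)) x = ∫ y, Δ h y * u (x - y) := by
  have hh1 : ∀ v, ContDiff ℝ 1 fun y => fderiv ℝ h y v := fun v =>
    contDiff_fderiv_const_apply hh (by norm_num) v
  rw [laplacian_eq_sum_fderiv (stdOrthonormalBasis ℝ E) (by
    exact_mod_cast contDiff_integral_mul_comp_sub (n := 2) (by exact_mod_cast hh) hc hu)]
  simp only [fderiv_integral_mul_comp_sub (hh.of_le (by norm_num)) hc hu,
    fderiv_integral_mul_comp_sub (hh1 _) (hc.fderiv_apply ℝ _) hu,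
    laplacian_eq_sum_fderiv (stdOrthonormalBasis ℝ E) hh, Finset.sum_mul]
  rw [integral_finsetSum]
  intro i _
  refine integrable_mul_of_hasCompactSupport ?_ (by fun_prop)
    ((hc.fderiv_apply ℝ _).fderiv_apply ℝ _)
  exact (contDiff_fderiv_const_apply (m := 0) (hh1 _) (by simp) _).continuous

theorem integral_laplacian_mul_comp_sub {h u : E → ℝ} (hh : ContDiff ℝ 2 h)
    (hc : HasCompactSupport h) (hu : ContDiff ℝ 2 u) (x : E) :
    ∫ y, Δ h y * u (x - y) = ∫ y, h y * Δ u (x - y) := by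
  have h1 : ContDiff ℝ 2 fun y => u (x - y) := hu.comp (contDiff_const.sub contDiff_id)
  rw [← integral_mul_laplacian hh h1 hc]
  simp only [laplacian_comp_const_sub hu]

/-- A non-negative function whose averages have polynomial growth is superharmonic if
`Δ (Δ u) - lam * Δ u ≥ 0`. -/
theorem laplacian_nonpos_of_growth {u : E → ℝ} {lam C : ℝ} {M : ℕ} (hlam : 0 < lam)
    (hu : ContDiff ℝ 4 u) (hu0 : ∀ x, 0 ≤ u x) (h : ∀ x, 0 ≤ Δ (Δ u) x - lam * Δ u x)
    (hb : ∀ x, ∫ y in Metric.closedBall x 1, u y ≤ C * (1 + ‖x‖) ^ M) (x : E) :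
    Δ u x ≤ 0 := by
  have hu2 : ContDiff ℝ 2 u := hu.of_le (by norm_num)
  have hΔ : ContDiff ℝ 2 (Δ u) := hu.laplacian (by norm_num)
  have hΔΔ : ContDiff ℝ 0 (Δ (Δ u)) := hΔ.laplacian (by norm_num)
  by_contra! hx
  obtain ⟨r, hr0, hr⟩ := Metric.eventually_nhds_iff.1
    (hΔ.continuous.continuousAt.eventually (lt_mem_nhds hx))
  let f : ContDiffBump (0 : E) := ⟨min r 1 / 2, min r 1, by positivity, by
    have : 0 < min r 1 := by positivity
    linarith⟩
  have hf2 : ContDiff ℝ 2 f := f.contDiff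
  have hfc : HasCompactSupport f := f.hasCompactSupport
  have hfΔ : Continuous (Δ (f : E → ℝ)) := (hf2.laplacian (m := 0) (by norm_num)).continuous
  have hfs : ∀ y, y ∉ Metric.closedBall (0 : E) (min r 1) → Δ (f : E → ℝ) y = 0 := by
    intro y hy
    have h1 : (f : E → ℝ) =ᶠ[𝓝 y] fun _ => 0 := by
      filter_upwards [Metric.isClosed_closedBall.isOpen_compl.mem_nhds hy] with z hz
      exact f.zero_of_le_dist (by
        rw [Set.mem_compl_iff, Metric.mem_closedBall, not_le] at hz
        exact hz.le)
    have := (laplacian_congr_nhds h1).eq_of_nhds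
    rw [this]; simp
  have hfΔc : HasCompactSupport (Δ (f : E → ℝ)) :=
    HasCompactSupport.intro (isCompact_closedBall _ _) hfs
  obtain ⟨B, hB⟩ := hfΔc.exists_bound_of_continuous hfΔ
  have hB0 : 0 ≤ B := (norm_nonneg _).trans (hB 0)
  -- `W` mollifies `-Δ u` by a bump supported where `Δ u > 0` around `x` (after translation). With
  -- the Laplacian moved onto the bump, `W` is controlled by averages of `u` over unit balls, so the
  -- maximum principle gives `W ≥ 0`, while `W x < 0` by the choice of the support.
  set W : E → ℝ := fun z => ∫ y, f y * (- Δ u (z - y))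
  have hWc : ContDiff ℝ 2 W := by
    exact_mod_cast contDiff_integral_mul_comp_sub (n := 2) (u := fun z => - Δ u z)
      (by exact_mod_cast hf2) hfc hΔ.continuous.neg
  have hint : ∀ {v : E → ℝ} (z : E), Continuous v → Integrable fun y => f y * v (z - y) :=
    fun z hv => integrable_mul_of_hasCompactSupport hf2.continuous (by fun_prop) hfc
  have hWl : ∀ z, Δ W z ≤ lam * W z := by
    intro z
    have e1 : Δ W z = ∫ y, f y * (- Δ (Δ u) (z - y)) := by
      have := laplacian_integral_mul_comp_sub (u := -Δ u) hf2 hfc hΔ.continuous.neg z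
      have h2 := integral_laplacian_mul_comp_sub (u := -Δ u) hf2 hfc hΔ.neg z
      rw [laplacian_neg] at h2
      exact this.trans h2
    rw [e1, ← integral_const_mul]
    refine integral_mono (hint (v := fun y => - Δ (Δ u) y) z hΔΔ.continuous.neg)
      ((hint (v := fun y => - Δ u y) z hΔ.continuous.neg).const_mul _) fun y => ?_
    have h1 := h (z - y)
    have h2 := f.nonneg (x := y)
    simp only
    nlinarith
  have hWb : ∀ z, |W z| ≤ B * C * (1 + ‖z‖) ^ M := by
    intro z
    have e1 : W z = - ∫ y, Δ (f : E → ℝ) y * u (z - y) := by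
      rw [integral_laplacian_mul_comp_sub hf2 hfc hu2, ← integral_neg]
      simp [W]
    rw [e1, abs_neg, mul_assoc]
    have hiu : IntegrableOn u (Metric.closedBall z 1) :=
      hu.continuous.continuousOn.integrableOn_compact (isCompact_closedBall _ _)
    calc |∫ y, Δ (f : E → ℝ) y * u (z - y)|
        = |∫ y, Δ (f : E → ℝ) (z - y) * u y| := by
          rw [← integral_sub_left_eq_self _ volume z]
          simp
      _ ≤ ∫ y, |Δ (f : E → ℝ) (z - y) * u y| := abs_integral_le_integral_abs
      _ ≤ ∫ y, (Metric.closedBall z 1).indicator (fun y => B * u y) y := by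
          refine integral_mono_of_nonneg (ae_of_all _ fun y => abs_nonneg _)
            ((integrable_indicator_iff measurableSet_closedBall).2 (hiu.const_mul B))
            (ae_of_all _ fun y => ?_)
          by_cases hy : y ∈ Metric.closedBall z 1
          · simp only [Set.indicator_of_mem hy, abs_mul, abs_of_nonneg (hu0 y)]
            exact mul_le_mul_of_nonneg_right (hB _) (hu0 y)
          · simp only [Set.indicator_of_notMem hy]
            rw [hfs (z - y)]
            · simp
            · intro h1
              apply hy
              rw [mem_closedBall_zero_iff] at h1
              rw [Metric.mem_closedBall, dist_comm, dist_eq_norm]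
              exact h1.trans (min_le_right _ _)
      _ = B * ∫ y in Metric.closedBall z 1, u y := by
          rw [integral_indicator measurableSet_closedBall, integral_const_mul]
      _ ≤ B * (C * (1 + ‖z‖) ^ M) := mul_le_mul_of_nonneg_left (hb z) hB0
  have hW0 := nonneg_of_laplacian_le_mul hlam hWc hWl hWb x
  have hneg : 0 < ∫ y, f y * Δ u (x - y) := by
    refine (hf2.continuous.mul (by have := hΔ.continuous; fun_prop)).integral_pos_of_hasCompactSupport_nonneg_nonzero
      hfc.mul_right (fun y => ?_) (x := 0) ?_
    · by_cases hy : dist y 0 < min r 1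
      · refine mul_nonneg f.nonneg (hr ?_).le
        rw [dist_eq_norm]
        simpa using hy.trans_le (min_le_left _ _)
      · have : f y = 0 := f.zero_of_le_dist (not_lt.1 hy)
        simp [this]
    · have : f 0 = 1 := f.one_of_mem_closedBall (by
        simp only [f, Metric.mem_closedBall, dist_self]
        positivity)
      simp [this, hx.ne']
  have : W x = - ∫ y, f y * Δ u (x - y) := by
    rw [← integral_neg]; simp [W]
  linarith

end MaximumPrinciples

/-! ### Laplacian of powers times powers of logarithms. -/

section PowLog

open Laplacian InnerProductSpace Module

/-- The profile `s ^ (-b) * (log s) ^ c`. -/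
noncomputable def powLog (b c s : ℝ) : ℝ := s ^ (-b) * Real.log s ^ c

theorem powLog_pos {b c s : ℝ} (hs : 1 < s) : 0 < powLog b c s :=
  mul_pos (Real.rpow_pos_of_pos (by linarith) _) (Real.rpow_pos_of_pos (Real.log_pos hs) _)

theorem powLog_zero (b : ℝ) : powLog b 0 = fun s => s ^ (-b) := by
  ext s; simp [powLog]

theorem mul_powLog_add_one {b c s : ℝ} (hs : 0 < s) : s * powLog (b + 1) c s = powLog b c s := by
  unfold powLog
  rw [← mul_assoc, show -b = 1 + -(b + 1) by ring, Real.rpow_add hs, Real.rpow_one]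

/-- The alternative `c = 0` permits pure powers at `s ≤ 1`, which is needed for barriers `(A + ‖x‖ ^
2) ^ (-b)` with small `A`. -/
theorem hasDerivAt_powLog {b c s : ℝ} (hs : 0 < s) (h : c = 0 ∨ 1 < s) :
    HasDerivAt (powLog b c) (-b * powLog (b + 1) c s + c * powLog (b + 1) (c - 1) s) s := by
  have h1 : HasDerivAt (fun s : ℝ => s ^ (-b)) (-b * s ^ (-b - 1)) s :=
    Real.hasDerivAt_rpow_const (Or.inl hs.ne')
  have e : -(b + 1) = -b - 1 := by ring
  rcases h with rfl | h
  · simpa [powLog_zero, e] using h1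
  · have h2 : HasDerivAt (fun s => Real.log s ^ c) (s⁻¹ * c * Real.log s ^ (c - 1)) s :=
      (Real.hasDerivAt_log hs.ne').rpow_const (Or.inl (Real.log_pos h).ne')
    refine (h1.mul h2).congr_deriv ?_
    have h3 : s ^ (-b) * s⁻¹ = s ^ (-b - 1) := by
      rw [Real.rpow_sub_one hs.ne', div_eq_mul_inv]
    simp only [powLog, e]
    rw [← h3]; ring

theorem hasDerivAt_powLog_two {b c s : ℝ} (hs : 0 < s) (h : c = 0 ∨ 1 < s) :
    HasDerivAt (fun s => -b * powLog (b + 1) c s + c * powLog (b + 1) (c - 1) s)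
      (b * (b + 1) * powLog (b + 2) c s - (2 * b + 1) * c * powLog (b + 2) (c - 1) s
        + c * (c - 1) * powLog (b + 2) (c - 2) s) s := by
  have e : b + 1 + 1 = b + 2 := by ring
  have e' : c - 1 - 1 = c - 2 := by ring
  have h1 := (hasDerivAt_powLog (b := b + 1) hs h).const_mul (-b)
  have h2 : HasDerivAt (fun s => c * powLog (b + 1) (c - 1) s)
      (c * (-(b + 1) * powLog (b + 1 + 1) (c - 1) s
        + (c - 1) * powLog (b + 1 + 1) (c - 1 - 1) s)) s := by
    rcases h with rfl | h
    · simpa using hasDerivAt_const s (0 : ℝ)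
    · exact (hasDerivAt_powLog (b := b + 1) hs (Or.inr h)).const_mul c
  refine (h1.add h2).congr_deriv ?_
  rw [e, e']; ring

variable {E : Type*} [NormedAddCommGroup E] [InnerProductSpace ℝ E] [FiniteDimensional ℝ E]

/-- The radial function `(A + ‖x‖ ^ 2) ^ (-b) * log (A + ‖x‖ ^ 2) ^ c`. -/
noncomputable def radialPowLog (A b c : ℝ) (x : E) : ℝ := powLog b c (A + ‖x‖ ^ 2)

omit [FiniteDimensional ℝ E] in
theorem contDiff_radialPowLog {A b c : ℝ} {n : WithTop ℕ∞} (hA : 0 < A) (h : c = 0 ∨ 1 < A) :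
    ContDiff ℝ n (radialPowLog A b c : E → ℝ) := by
  have h0 : ContDiff ℝ n fun x : E => A + ‖x‖ ^ 2 := contDiff_const.add (contDiff_norm_sq ℝ)
  have hp : ∀ x : E, A + ‖x‖ ^ 2 ≠ 0 := fun x => by positivity
  have h1 : ContDiff ℝ n fun x : E => (A + ‖x‖ ^ 2) ^ (-b) := h0.rpow_const_of_ne hp
  rcases h with rfl | h
  · have e : (radialPowLog A b 0 : E → ℝ) = fun x => (A + ‖x‖ ^ 2) ^ (-b) :=
      funext fun x => by simp [radialPowLog, powLog_zero]
    rwa [e]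
  · refine h1.mul ((h0.log hp).rpow_const_of_ne fun x => ?_)
    exact (Real.log_pos (by nlinarith [sq_nonneg ‖x‖])).ne'

/-- With `t = A + ‖x‖ ^ 2`, replace `‖x‖ ^ 2` by `t - A` in the radial formula: the terms without
`A` decay like `t ^ (-(b + 1))` up to logarithms, those with `A` one power faster. If `b = (n - 2) /
2`, the first coefficient vanishes and that of the next logarithmic order is `-4 * b * c`; this
cancellation drives all critical estimates. -/
theorem laplacian_radialPowLog {A b c : ℝ} (hA : 0 < A) (h : c = 0 ∨ 1 < A) (x : E) :
    Δ (radialPowLog A b c : E → ℝ) x =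
      (4 * b * (b + 1) - 2 * finrank ℝ E * b) * radialPowLog A (b + 1) c x
      + (2 * finrank ℝ E - 4 * (2 * b + 1)) * c * radialPowLog A (b + 1) (c - 1) x
      + 4 * c * (c - 1) * radialPowLog A (b + 1) (c - 2) x
      - 4 * A * (b * (b + 1) * radialPowLog A (b + 2) c x
        - (2 * b + 1) * c * radialPowLog A (b + 2) (c - 1) x
        + c * (c - 1) * radialPowLog A (b + 2) (c - 2) x) := by
  have hs : ∀ s, A ≤ s → 0 < s ∧ (c = 0 ∨ 1 < s) := fun s hs =>
    ⟨hA.trans_le hs, h.imp id fun h => h.trans_le hs⟩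
  have := laplacian_radial (E := E) (fun s h => hasDerivAt_powLog (b := b) (hs s h).1 (hs s h).2)
    (fun s h => hasDerivAt_powLog_two (hs s h).1 (hs s h).2)
    (contDiff_radialPowLog (n := 2) hA h) x
  refine this.trans ?_
  have ht : 0 < A + ‖x‖ ^ 2 := by positivity
  have e : b + 1 + 1 = b + 2 := by ring
  have hm : ∀ c, (A + ‖x‖ ^ 2) * powLog (b + 2) c (A + ‖x‖ ^ 2) = powLog (b + 1) c (A + ‖x‖ ^ 2) :=
    fun c => by rw [← e, mul_powLog_add_one ht]
  simp only [radialPowLog]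
  rw [← hm c, ← hm (c - 1), ← hm (c - 2)]
  ring

end PowLog

/-! ### A test function on balls and the resulting bound on potentials. -/

section BallTest

open Laplacian InnerProductSpace Module

theorem hasDerivAt_max_zero_pow (k : ℕ) (x : ℝ) :
    HasDerivAt (fun y : ℝ => max 0 y ^ (k + 2)) ((k + 2) * max 0 x ^ (k + 1)) x := by
  rcases lt_trichotomy x 0 with hx | rfl | hx
  · rw [max_eq_left hx.le]
    simp only [ne_eq, Nat.add_eq_zero_iff, one_ne_zero, and_false, not_false_eq_true, zero_pow,
      mul_zero]
    refine (hasDerivAt_const x (0 : ℝ)).congr_of_eventuallyEq ?_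
    filter_upwards [gt_mem_nhds hx] with y hy
    simp [max_eq_left hy.le]
  · simp only [max_self, ne_eq, Nat.add_eq_zero_iff, one_ne_zero, and_false, not_false_eq_true,
      zero_pow, mul_zero]
    have h2 : HasDerivAt (fun y : ℝ => y ^ (k + 2)) 0 0 := by
      simpa using hasDerivAt_pow (k + 2) (0 : ℝ)
    rw [hasDerivAt_iff_isLittleO] at h2 ⊢
    -- At the corner, `|max 0 y| ≤ |y|` transfers the zero derivative from `y ^ (k + 2)`.
    refine (Asymptotics.isBigO_of_le _ fun y => ?_).trans_isLittleO h2
    simp only [max_self, ne_eq, Nat.add_eq_zero_iff, OfNat.ofNat_ne_zero, and_false,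
      not_false_eq_true, zero_pow, sub_zero, smul_eq_mul, mul_zero, norm_pow]
    exact pow_le_pow_left₀ (norm_nonneg _) (by
      rcases le_total 0 y with h | h <;> simp [h]) _
  · rw [max_eq_right hx.le]
    have h2 : HasDerivAt (fun y : ℝ => y ^ (k + 2)) ((k + 2) * x ^ (k + 1)) x := by
      simpa using hasDerivAt_pow (k + 2) x
    refine h2.congr_of_eventuallyEq ?_
    filter_upwards [lt_mem_nhds hx] with y hy
    simp [max_eq_right hy.le]

theorem contDiff_max_zero_pow_four : ContDiff ℝ 2 fun y : ℝ => max 0 y ^ 4 := by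
  have h1 : deriv (fun y : ℝ => max 0 y ^ 3) = fun y => 3 * max 0 y ^ 2 := funext fun y => by
    rw [(hasDerivAt_max_zero_pow 1 y).deriv]; norm_num
  have h2 : deriv (fun y : ℝ => max 0 y ^ 4) = fun y => 4 * max 0 y ^ 3 := funext fun y => by
    rw [(hasDerivAt_max_zero_pow 2 y).deriv]; norm_num
  have h3 : ContDiff ℝ 1 fun y : ℝ => max 0 y ^ 3 := by
    rw [contDiff_one_iff_deriv, h1]
    exact ⟨fun y => (hasDerivAt_max_zero_pow 1 y).differentiableAt, by fun_prop⟩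
  rw [show (2 : WithTop ℕ∞) = 1 + 1 by norm_num, contDiff_succ_iff_deriv]
  refine ⟨fun y => (hasDerivAt_max_zero_pow 2 y).differentiableAt, by simp, ?_⟩
  rw [h2]
  exact contDiff_const.mul h3

variable {E : Type*} [NormedAddCommGroup E] [InnerProductSpace ℝ E] [FiniteDimensional ℝ E]

/-- A compactly supported `C²` function on the ball of radius `R`, positive inside. -/
noncomputable def ballTest (R : ℝ) (x : E) : ℝ := max 0 (1 - (0 + ‖x‖ ^ 2) / R ^ 2) ^ 4

omit [FiniteDimensional ℝ E] in
theorem contDiff_ballTest (R : ℝ) : ContDiff ℝ 2 (ballTest R : E → ℝ) :=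
  contDiff_max_zero_pow_four.comp
    (contDiff_const.sub ((contDiff_const.add (contDiff_norm_sq ℝ)).div_const _))

omit [InnerProductSpace ℝ E] [FiniteDimensional ℝ E] in
theorem ballTest_nonneg (R : ℝ) (x : E) : 0 ≤ ballTest R x := by unfold ballTest; positivity

omit [InnerProductSpace ℝ E] [FiniteDimensional ℝ E] in
theorem ballTest_eq_zero {R : ℝ} (hR : 0 < R) {x : E} (hx : R ≤ ‖x‖) : ballTest R x = 0 := by
  have : 1 ≤ ‖x‖ ^ 2 / R ^ 2 := by
    rw [one_le_div (by positivity)]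
    exact pow_le_pow_left₀ hR.le hx 2
  simp [ballTest, this]

theorem hasCompactSupport_ballTest {R : ℝ} (hR : 0 < R) :
    HasCompactSupport (ballTest R : E → ℝ) :=
  HasCompactSupport.intro (isCompact_closedBall (0 : E) R) fun x hx =>
    ballTest_eq_zero hR (by simpa using (not_le.1 (by simpa using hx)).le)

/-- With `p = 1 - ‖x‖ ^ 2 / R ^ 2`, right side minus left side is `p ^ 2 / R ^ 2` times the square
`((n + 6) * p - 12) ^ 2 / 3`. Thus `ballTest R` can play the role of a first Dirichlet eigenfunction
of the ball, with an explicit constant. -/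
theorem neg_laplacian_ballTest_le {R : ℝ} (hR : 0 < R) (x : E) :
    -Δ (ballTest R : E → ℝ) x ≤ ((finrank ℝ E : ℝ) + 6) ^ 2 / 3 / R ^ 2 * ballTest R x := by
  have hl : ∀ s : ℝ, HasDerivAt (fun s => 1 - s / R ^ 2) (-(1 / R ^ 2)) s := fun s => by
    simpa using ((hasDerivAt_id s).div_const (R ^ 2)).const_sub 1
  have := laplacian_radial (E := E) (A := 0) (φ := fun s => max 0 (1 - s / R ^ 2) ^ 4)
    (φ' := fun s => -(1 / R ^ 2) * 4 * max 0 (1 - s / R ^ 2) ^ 3)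
    (φ'' := fun s => 12 / R ^ 4 * max 0 (1 - s / R ^ 2) ^ 2) (fun s _ => ?_) (fun s _ => ?_)
    (contDiff_ballTest R) x
  · rw [show Δ (ballTest R : E → ℝ) x = _ from this]
    unfold ballTest
    rw [zero_add]
    set n : ℝ := (finrank ℝ E : ℝ)
    rcases le_total 0 (1 - ‖x‖ ^ 2 / R ^ 2) with h | h
    · rw [max_eq_right h]
      set p := 1 - ‖x‖ ^ 2 / R ^ 2 with hp
      have hx : ‖x‖ ^ 2 = (1 - p) * R ^ 2 := by rw [hp]; field_simp; ring
      rw [hx, ← sub_nonneg]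
      have e : (n + 6) ^ 2 / 3 / R ^ 2 * p ^ 4 - -(4 * ((1 - p) * R ^ 2) * (12 / R ^ 4 * p ^ 2)
          + 2 * n * (-(1 / R ^ 2) * 4 * p ^ 3)) =
          p ^ 2 / R ^ 2 * (((n + 6) * p - 12) ^ 2 / 3) := by
        field_simp; ring
      rw [e]; positivity
    · rw [max_eq_left h]; simp
  · have := (hasDerivAt_max_zero_pow 2 (1 - s / R ^ 2)).comp s (hl s)
    refine this.congr_deriv ?_
    push_cast; ring
  · have := ((hasDerivAt_max_zero_pow 1 (1 - s / R ^ 2)).comp s (hl s)).const_mul (-(1 / R ^ 2) * 4)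
    refine this.congr_deriv ?_
    push_cast; field_simp; ring

variable [MeasurableSpace E] [BorelSpace E]

theorem integral_ballTest_mul_neg_laplacian_le {R : ℝ} (hR : 0 < R) {g : E → ℝ}
    (hg : ContDiff ℝ 2 g) (hg0 : ∀ x, 0 ≤ g x) :
    ∫ x, ballTest R x * -Δ g x ≤
      ((finrank ℝ E : ℝ) + 6) ^ 2 / 3 / R ^ 2 * ∫ x, ballTest R x * g x := by
  have hc := hasCompactSupport_ballTest (E := E) hR
  have hη := contDiff_ballTest (E := E) R
  have hΔ : Continuous (Δ (ballTest R : E → ℝ)) := (hη.laplacian (m := 0) (by norm_num)).continuous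
  have hΔc : HasCompactSupport (Δ (ballTest R : E → ℝ)) := by
    refine HasCompactSupport.intro hc fun x hx => ?_
    have h1 : (ballTest R : E → ℝ) =ᶠ[nhds x] fun _ => 0 := by
      filter_upwards [(isClosed_tsupport _).isOpen_compl.mem_nhds hx] with z hz
      exact image_eq_zero_of_notMem_tsupport hz
    rw [(laplacian_congr_nhds h1).eq_of_nhds]; simp
  have e : ∫ x, ballTest R x * -Δ g x = ∫ x, -Δ (ballTest R : E → ℝ) x * g x := by
    simp only [mul_neg, neg_mul, integral_neg, integral_mul_laplacian hη hg hc]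
  rw [e, ← integral_const_mul]
  refine integral_mono (integrable_mul_of_hasCompactSupport hΔ.neg hg.continuous hΔc.neg)
    ((integrable_mul_of_hasCompactSupport hη.continuous hg.continuous hc).const_mul _) fun x => ?_
  simp only
  rw [← mul_assoc]
  exact mul_le_mul_of_nonneg_right (neg_laplacian_ballTest_le hR x) (hg0 x)

/-- If `V = -Δ u + lam * u ≥ 0` and `-Δ V ≥ m * u` on a ball of radius `R`, then `m` is at most of
order `R ^ (-2)`. -/
theorem mul_sq_le_of_neg_laplacian_ge {u : E → ℝ} {lam m R : ℝ} {ξ : E}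
    (hR : 1 ≤ R) (hu : ContDiff ℝ 4 u) (hu0 : ∀ x, 0 ≤ u x) (huξ : 0 < u ξ)
    (hV : ∀ x, 0 ≤ lam * u x - Δ u x)
    (hm : ∀ x ∈ Metric.ball ξ R, m * u x ≤ Δ (Δ u) x - lam * Δ u x) :
    m * R ^ 2 ≤ ((finrank ℝ E : ℝ) + 6) ^ 2 / 3 * (((finrank ℝ E : ℝ) + 6) ^ 2 / 3 + lam) := by
  have hR0 : 0 < R := by linarith
  set c : ℝ := ((finrank ℝ E : ℝ) + 6) ^ 2 / 3 with hc_def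
  have hc0 : 0 < c := by positivity
  wlog hξ : ξ = 0 generalizing u ξ
  · refine this (u := fun x => u (x + ξ)) (ξ := 0) (hu.comp (contDiff_id.add contDiff_const))
      (fun x => hu0 _) (by simpa using huξ) (fun x => ?_) (fun x hx => ?_) rfl
    · rw [laplacian_comp_add_right (hu.of_le (by norm_num))]
      exact hV _
    · have e : Δ (fun x => u (x + ξ)) = fun x => Δ u (x + ξ) :=
        funext fun x => laplacian_comp_add_right (hu.of_le (by norm_num)) _ _
      rw [e, laplacian_comp_add_right (hu.laplacian (by norm_num))]
      refine hm _ ?_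
      simpa [dist_eq_norm] using hx
  subst hξ
  have hu2 : ContDiff ℝ 2 u := hu.of_le (by norm_num)
  have hΔ : ContDiff ℝ 2 (Δ u) := hu.laplacian (by norm_num)
  have hΔΔ : Continuous (Δ (Δ u)) := (hΔ.laplacian (m := 0) (by norm_num)).continuous
  have hc := hasCompactSupport_ballTest (E := E) hR0
  have hη := contDiff_ballTest (E := E) R
  set V : E → ℝ := lam • u - Δ u
  have hVc : ContDiff ℝ 2 V := (hu2.const_smul lam).sub hΔ
  have hI : ∀ {v : E → ℝ}, Continuous v → Integrable fun x => ballTest R x * v x := fun hv =>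
    integrable_mul_of_hasCompactSupport hη.continuous hv hc
  have hVΔ : ∀ x, -Δ V x = Δ (Δ u) x - lam * Δ u x := fun x => by
    have hlu : ContDiff ℝ 2 (lam • u) := hu2.const_smul lam
    rw [ContDiffAt.laplacian_sub hlu.contDiffAt hΔ.contDiffAt,
      laplacian_smul lam hu2.contDiffAt, smul_eq_mul]
    ring
  set I := ∫ x, ballTest R x * u x
  have hIpos : 0 < I := by
    refine (hη.continuous.mul hu.continuous).integral_pos_of_hasCompactSupport_nonneg_nonzero
      hc.mul_right (fun x => mul_nonneg (ballTest_nonneg _ _) (hu0 x)) (x := 0) ?_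
    simp [ballTest, huξ.ne']
  have h1 : m * I ≤ ∫ x, ballTest R x * -Δ V x := by
    rw [← integral_const_mul]
    refine integral_mono ((hI hu.continuous).const_mul m)
      (hI (hVc.laplacian (m := 0) (by norm_num)).continuous.neg) fun x => ?_
    by_cases hx : ‖x‖ < R
    · have := mul_le_mul_of_nonneg_left (hm x (by simpa using hx)) (ballTest_nonneg R x)
      simp only [hVΔ]
      linarith
    · simp [ballTest_eq_zero hR0 (not_lt.1 hx)]
  -- Green's identity is used twice: once for `V`, gaining `R ^ (-2)`, and once for `u`, where `R ≥
  -- 1` suffices to bound the weighted integral of `V` by `(lam + c) * I`. Dividing by `I > 0`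
  -- leaves the bound on `m`.
  have h2 := integral_ballTest_mul_neg_laplacian_le hR0 hVc hV
  have h3 := integral_ballTest_mul_neg_laplacian_le hR0 hu2 hu0
  have h4 : ∫ x, ballTest R x * V x = lam * I + ∫ x, ballTest R x * -Δ u x := by
    rw [← integral_const_mul, ← integral_add ((hI hu.continuous).const_mul _)
      (hI (v := fun x => -Δ u x) hΔ.continuous.neg)]
    refine integral_congr_ae (ae_of_all _ fun x => ?_)
    simp only [V, Pi.sub_apply, Pi.smul_apply, smul_eq_mul]; ring
  rw [h4, ← hc_def] at h2
  rw [← hc_def] at h3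
  have h5 : c / R ^ 2 * I ≤ c * I := by
    refine mul_le_mul_of_nonneg_right (div_le_self hc0.le ?_) hIpos.le
    nlinarith
  have h6 : m * I ≤ c / R ^ 2 * ((lam + c) * I) := by
    refine h1.trans (h2.trans (mul_le_mul_of_nonneg_left ?_ (by positivity)))
    have : ∫ x, ballTest R x * -Δ u x ≤ c * I := h3.trans h5
    linarith
  have h7 : m ≤ c / R ^ 2 * (lam + c) := by
    rw [← mul_assoc] at h6
    exact le_of_mul_le_mul_right h6 hIpos
  calc m * R ^ 2 ≤ c / R ^ 2 * (lam + c) * R ^ 2 := by gcongr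
    _ = c * (c + lam) := by field_simp; ring

end BallTest

/-! ### Elementary asymptotics of power-logarithm profiles. -/

section PowLogEstimates

open Filter Topology

theorem one_le_log_of_four_le {t : ℝ} (ht : 4 ≤ t) : 1 ≤ Real.log t := by
  rw [Real.le_log_iff_exp_le (by linarith)]
  exact (Real.exp_one_lt_d9.trans (by norm_num)).le.trans ht

theorem powLog_le_powLog {b b' c c' t : ℝ} (ht : 4 ≤ t) (hb : b ≤ b') (hc : c' ≤ c) :
    powLog b' c' t ≤ powLog b c t := by
  have hl := one_le_log_of_four_le ht
  exact mul_le_mul (Real.rpow_le_rpow_of_exponent_le (by linarith) (by linarith))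
    (Real.rpow_le_rpow_of_exponent_le hl hc) (Real.rpow_nonneg (by linarith) _)
    (Real.rpow_nonneg (by linarith) _)

theorem powLog_add_one_le {b c t : ℝ} (ht : 4 ≤ t) : powLog (b + 1) (c + 1) t ≤ powLog b c t := by
  have hl := one_le_log_of_four_le ht
  have h1 : Real.log t ≤ t := (Real.log_le_sub_one_of_pos (by linarith)).trans (by linarith)
  rw [← mul_powLog_add_one (b := b) (c := c) (by linarith : 0 < t)]
  unfold powLog
  rw [Real.rpow_add_one (by linarith : Real.log t ≠ 0)]
  have h2 : 0 ≤ t ^ (-(b + 1)) * Real.log t ^ c :=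
    mul_nonneg (Real.rpow_nonneg (by linarith) _) (Real.rpow_nonneg (by linarith) _)
  nlinarith

theorem powLog_mul_powLog {b b' c c' t : ℝ} (ht : 1 < t) :
    powLog b c t * powLog b' c' t = powLog (b + b') (c + c') t := by
  have h0 : 0 < t := by linarith
  have hl := Real.log_pos ht
  simp only [powLog, neg_add, Real.rpow_add h0, Real.rpow_add hl]; ring

theorem powLog_rpow {b c t r : ℝ} (ht : 1 < t) :
    powLog b c t ^ r = powLog (b * r) (c * r) t := by
  have h0 : 0 < t := by linarith
  have hl := Real.log_pos ht
  unfold powLog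
  rw [Real.mul_rpow (by positivity) (by positivity), ← Real.rpow_mul h0.le, ← Real.rpow_mul hl.le,
    neg_mul]

theorem rpow_comparable {k x y : ℝ} (a : ℝ) (hk : 1 ≤ k) (hy : 0 < y) (h1 : y / k ≤ x)
    (h2 : x ≤ k * y) : k ^ (-|a|) * y ^ a ≤ x ^ a := by
  have hk0 : 0 < k := by linarith
  rcases le_total 0 a with ha | ha
  · rw [abs_of_nonneg ha]
    calc k ^ (-a) * y ^ a = (y / k) ^ a := by
          rw [Real.div_rpow hy.le hk0.le, Real.rpow_neg hk0.le]; field_simp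
      _ ≤ x ^ a := Real.rpow_le_rpow (by positivity) h1 ha
  · rw [abs_of_nonpos ha, neg_neg, ← Real.mul_rpow hk0.le hy.le]
    have hx : 0 < x := (by positivity : 0 < y / k).trans_le h1
    exact Real.rpow_le_rpow_of_nonpos hx h2 ha

theorem log_comparable {T t : ℝ} (hT : 16 ≤ T) (h1 : T / 4 ≤ t) (h2 : t ≤ 4 * T) :
    Real.log T / 2 ≤ Real.log t ∧ Real.log t ≤ 2 * Real.log T := by
  have h16 : Real.log 16 = 2 * Real.log 4 := by
    rw [← Real.log_rpow (by norm_num)]; norm_num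
  have h16' : Real.log 16 ≤ Real.log T := Real.log_le_log (by norm_num) hT
  have h4 : 0 ≤ Real.log 4 := Real.log_nonneg (by norm_num)
  have ha : Real.log T - Real.log 4 ≤ Real.log t := by
    rw [← Real.log_div (by linarith) (by norm_num)]
    exact Real.log_le_log (by linarith) h1
  have hb : Real.log t ≤ Real.log 4 + Real.log T := by
    rw [← Real.log_mul (by norm_num) (by linarith)]
    exact Real.log_le_log (by linarith) h2
  constructor <;> linarith

/-- A factor `4` in `t` corresponds to a factor `2` in `‖x‖`: on balls whose radius is half the norm
of the centre, the profile may be replaced by its value at the centre. `T ≥ 16` makes `log 4` at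
most half of `log T`. -/
theorem powLog_comparable (b c : ℝ) : ∃ k > 0, ∀ T t : ℝ, 16 ≤ T → T / 4 ≤ t → t ≤ 4 * T →
    k * powLog b c T ≤ powLog b c t := by
  refine ⟨4 ^ (-|-b|) * 2 ^ (-|c|), by positivity, fun T t hT h1 h2 => ?_⟩
  obtain ⟨h3, h4⟩ := log_comparable hT h1 h2
  have hl : 0 < Real.log T := Real.log_pos (by linarith)
  have h5 := rpow_comparable (-b) (by norm_num) (by linarith) h1 h2
  have h6 := rpow_comparable c (by norm_num) hl h3 h4
  unfold powLog
  calc _ = (4 ^ (-|-b|) * T ^ (-b)) * (2 ^ (-|c|) * Real.log T ^ c) := by ring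
    _ ≤ _ := mul_le_mul h5 h6 (by positivity) (Real.rpow_nonneg (by linarith) _)

theorem tendsto_powLog_zero {b : ℝ} (c : ℝ) (hb : 0 < b) :
    Tendsto (powLog b c) atTop (𝓝 0) := by
  have h := (isLittleO_log_rpow_rpow_atTop c hb).tendsto_div_nhds_zero
  refine h.congr' ?_
  filter_upwards [eventually_gt_atTop 0] with x hx
  rw [powLog, Real.rpow_neg hx.le]; field_simp

/-- If either conclusion failed, the reciprocal profile `powLog (-e) (-κ)`, shifted by one power,
would tend to zero, contradicting boundedness. This converts the ball test into conditions on
exponents. -/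
theorem exponents_of_powLog_mul_le {e κ C T₀ : ℝ}
    (h : ∀ T, T₀ ≤ T → powLog e κ T * T ≤ C) : 1 ≤ e ∧ (e = 1 → κ ≤ 0) := by
  have h' : ∀ᶠ T in atTop, powLog (e - 1) κ T ≤ C := by
    filter_upwards [eventually_ge_atTop T₀, eventually_gt_atTop 0] with T hT h0
    have := h T hT
    rw [← mul_powLog_add_one h0, sub_add_cancel]
    linarith
  have key : ∀ {e κ : ℝ}, (∀ᶠ T in atTop, powLog e κ T ≤ C) →
      Tendsto (powLog (-e) (-κ)) atTop (𝓝 0) → False := by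
    intro e κ h1 h2
    have h3 := h2.eventually (gt_mem_nhds (show (0 : ℝ) < 1 / (|C| + 1) by positivity))
    obtain ⟨T, h1, h3, hT⟩ := (h1.and (h3.and (eventually_gt_atTop 1))).exists
    have h4 := powLog_mul_powLog (b := e) (b' := -e) (c := κ) (c' := -κ) hT
    simp only [add_neg_cancel] at h4
    have h5 : powLog 0 0 T = 1 := by simp [powLog]
    rw [h5] at h4
    have h6 := powLog_pos (b := e) (c := κ) hT
    rw [lt_div_iff₀ (by positivity)] at h3
    have h7 := powLog_pos (b := -e) (c := -κ) hT
    have h8 := le_abs_self C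
    nlinarith
  constructor
  · by_contra! he
    exact key h' (tendsto_powLog_zero _ (by linarith))
  · intro he
    by_contra! hκ
    refine key h' ?_
    have h1 : Tendsto (fun T => (Real.log T) ^ (-κ)) atTop (𝓝 0) :=
      (tendsto_rpow_neg_atTop hκ).comp Real.tendsto_log_atTop
    refine h1.congr fun T => ?_
    simp [powLog, he]

end PowLogEstimates

/-! ### Pointwise lower bounds for superharmonic solutions and their consequences. -/

section LowerBounds

open Laplacian InnerProductSpace Module Filter Topology

variable {E : Type*} [NormedAddCommGroup E] [InnerProductSpace ℝ E] [FiniteDimensional ℝ E]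

theorem tendsto_radialPowLog_cocompact {A b : ℝ} (c : ℝ) (hb : 0 < b) :
    Tendsto (radialPowLog A b c : E → ℝ) (cocompact E) (𝓝 0) := by
  refine (tendsto_powLog_zero c hb).comp (tendsto_atTop_add_const_left _ _ ?_)
  exact (tendsto_pow_atTop two_ne_zero).comp tendsto_norm_cocompact_atTop

omit [InnerProductSpace ℝ E] [FiniteDimensional ℝ E] in
theorem four_le_four_add_norm_sq (x : E) : 4 ≤ 4 + ‖x‖ ^ 2 := by nlinarith [sq_nonneg ‖x‖]

omit [FiniteDimensional ℝ E] [InnerProductSpace ℝ E] in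
theorem radialPowLog_pos {b c : ℝ} (x : E) : 0 < radialPowLog 4 b c x :=
  powLog_pos (by linarith [four_le_four_add_norm_sq x])

/-- A strict subsolution away from the origin. -/
theorem laplacian_powBarrier_pos {A b r : ℝ} (hn : (finrank ℝ E : ℝ) = 2 * (b + 1)) (hb : 0 < b)
    (hA : 0 < A) (hr0 : 0 < r) (hr1 : r ≤ 1)
    (hA1 : 4 * A * (b * (b + 1) + (b + 1 / 2) * (b + 1 / 2 + 1)) < 2 * (b + 1 / 2) * r ^ 2)
    {x : E} (hx : r ≤ ‖x‖) :
    0 < Δ (radialPowLog A b 0 + radialPowLog A (b + 1 / 2) 0 : E → ℝ) x := by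
  have hpow : ∀ (d : ℝ) (x : E), radialPowLog A d 0 x = (A + ‖x‖ ^ 2) ^ (-d) := fun d x => by
    simp [radialPowLog, powLog_zero]
  have hc1 : ∀ d, ContDiff ℝ 2 (radialPowLog A d 0 : E → ℝ) := fun d =>
    contDiff_radialPowLog hA (Or.inl rfl)
  rw [ContDiffAt.laplacian_add (hc1 b).contDiffAt (hc1 _).contDiffAt,
    laplacian_radialPowLog hA (Or.inl rfl), laplacian_radialPowLog hA (Or.inl rfl)]
  have ht : 0 < A + ‖x‖ ^ 2 := by positivity
  have hrt : r ^ 2 ≤ A + ‖x‖ ^ 2 := by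
    have := pow_le_pow_left₀ hr0.le hx 2
    linarith
  -- Since `n = 2 * (b + 1)`, the leading coefficient for the exponent `b` is zero and that for `b +
  -- 1 / 2` is `2 * (b + 1 / 2) > 0`. The remaining negative terms carry the factor `A` and are
  -- absorbed for `‖x‖ ≥ r` by `hA1`.
  simp only [hpow, hn]
  have e1 : (A + ‖x‖ ^ 2) ^ (-(b + 2))
      = (A + ‖x‖ ^ 2) ^ (1 / 2 : ℝ) * (A + ‖x‖ ^ 2) ^ (-(b + 1 / 2 + 2)) := by
    rw [← Real.rpow_add ht]; congr 1; ring
  have e2 : (A + ‖x‖ ^ 2) ^ (-(b + 1 / 2 + 1))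
      = (A + ‖x‖ ^ 2) * (A + ‖x‖ ^ 2) ^ (-(b + 1 / 2 + 2)) := by
    rw [← Real.rpow_one_add' ht.le]
    · congr 1; ring
    · linarith
  rw [e1, e2]
  generalize A + ‖x‖ ^ 2 = t at *
  have hp : 0 < t ^ (-(b + 1 / 2 + 2)) := Real.rpow_pos_of_pos ht _
  generalize t ^ (-(b + 1 / 2 + 2)) = p at *
  have h3 : r * t ^ (1 / 2 : ℝ) ≤ t := by
    rw [← Real.sqrt_eq_rpow]
    have h1 := mul_le_mul_of_nonneg_right (Real.le_sqrt_of_sq_le hrt) (Real.sqrt_nonneg t)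
    rwa [Real.mul_self_sqrt ht.le] at h1
  have hy0 : 0 ≤ t ^ (1 / 2 : ℝ) := Real.rpow_nonneg ht.le _
  generalize t ^ (1 / 2 : ℝ) = y at *
  have h6 : r ^ 2 * y ≤ t := by
    have := mul_le_mul_of_nonneg_right hr1 (mul_nonneg hr0.le hy0)
    linarith
  have h4 : 4 * A * (b * (b + 1) * y + (b + 1 / 2) * (b + 1 / 2 + 1)) < 2 * (b + 1 / 2) * t := by
    have h7 := mul_le_mul_of_nonneg_left h6 (by positivity : 0 ≤ 4 * A * (b * (b + 1)))
    have h8 := mul_le_mul_of_nonneg_left hrt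
      (by positivity : 0 ≤ 4 * A * ((b + 1 / 2) * (b + 1 / 2 + 1)))
    have h9 := mul_lt_mul_of_pos_right hA1 ht
    refine lt_of_mul_lt_mul_left (a := r ^ 2) ?_ (by positivity)
    linarith
  have h5 := mul_lt_mul_of_pos_right h4 hp
  linarith

/-- A superharmonic function dominates a multiple of the fundamental solution. -/
theorem exists_le_of_laplacian_nonpos {u : E → ℝ} (hn : 3 ≤ finrank ℝ E) (hu : ContDiff ℝ 2 u)
    (hu0 : ∀ x, 0 ≤ u x) (hΔ : ∀ x, Δ u x ≤ 0) (h0 : 0 < u 0) :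
    ∃ c > 0, ∀ x, c * radialPowLog 4 (((finrank ℝ E : ℝ) - 2) / 2) 0 x ≤ u x := by
  have hn' : (3 : ℝ) ≤ (finrank ℝ E : ℝ) := by exact_mod_cast hn
  set n : ℝ := (finrank ℝ E : ℝ) with hn_def
  set b : ℝ := (n - 2) / 2 with hb_def
  have hb : 0 < b := by simp only [hb_def]; linarith
  obtain ⟨r₀, hr₀, hr⟩ := Metric.eventually_nhds_iff.1
    (hu.continuous.continuousAt.eventually (lt_mem_nhds (half_lt_self h0)))
  set r := min r₀ 1 with hr_def
  have hr0 : 0 < r := by positivity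
  have hr1 : r ≤ 1 := min_le_right _ _
  set b₁ := b + 1 / 2 with hb₁_def
  have hb₁ : 0 < b₁ := by positivity
  set D := b * (b + 1) + b₁ * (b₁ + 1) with hD
  have hD0 : 0 < D := by positivity
  -- Small enough for `hA1`, which makes `Z` strictly subharmonic outside the ball of radius `r`,
  -- and at most `4`, so that the final bound can be stated with `4` in place of `A`.
  set A := b₁ * r ^ 2 / (4 * D + b₁) with hA_def
  have hA : 0 < A := by positivity
  have hA1 : 4 * A * D < 2 * b₁ * r ^ 2 := by
    rw [hA_def]
    have : 4 * (b₁ * r ^ 2 / (4 * D + b₁)) * D = (b₁ * r ^ 2) * (4 * D / (4 * D + b₁)) := by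
      field_simp
    rw [this]
    have h1 : 4 * D / (4 * D + b₁) < 1 := by rw [div_lt_one (by positivity)]; linarith
    have h2 : 0 < b₁ * r ^ 2 := by positivity
    nlinarith
  have hA4 : A ≤ 4 := by
    rw [hA_def, div_le_iff₀ (by positivity)]
    have : r ^ 2 ≤ 1 := pow_le_one₀ hr0.le hr1
    nlinarith
  have hpow : ∀ (d : ℝ) (x : E), radialPowLog A d 0 x = (A + ‖x‖ ^ 2) ^ (-d) := fun d x => by
    simp [radialPowLog, powLog_zero]
  have htend : ∀ d > 0, Tendsto (radialPowLog A d 0 : E → ℝ) (cocompact E) (𝓝 0) := fun d hd =>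
    tendsto_radialPowLog_cocompact 0 hd
  set Z : E → ℝ := radialPowLog A b 0 + radialPowLog A b₁ 0 with hZ
  have hc1 : ∀ d, ContDiff ℝ 2 (radialPowLog A d 0 : E → ℝ) := fun d =>
    contDiff_radialPowLog hA (Or.inl rfl)
  have hZc : ContDiff ℝ 2 Z := (hc1 b).add (hc1 b₁)
  set S := A ^ (-b) + A ^ (-b₁) with hS
  have hS0 : 0 < S := by positivity
  have hZS : ∀ x, Z x ≤ S := fun x => by
    simp only [hZ, Pi.add_apply, hpow]
    have hx : A ≤ A + ‖x‖ ^ 2 := by nlinarith [sq_nonneg ‖x‖]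
    exact add_le_add (Real.rpow_le_rpow_of_nonpos hA hx (by linarith))
      (Real.rpow_le_rpow_of_nonpos hA hx (by linarith))
  have hZΔ : ∀ x, r ≤ ‖x‖ → 0 < Δ Z x := fun x hx =>
    laplacian_powBarrier_pos (by simp only [← hn_def, hb_def]; ring) hb hA hr0 hr1 hA1 hx
  -- Then `δ * Z ≤ u 0 / 2 < u` inside the ball of radius `r`, so `u - δ • Z` can be negative only
  -- where `Z` is strictly subharmonic.
  set δ := u 0 / 2 / S with hδ_def
  have hδ : 0 < δ := by positivity
  have key := nonneg_of_laplacian_neg (g := u - δ • Z) (hu.sub (hZc.const_smul δ)) (fun ε hε => ?_)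
    (fun x hx => ?_)
  · refine ⟨δ, hδ, fun x => ?_⟩
    have h1 := key x
    simp only [Pi.sub_apply, Pi.smul_apply, smul_eq_mul, sub_nonneg] at h1
    refine le_trans (mul_le_mul_of_nonneg_left ?_ hδ.le) h1
    have h2 : radialPowLog 4 b 0 x ≤ radialPowLog A b 0 x := by
      rw [hpow]
      simp only [radialPowLog, powLog_zero]
      exact Real.rpow_le_rpow_of_nonpos (by positivity) (by linarith) (by linarith)
    have h3 : 0 ≤ radialPowLog A b₁ 0 x := by rw [hpow]; positivity
    simp only [hZ, Pi.add_apply]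
    linarith
  · have h1 : Tendsto Z (cocompact E) (𝓝 0) := by
      have := (htend b hb).add (htend b₁ hb₁)
      rwa [add_zero] at this
    filter_upwards [h1.eventually (gt_mem_nhds (show 0 < ε / δ by positivity))] with x hx
    rw [lt_div_iff₀ hδ] at hx
    have := hu0 x
    simp only [Pi.sub_apply, Pi.smul_apply, smul_eq_mul]
    linarith
  · simp only [Pi.sub_apply, Pi.smul_apply, smul_eq_mul] at hx
    have hxr : r ≤ ‖x‖ := by
      by_contra! h
      have h1 := hr (y := x) (by rw [dist_zero_right]; exact h.trans_le (min_le_left _ _))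
      have h2 : δ * Z x ≤ u 0 / 2 := by
        calc δ * Z x ≤ δ * S := mul_le_mul_of_nonneg_left (hZS x) hδ.le
          _ = u 0 / 2 := by rw [hδ_def]; field_simp
      linarith
    have hδZ : ContDiff ℝ 2 (δ • Z) := hZc.const_smul δ
    rw [ContDiffAt.laplacian_sub hu.contDiffAt hδZ.contDiffAt, laplacian_smul δ hZc.contDiffAt,
      smul_eq_mul]
    have h1 := mul_pos hδ (hZΔ x hxr)
    have h2 := hΔ x
    linarith

/-- A subsolution that grows like the fundamental solution times a power of the logarithm. -/
theorem neg_laplacian_logBarrier_le {β : ℝ} (hn : 3 ≤ finrank ℝ E) (hβ : -1 < β) :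
    ∃ C > 0, ∀ M : ℝ, 0 ≤ M → ∀ x : E,
      -Δ (radialPowLog 4 (((finrank ℝ E : ℝ) - 2) / 2) (β + 1)
        - M • radialPowLog 4 (((finrank ℝ E : ℝ) - 2) / 2) 0 : E → ℝ) x
      ≤ C * radialPowLog 4 ((finrank ℝ E : ℝ) / 2) β x := by
  have hn' : (3 : ℝ) ≤ (finrank ℝ E : ℝ) := by exact_mod_cast hn
  set n : ℝ := (finrank ℝ E : ℝ) with hn_def
  set b : ℝ := (n - 2) / 2 with hb_def
  have hb : 0 < b := by simp only [hb_def]; linarith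
  have hnb : n = 2 * (b + 1) := by simp only [hb_def]; ring
  -- The constant collects the coefficients once every term is bounded by `radialPowLog 4 (b + 1)
  -- β`. It does not depend on `M`, because subtracting a multiple of a superharmonic function only
  -- lowers the left side.
  refine ⟨4 * b * (β + 1) + 4 * (β + 1) * |β| + 16 * (b * (b + 1) + (β + 1) * |β|), ?_,
    fun M hM x => ?_⟩
  · have : 0 < β + 1 := by linarith
    positivity
  have h1 : ContDiff ℝ 2 (radialPowLog 4 b (β + 1) : E → ℝ) :=
    contDiff_radialPowLog (by norm_num) (Or.inr (by norm_num))
  have h2 : ContDiff ℝ 2 (radialPowLog 4 b 0 : E → ℝ) :=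
    contDiff_radialPowLog (by norm_num) (Or.inl rfl)
  have h2' : ContDiff ℝ 2 (M • radialPowLog 4 b 0 : E → ℝ) := h2.const_smul M
  rw [ContDiffAt.laplacian_sub h1.contDiffAt h2'.contDiffAt, laplacian_smul M h2.contDiffAt,
    laplacian_radialPowLog (by norm_num) (Or.inr (by norm_num)),
    laplacian_radialPowLog (by norm_num) (Or.inl rfl)]
  have ht := four_le_four_add_norm_sq x
  rw [← hn_def, hnb, show 2 * (b + 1) / 2 = b + 1 by ring, smul_eq_mul,
    show β + 1 - 1 = β by ring, show β + 1 - 2 = β - 1 by ring]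
  have hG : radialPowLog 4 (b + 2) (β + 1) x ≤ radialPowLog 4 (b + 1) β x := by
    have := powLog_add_one_le (b := b + 1) (c := β) ht
    rwa [show b + 1 + 1 = b + 2 by ring] at this
  have hG1 : radialPowLog 4 (b + 1) (β - 1) x ≤ radialPowLog 4 (b + 1) β x :=
    powLog_le_powLog ht le_rfl (by linarith)
  have hG2 : radialPowLog 4 (b + 2) (β - 1) x ≤ radialPowLog 4 (b + 1) β x :=
    powLog_le_powLog ht (by linarith) (by linarith)
  have p1 := radialPowLog_pos (b := b + 2) (c := β) x
  have p2 := radialPowLog_pos (b := b + 2) (c := 0) x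
  have p3 := radialPowLog_pos (b := b + 1) (c := β - 1) x
  have p4 := radialPowLog_pos (b := b + 2) (c := β - 1) x
  have p5 := radialPowLog_pos (b := b + 1) (c := β) x
  have hκ : 0 < β + 1 := by linarith
  set G := radialPowLog 4 (b + 1) β x
  set G₁ := radialPowLog 4 (b + 1) (β - 1) x
  set G₂ := radialPowLog 4 (b + 2) (β - 1) x
  set G₃ := radialPowLog 4 (b + 2) (β + 1) x
  have q1 : -(β * G₁) ≤ |β| * G := by
    calc -(β * G₁) = -β * G₁ := by ring
      _ ≤ |β| * G₁ := mul_le_mul_of_nonneg_right (neg_le_abs β) p3.le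
      _ ≤ _ := mul_le_mul_of_nonneg_left hG1 (abs_nonneg _)
  have q2 : β * G₂ ≤ |β| * G := by
    calc β * G₂ ≤ |β| * G₂ := mul_le_mul_of_nonneg_right (le_abs_self β) p4.le
      _ ≤ _ := mul_le_mul_of_nonneg_left hG2 (abs_nonneg _)
  have q3 := mul_le_mul_of_nonneg_left q1 (by positivity : 0 ≤ 4 * (β + 1))
  have q4 := mul_le_mul_of_nonneg_left q2 (by positivity : 0 ≤ 16 * (β + 1))
  have q5 := mul_le_mul_of_nonneg_left hG (by positivity : 0 ≤ 16 * (b * (b + 1)))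
  have q6 : 0 ≤ 16 * ((2 * b + 1) * (β + 1) * radialPowLog 4 (b + 2) β x) := by positivity
  have q7 : 0 ≤ M * (16 * (b * (b + 1) * radialPowLog 4 (b + 2) 0 x)) := by positivity
  nlinarith

/-- If `-Δ (lam u - Δ u)` is at least of order `|x| ^ (-n) (log |x|) ^ β` with `β > -1`, then `u`
exceeds the fundamental solution by the factor `(log |x|) ^ (β + 1)`. -/
theorem exists_log_improvement {u : E → ℝ} {lam β c₀ R₀ : ℝ} (hn : 3 ≤ finrank ℝ E) (hβ : -1 < β)
    (hlam : 0 < lam) (hc₀ : 0 < c₀) (hu : ContDiff ℝ 4 u) (hu0 : ∀ x, 0 ≤ u x)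
    (hΔ : ∀ x, Δ u x ≤ 0)
    (h : ∀ x, R₀ ≤ ‖x‖ → c₀ * radialPowLog 4 ((finrank ℝ E : ℝ) / 2) β x ≤
      Δ (Δ u) x - lam * Δ u x) :
    ∃ c > 0, ∃ R₁, ∀ x, R₁ ≤ ‖x‖ →
      c * radialPowLog 4 (((finrank ℝ E : ℝ) - 2) / 2) (β + 1) x ≤ u x := by
  obtain ⟨C, hC, hbar⟩ := neg_laplacian_logBarrier_le (E := E) hn hβ
  have hn' : (3 : ℝ) ≤ (finrank ℝ E : ℝ) := by exact_mod_cast hn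
  set n : ℝ := (finrank ℝ E : ℝ) with hn_def
  set b : ℝ := (n - 2) / 2 with hb_def
  have hb : 0 < b := by simp only [hb_def]; linarith
  have hκ : 0 < β + 1 := by linarith
  set P : E → ℝ := radialPowLog 4 b (β + 1) with hP
  set Q : E → ℝ := radialPowLog 4 b 0 with hQ
  have hPpos : ∀ x, 0 < P x := radialPowLog_pos
  have hQpos : ∀ x, 0 < Q x := radialPowLog_pos
  have hPc : ContDiff ℝ 2 P := contDiff_radialPowLog (by norm_num) (Or.inr (by norm_num))
  have hQc : ContDiff ℝ 2 Q := contDiff_radialPowLog (by norm_num) (Or.inl rfl)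
  have hPQ : ∀ x, P x = Real.log (4 + ‖x‖ ^ 2) ^ (β + 1) * Q x := fun x => by
    simp [hP, hQ, radialPowLog, powLog, mul_comm]
  have hPt : Tendsto P (cocompact E) (𝓝 0) := tendsto_radialPowLog_cocompact _ hb
  set Z : ℝ → E → ℝ := fun M => P - M • Q with hZ
  have hZc : ∀ M, ContDiff ℝ 2 (Z M) := fun M => hPc.sub (hQc.const_smul M)
  have hZP : ∀ M ≥ 0, ∀ x, Z M x ≤ P x := fun M hM x => by
    simp only [hZ, Pi.sub_apply, Pi.smul_apply, smul_eq_mul]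
    have := mul_nonneg hM (hQpos x).le
    linarith
  have comparison : ∀ {v : E → ℝ} {δ M : ℝ}, 0 < δ → 0 ≤ M → ContDiff ℝ 2 v → (∀ x, 0 ≤ v x) →
      (∀ x, v x < δ * Z M x → 0 < Z M x → Δ v x < δ * Δ (Z M) x) → ∀ x, δ * Z M x ≤ v x := by
    intro v δ M hδ hM hv hv0 hlt x
    have hδZ : ContDiff ℝ 2 (δ • Z M) := (hZc M).const_smul δ
    have := nonneg_of_laplacian_neg (g := v - δ • Z M) (hv.sub hδZ) (fun ε hε => ?_)
      (fun y hy => ?_) x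
    · simpa using this
    · filter_upwards [hPt.eventually (gt_mem_nhds (show 0 < ε / δ by positivity))] with y hy
      rw [lt_div_iff₀ hδ] at hy
      have h1 := hv0 y
      have h2 := mul_le_mul_of_nonneg_left (hZP M hM y) hδ.le
      simp only [Pi.sub_apply, Pi.smul_apply, smul_eq_mul]
      linarith
    · simp only [Pi.sub_apply, Pi.smul_apply, smul_eq_mul, sub_neg] at hy
      rw [ContDiffAt.laplacian_sub hv.contDiffAt hδZ.contDiffAt,
        laplacian_smul δ (hZc M).contDiffAt, smul_eq_mul, sub_neg]
      refine hlt y hy ?_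
      exact (mul_pos_iff_of_pos_left hδ).1 ((hv0 y).trans_lt hy)
  -- With this `M`, `Z M` is not positive inside the ball of radius `R₀`, where nothing is assumed
  -- on the right-hand side, so the comparison for `V` takes place only outside it.
  set M : ℝ := Real.log (4 + R₀ ^ 2) ^ (β + 1) with hM
  have hM0 : 0 < M := Real.rpow_pos_of_pos (Real.log_pos (by nlinarith [sq_nonneg R₀])) _
  have hu2 : ContDiff ℝ 2 u := hu.of_le (by norm_num)
  have hΔc : ContDiff ℝ 2 (Δ u) := hu.laplacian (by norm_num)
  have hlu : ContDiff ℝ 2 (lam • u) := hu2.const_smul lam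
  set V : E → ℝ := lam • u - Δ u with hV
  have hV0 : ∀ x, 0 ≤ V x := fun x => by
    simp only [hV, Pi.sub_apply, Pi.smul_apply, smul_eq_mul]
    have := mul_nonneg hlam.le (hu0 x)
    linarith [hΔ x]
  have hVΔ : ∀ x, Δ V x = lam * Δ u x - Δ (Δ u) x := fun x => by
    rw [hV, ContDiffAt.laplacian_sub hlu.contDiffAt hΔc.contDiffAt,
      laplacian_smul lam hu2.contDiffAt, smul_eq_mul]
  set δ := c₀ / (2 * C) with hδ_def
  have hδ : 0 < δ := by positivity
  have hV1 : ∀ x, δ * Z M x ≤ V x := by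
    refine comparison hδ hM0.le (hlu.sub hΔc) hV0 fun x _ hx => ?_
    have hxR : R₀ ≤ ‖x‖ := by
      by_contra! hlt
      have h1 : Real.log (4 + ‖x‖ ^ 2) ^ (β + 1) ≤ M := by
        refine Real.rpow_le_rpow (Real.log_nonneg (by linarith [four_le_four_add_norm_sq x]))
          (Real.log_le_log (by positivity) ?_) hκ.le
        have := pow_le_pow_left₀ (norm_nonneg x) hlt.le 2
        linarith
      have h2 := mul_le_mul_of_nonneg_right h1 (hQpos x).le
      simp only [hZ, Pi.sub_apply, Pi.smul_apply, smul_eq_mul, hPQ] at hx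
      linarith
    have h1 := h x hxR
    have h2 := mul_le_mul_of_nonneg_left (hbar M hM0.le x) hδ.le
    have h3 : δ * (C * radialPowLog 4 (n / 2) β x) = c₀ * radialPowLog 4 (n / 2) β x / 2 := by
      rw [hδ_def]; field_simp
    have h4 : 0 < c₀ * radialPowLog 4 (n / 2) β x := mul_pos hc₀ (radialPowLog_pos x)
    rw [hVΔ]
    simp only [hZ]
    linarith
  -- In a second comparison `Δ u = lam * u - V`, and `V` is at least `δ * P / 2` wherever `Z (2 * M)
  -- > 0`. If `u < δ' * Z (2 * M)` there, this `δ'` lets `V` outweigh both `lam * u` and the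
  -- Laplacian of the barrier.
  set δ' := δ / (4 * (lam + C)) with hδ'_def
  have hδ' : 0 < δ' := by positivity
  have hu1 : ∀ x, δ' * Z (2 * M) x ≤ u x := by
    refine comparison hδ' (by positivity) hu2 hu0 fun x hx hx0 => ?_
    have h1 := hV1 x
    have h2 := mul_le_mul_of_nonneg_left (hbar (2 * M) (by positivity) x) hδ'.le
    have h3 : radialPowLog 4 (n / 2) β x ≤ P x :=
      powLog_le_powLog (four_le_four_add_norm_sq x) (by simp only [hb_def]; linarith) (by linarith)
    have h4 : P x ≤ 2 * Z M x := by
      simp only [hZ, Pi.sub_apply, Pi.smul_apply, smul_eq_mul] at hx0 ⊢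
      linarith
    have h5 := hZP (2 * M) (by positivity) x
    have h6 : δ' * (lam + C) * P x = δ * P x / 4 := by rw [hδ'_def]; field_simp
    have h7 := mul_pos hδ (hPpos x)
    have h8 := mul_le_mul_of_nonneg_left h4 hδ.le
    have h9 := mul_lt_mul_of_pos_left hx hlam
    have h10 := mul_le_mul_of_nonneg_left h5 (mul_pos hlam hδ').le
    have h11 := mul_le_mul_of_nonneg_left h3 (mul_pos hδ' hC).le
    simp only [hV, Pi.sub_apply, Pi.smul_apply, smul_eq_mul] at h1
    change Δ u x < δ' * Δ (P - (2 * M) • Q) x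
    nlinarith
  have hev : ∀ᶠ s : ℝ in atTop, 4 * M ≤ Real.log (4 + s ^ 2) ^ (β + 1) := by
    have h1 : Tendsto (fun s : ℝ => 4 + s ^ 2) atTop atTop :=
      tendsto_atTop_add_const_left _ _ (tendsto_pow_atTop two_ne_zero)
    exact ((tendsto_rpow_atTop hκ).comp (Real.tendsto_log_atTop.comp h1)).eventually_ge_atTop _
  obtain ⟨R₁, hR₁⟩ := eventually_atTop.1 hev
  refine ⟨δ' / 2, by positivity, R₁, fun x hx => ?_⟩
  have h1 := mul_le_mul_of_nonneg_right (hR₁ _ hx) (hQpos x).le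
  rw [← hPQ] at h1
  have h2 := hu1 x
  have h3 : P x ≤ 2 * Z (2 * M) x := by
    simp only [hZ, Pi.sub_apply, Pi.smul_apply, smul_eq_mul]
    linarith
  have h4 := mul_le_mul_of_nonneg_left h3 hδ'.le
  change δ' / 2 * P x ≤ u x
  linarith

variable [MeasurableSpace E] [BorelSpace E]

/-- Necessary condition on the exponents from pointwise lower bounds far away. -/
theorem exponents_of_lower_bounds {u : E → ℝ} {lam q θ β κ c₀ c₁ R₀ : ℝ} (hn : 3 ≤ finrank ℝ E)
    (hq : 1 ≤ q) (hlam : 0 < lam) (hc₀ : 0 < c₀) (hc₁ : 0 < c₁)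
    (hu : ContDiff ℝ 4 u) (hu0 : ∀ x, 0 ≤ u x) (hΔ : ∀ x, Δ u x ≤ 0)
    (h : ∀ x, R₀ ≤ ‖x‖ → c₀ * radialPowLog 4 (θ / 2) β x * u x ^ q ≤ Δ (Δ u) x - lam * Δ u x)
    (hlow : ∀ x, R₀ ≤ ‖x‖ → c₁ * radialPowLog 4 (((finrank ℝ E : ℝ) - 2) / 2) κ x ≤ u x) :
    1 ≤ θ / 2 + ((finrank ℝ E : ℝ) - 2) / 2 * (q - 1) ∧
      (θ / 2 + ((finrank ℝ E : ℝ) - 2) / 2 * (q - 1) = 1 → β + κ * (q - 1) ≤ 0) := by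
  set b : ℝ := ((finrank ℝ E : ℝ) - 2) / 2 with hb_def
  set e := θ / 2 + b * (q - 1) with he
  set d := β + κ * (q - 1) with hd
  obtain ⟨k, hk, hcomp⟩ := powLog_comparable e d
  set D := ((finrank ℝ E : ℝ) + 6) ^ 2 / 3 * (((finrank ℝ E : ℝ) + 6) ^ 2 / 3 + lam) with hD
  set m₀ := c₀ * c₁ ^ (q - 1) * k with hm₀
  have hm₀pos : 0 < m₀ := by positivity
  have : Nontrivial E := Module.nontrivial_of_finrank_pos (R := ℝ) (by omega)
  -- Here `T` stands for `4 + ‖ξ‖ ^ 2`. The threshold forces `‖ξ‖ ≥ 2 * |R₀| + 4`, so the ball of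
  -- radius `‖ξ‖ / 2` about `ξ` lies where the lower bounds hold and its radius is at least `1`.
  refine exponents_of_powLog_mul_le (T₀ := 4 + (2 * |R₀| + 4) ^ 2) (C := 8 * D / m₀) fun T hT => ?_
  obtain ⟨ξ, hξ⟩ := exists_norm_eq E (Real.sqrt_nonneg (T - 4))
  have hT0 : 0 ≤ T - 4 := by nlinarith [sq_nonneg (2 * |R₀| + 4)]
  have hξ2 : ‖ξ‖ ^ 2 = T - 4 := by rw [hξ, Real.sq_sqrt hT0]
  have hξR : 2 * |R₀| + 4 ≤ ‖ξ‖ := by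
    rw [hξ]; exact Real.le_sqrt_of_sq_le (by linarith)
  have hR0 := abs_nonneg R₀
  have hR0' := le_abs_self R₀
  have hT16 : 16 ≤ T := by nlinarith
  have hupos : ∀ x, R₀ ≤ ‖x‖ → 0 < u x := fun x hx =>
    (mul_pos hc₁ (radialPowLog_pos x)).trans_le (hlow x hx)
  have key := mul_sq_le_of_neg_laplacian_ge (m := m₀ * powLog e d T) (R := ‖ξ‖ / 2) (ξ := ξ)
    (lam := lam) (by linarith) hu hu0 (hupos ξ (by linarith))
    (fun x => by have := mul_nonneg hlam.le (hu0 x); linarith [hΔ x]) (fun x hx => ?_)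
  · rw [← hD] at key
    have hp := powLog_pos (b := e) (c := d) (show 1 < T by linarith)
    rw [le_div_iff₀ hm₀pos]
    have h1 : T ≤ 8 * (‖ξ‖ / 2) ^ 2 := by nlinarith
    have h2 := mul_le_mul_of_nonneg_left h1 (mul_pos hm₀pos hp).le
    linarith
  · rw [Metric.mem_ball, dist_eq_norm] at hx
    have hx1 : ‖ξ‖ / 2 ≤ ‖x‖ := by
      have := norm_sub_norm_le ξ x
      rw [norm_sub_rev] at this
      linarith
    have hx2 : ‖x‖ ≤ 3 / 2 * ‖ξ‖ := by
      have := norm_sub_norm_le x ξ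
      linarith
    have hxR : R₀ ≤ ‖x‖ := by linarith
    refine le_trans ?_ (h x hxR)
    have hux := hupos x hxR
    have ht1 : 1 < 4 + ‖x‖ ^ 2 := by linarith [four_le_four_add_norm_sq x]
    have h1 := hcomp T (4 + ‖x‖ ^ 2) hT16 (by nlinarith) (by nlinarith [norm_nonneg x])
    have h2 : c₁ ^ (q - 1) * powLog (b * (q - 1)) (κ * (q - 1)) (4 + ‖x‖ ^ 2) ≤ u x ^ (q - 1) := by
      rw [← powLog_rpow ht1, ← Real.mul_rpow hc₁.le (powLog_pos ht1).le]
      exact Real.rpow_le_rpow (mul_pos hc₁ (powLog_pos ht1)).le (hlow x hxR) (by linarith)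
    have h3 : u x ^ q = u x ^ (q - 1) * u x := by
      rw [← Real.rpow_add_one hux.ne', sub_add_cancel]
    -- One factor `u` is kept as the unknown; the other `q - 1` powers are bounded below and become
    -- part of the potential `m`.
    rw [h3, ← mul_assoc]
    refine mul_le_mul_of_nonneg_right ?_ hux.le
    have h4 := powLog_mul_powLog (b := θ / 2) (b' := b * (q - 1)) (c := β) (c' := κ * (q - 1)) ht1
    have h5 := mul_le_mul_of_nonneg_left h2 (mul_pos hc₀ (radialPowLog_pos (b := θ / 2) (c := β) x)).le
    refine le_trans ?_ h5
    have h6 := mul_le_mul_of_nonneg_left h1 (by positivity : 0 ≤ c₀ * c₁ ^ (q - 1))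
    rw [← h4] at h6
    unfold radialPowLog
    rw [hm₀]
    refine le_trans (le_of_eq ?_) (h6.trans (le_of_eq ?_)) <;> ring

end LowerBounds

/-! ### Divergence of radial power-logarithm integrals. -/

section RadialNonintegrability

open Module Filter Topology Asymptotics

theorem eventually_powLog_le {d d' β β' : ℝ} (h : d < d' ∨ (d = d' ∧ β' ≤ β)) :
    ∀ᶠ t in atTop, powLog d' β' t ≤ powLog d β t := by
  rcases h with h | ⟨rfl, h⟩
  · have h1 := (tendsto_powLog_zero (b := d' - d) (β' - β) (by linarith)).eventually
      (gt_mem_nhds one_pos)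
    filter_upwards [h1, eventually_gt_atTop 1] with t ht ht1
    have h2 := powLog_mul_powLog (b := d) (b' := d' - d) (c := β) (c' := β' - β) ht1
    rw [add_sub_cancel, add_sub_cancel] at h2
    rw [← h2]
    have := powLog_pos (b := d) (c := β) ht1
    nlinarith
  · filter_upwards [eventually_ge_atTop 4] with t ht
    exact powLog_le_powLog ht le_rfl h

/-- The borderline case `d = n / 2`, `β = -1` lies eventually below all the others, and there the
radial density dominates a multiple of the derivative of `log (log (4 + y ^ 2))`, an unbounded
function. -/
theorem not_integrableOn_radial {n : ℕ} (hn : 3 ≤ n) {d β : ℝ}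
    (h : d < n / 2 ∨ (d = n / 2 ∧ -1 ≤ β)) :
    ¬ IntegrableOn (fun y : ℝ => y ^ (n - 1) • powLog d β (4 + y ^ 2)) (Set.Ioi 0) := by
  have hT : Tendsto (fun y : ℝ => 4 + y ^ 2) atTop atTop :=
    tendsto_atTop_add_const_left _ _ (tendsto_pow_atTop two_ne_zero)
  have hder : ∀ y : ℝ, HasDerivAt (fun y : ℝ => Real.log (Real.log (4 + y ^ 2)))
      (2 * y / (4 + y ^ 2) / Real.log (4 + y ^ 2)) y := fun y => by
    have h1 : HasDerivAt (fun y : ℝ => 4 + y ^ 2) (2 * y) y := by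
      simpa using (hasDerivAt_pow 2 y).const_add (4 : ℝ)
    refine (h1.log (by positivity)).log ?_
    exact (Real.log_pos (by nlinarith [sq_nonneg y])).ne'
  refine not_integrableOn_of_tendsto_norm_atTop_of_deriv_isBigO_filter
    (f := fun y => Real.log (Real.log (4 + y ^ 2))) atTop (Ioi_mem_atTop 0)
    (Eventually.of_forall fun y => (hder y).differentiableAt)
    (tendsto_norm_atTop_atTop.comp
      (Real.tendsto_log_atTop.comp (Real.tendsto_log_atTop.comp hT))) ?_
  have hd' : deriv (fun y : ℝ => Real.log (Real.log (4 + y ^ 2))) =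
      fun y => 2 * y / (4 + y ^ 2) / Real.log (4 + y ^ 2) := funext fun y => (hder y).deriv
  rw [hd']
  refine IsBigO.of_bound (2 * 2 ^ (n - 2)) ?_
  filter_upwards [hT.eventually (eventually_powLog_le h), eventually_ge_atTop 2] with y hy hy2
  have hy0 : 0 < y := by linarith
  have ht : 4 ≤ 4 + y ^ 2 := by nlinarith
  have ht1 : 1 < 4 + y ^ 2 := by linarith
  have hl := Real.log_pos ht1
  have hp := powLog_pos (b := d) (c := β) ht1
  rw [Real.norm_of_nonneg (by positivity), Real.norm_of_nonneg (by positivity), smul_eq_mul]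
  have e1 : 2 * y / (4 + y ^ 2) / Real.log (4 + y ^ 2)
      = 2 * y * Real.sqrt (4 + y ^ 2) ^ (n - 2) * powLog (n / 2) (-1) (4 + y ^ 2) := by
    have ht0 : 0 < 4 + y ^ 2 := by linarith
    have e2 : Real.sqrt (4 + y ^ 2) ^ (n - 2) = (4 + y ^ 2) ^ ((n : ℝ) / 2 - 1) := by
      rw [Real.sqrt_eq_rpow, ← Real.rpow_mul_natCast ht0.le]
      congr 1
      rw [Nat.cast_sub (by omega)]
      push_cast; ring
    rw [e2, powLog, Real.rpow_neg_one, mul_assoc, ← mul_assoc (_ ^ _), ← Real.rpow_add ht0,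
      show (n : ℝ) / 2 - 1 + -(n / 2) = -1 by ring, Real.rpow_neg_one]
    field_simp
  have h3 : Real.sqrt (4 + y ^ 2) ≤ 2 * y := by
    rw [Real.sqrt_le_left (by positivity)]
    nlinarith
  have hp' := powLog_pos (b := n / 2) (c := -1) ht1
  rw [e1]
  calc 2 * y * Real.sqrt (4 + y ^ 2) ^ (n - 2) * powLog (n / 2) (-1) (4 + y ^ 2)
      ≤ 2 * y * (2 * y) ^ (n - 2) * powLog d β (4 + y ^ 2) := by gcongr
    _ = 2 * 2 ^ (n - 2) * (y ^ (n - 2 + 1) * powLog d β (4 + y ^ 2)) := by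
        rw [mul_pow, pow_succ]; ring
    _ = _ := by rw [show n - 2 + 1 = n - 1 by omega]

variable {E : Type*} [NormedAddCommGroup E] [InnerProductSpace ℝ E] [FiniteDimensional ℝ E]
  [MeasurableSpace E] [BorelSpace E]

theorem exponents_of_integrable_radialPowLog (hn : 3 ≤ finrank ℝ E) {d β : ℝ}
    (h : Integrable (radialPowLog 4 d β : E → ℝ)) :
    (finrank ℝ E : ℝ) / 2 ≤ d ∧ (-1 ≤ β → (finrank ℝ E : ℝ) / 2 < d) := by
  have : Nontrivial E := Module.nontrivial_of_finrank_pos (R := ℝ) (by omega)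
  have h1 := (integrable_fun_norm_addHaar (volume : Measure E)
    (f := fun y => powLog d β (4 + y ^ 2))).1 h
  constructor
  · by_contra! hd
    exact not_integrableOn_radial hn (Or.inl hd) h1
  · intro hβ
    by_contra! hd
    exact not_integrableOn_radial hn (hd.lt_or_eq.imp id fun h => ⟨h, hβ⟩) h1

end RadialNonintegrability

/-! ### Necessary conditions on the exponents. -/

section Necessity

open Laplacian InnerProductSpace Module Filter Topology

variable {N : ℕ}

local notation "𝔼" => EuclideanSpace ℝ (Fin N)

theorem logRieszKernel_nonneg (α β : ℝ) (z : 𝔼) : 0 ≤ logRieszKernel α β z :=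
  mul_nonneg (Real.rpow_nonneg (norm_nonneg _) _)
    (Real.rpow_nonneg (Real.log_nonneg (by linarith [norm_nonneg z])) _)

theorem measurable_logRieszKernel (α β : ℝ) :
    Measurable (logRieszKernel α β : 𝔼 → ℝ) := by
  unfold logRieszKernel
  exact (measurable_norm.pow_const _).mul
    ((Real.measurable_log.comp (measurable_norm.const_add 1)).pow_const _)

/-- For `‖z‖` comparable to `‖x‖`, both the power and the logarithm of the kernel are within fixed
factors of their values at `x`, whatever the signs of the exponents. -/
theorem exists_le_logRieszKernel (α β : ℝ) : ∃ k > 0, ∀ x z : 𝔼, 4 ≤ ‖x‖ → ‖x‖ / 2 ≤ ‖z‖ →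
    ‖z‖ ≤ 4 * ‖x‖ → k * radialPowLog 4 (α / 2) β x ≤ logRieszKernel α β z := by
  refine ⟨8 ^ (-|-α|) * 4 ^ (-|β|), by positivity, fun x z hx h1 h2 => ?_⟩
  set T := 4 + ‖x‖ ^ 2 with hT
  have hT16 : 16 ≤ T := by nlinarith
  have hx0 := norm_nonneg x
  have hz0 : 0 < ‖z‖ := by linarith
  have hs1 : Real.sqrt T ≤ 2 * ‖x‖ := by
    rw [Real.sqrt_le_left (by positivity)]; nlinarith
  have hs2 : ‖x‖ ≤ Real.sqrt T := Real.le_sqrt_of_sq_le (by linarith)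
  have hs0 : 0 < Real.sqrt T := by linarith
  have h3 := rpow_comparable (-α) (k := 8) (by norm_num) hs0 (x := ‖z‖) (by linarith)
    (by linarith)
  have e1 : Real.sqrt T ^ (-α) = T ^ (-(α / 2)) := by
    rw [Real.sqrt_eq_rpow, ← Real.rpow_mul (by linarith)]; congr 1; ring
  have hlT : 0 < Real.log T := Real.log_pos (by linarith)
  have hlz : 2 * Real.log (1 + ‖z‖) = Real.log ((1 + ‖z‖) ^ 2) := by
    rw [Real.log_pow]; norm_num
  have h16 : Real.log 16 = 2 * Real.log 4 := by
    rw [← Real.log_rpow (by norm_num)]; norm_num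
  have h16' : Real.log 16 ≤ Real.log T := Real.log_le_log (by norm_num) hT16
  have h4 : 0 ≤ Real.log 4 := Real.log_nonneg (by norm_num)
  have h5 : Real.log T - Real.log 4 ≤ 2 * Real.log (1 + ‖z‖) := by
    rw [hlz, ← Real.log_div (by linarith) (by norm_num)]
    refine Real.log_le_log (by positivity) ?_
    nlinarith
  have h6 : 2 * Real.log (1 + ‖z‖) ≤ 2 * Real.log 16 + Real.log T := by
    rw [hlz, two_mul, ← Real.log_mul (by norm_num) (by norm_num),
      ← Real.log_mul (by norm_num) (by linarith)]
    refine Real.log_le_log (by positivity) ?_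
    nlinarith
  have h7 := rpow_comparable β (k := 4) (by norm_num) hlT (x := Real.log (1 + ‖z‖))
    (by linarith) (by linarith)
  rw [e1] at h3
  unfold radialPowLog logRieszKernel powLog
  calc _ = (8 ^ (-|-α|) * T ^ (-(α / 2))) * (4 ^ (-|β|) * Real.log T ^ β) := by ring
    _ ≤ _ := mul_le_mul h3 h7 (by positivity) (Real.rpow_nonneg hz0.le _)

theorem mul_volume_le_kernelConv {α β p m : ℝ} {u : 𝔼 → ℝ} {x : 𝔼} {s : Set 𝔼}
    (hs : MeasurableSet s) (h : ∀ y ∈ s, m ≤ logRieszKernel α β (x - y) * u y ^ p) :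
    ENNReal.ofReal m * volume s ≤ kernelConv α β p u x := by
  rw [← setLIntegral_const]
  exact (setLIntegral_mono' hs fun y hy => ENNReal.ofReal_le_ofReal (h y hy)).trans
    (setLIntegral_le_lintegral _ _)

theorem kernelConv_comp_add_right (α β p : ℝ) (u : 𝔼 → ℝ) (a x : 𝔼) :
    kernelConv α β p (fun y => u (y + a)) x = kernelConv α β p u (x + a) := by
  unfold kernelConv
  rw [← lintegral_add_right_eq_self
    (fun y => ENNReal.ofReal (logRieszKernel α β (x + a - y) * u y ^ p)) a]
  simp

theorem IsNonnegSolutionPPlus.comp_add_right {α β p q lam : ℝ} {u : 𝔼 → ℝ}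
    (h : IsNonnegSolutionPPlus α β p q lam u) (a : 𝔼) :
    IsNonnegSolutionPPlus α β p q lam fun y => u (y + a) := by
  have e : Δ (fun y => u (y + a)) = fun x => Δ u (x + a) :=
    funext fun x => laplacian_comp_add_right (h.contDiff.of_le (by norm_num)) _ _
  refine ⟨h.contDiff.comp (contDiff_id.add contDiff_const), fun x => h.nonneg _, fun x => ?_,
    fun x => ?_⟩
  · rw [kernelConv_comp_add_right]; exact h.conv_lt_top _
  · rw [kernelConv_comp_add_right, e,
      laplacian_comp_add_right (h.contDiff.laplacian (by norm_num))]
    exact h.ineq _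

theorem IsNonnegSolutionPPlus.integrable {α β p q lam : ℝ} {u : 𝔼 → ℝ}
    (h : IsNonnegSolutionPPlus α β p q lam u) (hp : 0 ≤ p) (x : 𝔼) :
    Integrable fun y => logRieszKernel α β (x - y) * u y ^ p := by
  have hm : Measurable fun y => logRieszKernel α β (x - y) * u y ^ p := by
    refine ((measurable_logRieszKernel α β).comp (measurable_const.sub measurable_id)).mul ?_
    exact (h.contDiff.continuous.rpow_const fun y => Or.inr hp).measurable
  refine ⟨hm.aestronglyMeasurable, ?_⟩
  rw [hasFiniteIntegral_iff_ofReal (ae_of_all _ fun y =>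
    mul_nonneg (logRieszKernel_nonneg _ _ _) (Real.rpow_nonneg (h.nonneg y) _))]
  exact h.conv_lt_top x

/-- Finiteness at the origin makes `u ^ p` integrable against the kernel, whose decay is at most
polynomial. Since `p ≥ 1`, `u ≤ 1 + u ^ p`, so dividing by the kernel costs only a polynomial factor
on each unit ball. -/
theorem IsNonnegSolutionPPlus.exists_growth {α β p q lam : ℝ} {u : 𝔼 → ℝ}
    (h : IsNonnegSolutionPPlus α β p q lam u) (hp : 1 ≤ p) :
    ∃ (C : ℝ) (M : ℕ), ∀ x, ∫ y in Metric.closedBall x 1, u y ≤ C * (1 + ‖x‖) ^ M := by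
  obtain ⟨k, hk, hK⟩ := exists_le_logRieszKernel (N := N) α β
  obtain ⟨m, hm⟩ := exists_nat_ge (α / 2 + |β|)
  have hint := h.integrable (by linarith) 0
  set F : 𝔼 → ℝ := fun y => logRieszKernel α β (0 - y) * u y ^ p
  have hF0 : ∀ y, 0 ≤ F y := fun y =>
    mul_nonneg (logRieszKernel_nonneg _ _ _) (Real.rpow_nonneg (h.nonneg y) _)
  obtain ⟨B, hB⟩ := (isCompact_closedBall (0 : 𝔼) 4).exists_bound_of_continuousOn
    h.contDiff.continuous.continuousOn
  have hB0 : 0 ≤ B := (norm_nonneg _).trans (hB 0 (by simp))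
  have hfar : ∀ y : 𝔼, 4 ≤ ‖y‖ → u y ≤ 1 + k⁻¹ * (4 + ‖y‖ ^ 2) ^ m * F y := by
    intro y hy
    have h1 := hK y (0 - y) hy (by simp) (by simp; linarith [norm_nonneg y])
    have ht := four_le_four_add_norm_sq y
    have ht0 : 0 < 4 + ‖y‖ ^ 2 := by linarith
    have hl1 := one_le_log_of_four_le ht
    have h2 : 1 ≤ (4 + ‖y‖ ^ 2) ^ m * radialPowLog 4 (α / 2) β y := by
      have h3 : radialPowLog 4 (α / 2) (-|β|) y ≤ radialPowLog 4 (α / 2) β y :=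
        powLog_le_powLog ht le_rfl (neg_abs_le β)
      have h4 : (4 + ‖y‖ ^ 2) ^ (-|β|) ≤ Real.log (4 + ‖y‖ ^ 2) ^ (-|β|) :=
        Real.rpow_le_rpow_of_nonpos (by linarith)
          ((Real.log_le_sub_one_of_pos ht0).trans (by linarith)) (by simp)
      have h5 : (4 + ‖y‖ ^ 2) ^ (-(m : ℝ)) ≤ radialPowLog 4 (α / 2) (-|β|) y := by
        calc (4 + ‖y‖ ^ 2) ^ (-(m : ℝ)) ≤ (4 + ‖y‖ ^ 2) ^ (-(α / 2) + -|β|) :=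
              Real.rpow_le_rpow_of_exponent_le (by linarith) (by linarith)
          _ = (4 + ‖y‖ ^ 2) ^ (-(α / 2)) * (4 + ‖y‖ ^ 2) ^ (-|β|) := Real.rpow_add ht0 _ _
          _ ≤ _ := mul_le_mul_of_nonneg_left h4 (by positivity)
      calc (1 : ℝ) = (4 + ‖y‖ ^ 2) ^ m * (4 + ‖y‖ ^ 2) ^ (-(m : ℝ)) := by
            rw [Real.rpow_neg ht0.le, Real.rpow_natCast, mul_inv_cancel₀ (by positivity)]
        _ ≤ _ := mul_le_mul_of_nonneg_left (h5.trans h3) (by positivity)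
    have h6 : u y ≤ 1 + u y ^ p := by
      rcases le_total (u y) 1 with h7 | h7
      · linarith [Real.rpow_nonneg (h.nonneg y) p]
      · have := Real.rpow_le_rpow_of_exponent_le h7 hp
        rw [Real.rpow_one] at this
        linarith
    have hup := Real.rpow_nonneg (h.nonneg y) p
    have h7 : u y ^ p ≤ k⁻¹ * (4 + ‖y‖ ^ 2) ^ m * F y := by
      calc u y ^ p ≤ ((4 + ‖y‖ ^ 2) ^ m * radialPowLog 4 (α / 2) β y) * u y ^ p := by
            nlinarith
        _ = k⁻¹ * (4 + ‖y‖ ^ 2) ^ m * (k * radialPowLog 4 (α / 2) β y * u y ^ p) := by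
            field_simp
        _ ≤ _ := by
            refine mul_le_mul_of_nonneg_left (mul_le_mul_of_nonneg_right h1 hup) (by positivity)
    linarith
  set I := ∫ y, F y
  have hI : 0 ≤ I := integral_nonneg hF0
  set ω := volume.real (Metric.closedBall (0 : 𝔼) 1)
  have hω : 0 ≤ ω := measureReal_nonneg
  refine ⟨(1 + B) * ω + k⁻¹ * 5 ^ m * I, 2 * m, fun x => ?_⟩
  have hx0 := norm_nonneg x
  set A := k⁻¹ * (4 + (1 + ‖x‖) ^ 2) ^ m
  have hA : 0 ≤ A := by positivity
  have hb : ∀ y ∈ Metric.closedBall x 1, u y ≤ (1 + B) + A * F y := by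
    intro y hy
    have hy1 : ‖y‖ ≤ 1 + ‖x‖ := by
      rw [Metric.mem_closedBall, dist_eq_norm] at hy
      linarith [norm_sub_norm_le y x]
    have hAF := mul_nonneg hA (hF0 y)
    rcases le_total ‖y‖ 4 with h4 | h4
    · have := (le_abs_self _).trans (hB y (by simpa using h4))
      linarith
    · refine (hfar y h4).trans ?_
      have : k⁻¹ * (4 + ‖y‖ ^ 2) ^ m * F y ≤ A * F y := by
        refine mul_le_mul_of_nonneg_right (mul_le_mul_of_nonneg_left ?_ (by positivity)) (hF0 y)
        gcongr
      linarith
  have hfin : volume (Metric.closedBall x 1) ≠ ∞ := (isCompact_closedBall x 1).measure_lt_top.ne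
  have hcst : IntegrableOn (fun _ : 𝔼 => 1 + B) (Metric.closedBall x 1) := integrableOn_const hfin
  have hsubint : ∫ y in Metric.closedBall x 1, F y ≤ I :=
    setIntegral_le_integral hint (ae_of_all _ hF0)
  have hvol : volume.real (Metric.closedBall x 1) = ω := by
    simp only [ω, measureReal_def, Measure.addHaar_closedBall_center volume x]
  calc ∫ y in Metric.closedBall x 1, u y ≤ ∫ y in Metric.closedBall x 1, ((1 + B) + A * F y) :=
        setIntegral_mono_on
          (h.contDiff.continuous.continuousOn.integrableOn_compact (isCompact_closedBall _ _))
          (hcst.add (hint.integrableOn.const_mul A))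
          measurableSet_closedBall hb
    _ = (1 + B) * ω + A * ∫ y in Metric.closedBall x 1, F y := by
        rw [integral_add hcst (hint.integrableOn.const_mul A),
          integral_const_mul, setIntegral_const, hvol, smul_eq_mul, mul_comm ω]
    _ ≤ (1 + B) * ω + A * I := by gcongr
    _ ≤ ((1 + B) * ω + k⁻¹ * 5 ^ m * I) * (1 + ‖x‖) ^ (2 * m) := by
        have h1 : (1 : ℝ) ≤ (1 + ‖x‖) ^ (2 * m) := one_le_pow₀ (by linarith)
        have h2 : A ≤ k⁻¹ * 5 ^ m * (1 + ‖x‖) ^ (2 * m) := by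
          rw [mul_assoc, pow_mul, ← mul_pow]
          simp only [A]
          gcongr
          nlinarith
        have h3 := mul_le_mul_of_nonneg_right h2 hI
        have h4 : 0 ≤ (1 + B) * ω := by positivity
        nlinarith

/-- Necessary conditions for the existence of a solution which is positive at the origin. -/
theorem IsNonnegSolutionPPlus.exponents (hN : 3 ≤ N) {α β p q lam : ℝ} {u : 𝔼 → ℝ}
    (h : IsNonnegSolutionPPlus α β p q lam u) (hp : 1 ≤ p) (hq : 1 ≤ q) (hlam : 0 < lam)
    (h0 : 0 < u 0) :
    ((N : ℝ) ≤ α + (N - 2) * p ∧ (-1 ≤ β → (N : ℝ) < α + (N - 2) * p)) ∧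
    ∀ θ ∈ ({α, α + (N - 2) * p - N} : Set ℝ),
      (N : ℝ) ≤ θ + (N - 2) * q ∧ (-1 < β → (N : ℝ) = θ + (N - 2) * q → q * (β + 1) ≤ 1) := by
  have hfr : finrank ℝ 𝔼 = N := by simp
  have hn : 3 ≤ finrank ℝ 𝔼 := by rw [hfr]; exact hN
  have hN' : (3 : ℝ) ≤ N := by exact_mod_cast hN
  have : Nontrivial 𝔼 := nontrivial_of_finrank_pos (R := ℝ) (by omega)
  have hu2 : ContDiff ℝ 2 u := h.contDiff.of_le (by norm_num)
  have hΔ : ∀ x, Δ u x ≤ 0 := by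
    obtain ⟨C, M, hCM⟩ := h.exists_growth hp
    exact laplacian_nonpos_of_growth hlam h.contDiff h.nonneg
      (fun x => le_trans (mul_nonneg ENNReal.toReal_nonneg (Real.rpow_nonneg (h.nonneg x) _))
        (h.ineq x)) hCM
  obtain ⟨c, hc, hlow⟩ := exists_le_of_laplacian_nonpos hn hu2 h.nonneg hΔ h0
  rw [hfr] at hlow
  set b : ℝ := ((N : ℝ) - 2) / 2 with hb
  have hb0 : 0 < b := by simp only [hb]; linarith
  obtain ⟨k, hk, hK⟩ := exists_le_logRieszKernel (N := N) α β
  have hup : ∀ y : 𝔼, c ^ p * radialPowLog 4 (b * p) 0 y ≤ u y ^ p := fun y => by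
    have h1 : radialPowLog 4 (b * p) 0 y = radialPowLog 4 b 0 y ^ p := by
      have ht1 : 1 < 4 + ‖y‖ ^ 2 := by linarith [four_le_four_add_norm_sq y]
      simp only [radialPowLog]
      rw [powLog_rpow ht1, zero_mul]
    rw [h1, ← Real.mul_rpow hc.le (radialPowLog_pos y).le]
    exact Real.rpow_le_rpow (mul_pos hc (radialPowLog_pos y)).le (hlow y) (by linarith)
  refine ⟨?_, ?_⟩
  -- The lower bound for `u` is inserted in the convolution at the origin; integrability then
  -- restricts the exponents.
  · have hint : Integrable (radialPowLog 4 (α / 2 + b * p) β : 𝔼 → ℝ) := by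
      have hcont : Continuous (radialPowLog 4 (α / 2 + b * p) β : 𝔼 → ℝ) :=
        (contDiff_radialPowLog (n := 0) (by norm_num) (Or.inr (by norm_num))).continuous
      have hF := (h.integrable (by linarith) 0).const_mul (k * c ^ p)⁻¹
      have hball : IntegrableOn (radialPowLog 4 (α / 2 + b * p) β : 𝔼 → ℝ)
          (Metric.closedBall 0 4) :=
        hcont.continuousOn.integrableOn_compact (isCompact_closedBall _ _)
      rw [← integrableOn_univ, ← Set.union_compl_self (Metric.closedBall (0 : 𝔼) 4)]
      refine hball.union (Integrable.mono' hF.integrableOn hcont.aestronglyMeasurable.restrict ?_)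
      refine (ae_restrict_iff' measurableSet_closedBall.compl).2 (ae_of_all _ fun y hy => ?_)
      have hy4 : 4 ≤ ‖y‖ := by
        rw [Set.mem_compl_iff, mem_closedBall_zero_iff, not_le] at hy
        exact hy.le
      have h1 := hK y (0 - y) hy4 (by simp) (by simp; linarith)
      have ht1 : 1 < 4 + ‖y‖ ^ 2 := by linarith [four_le_four_add_norm_sq y]
      rw [Real.norm_of_nonneg (radialPowLog_pos y).le, le_inv_mul_iff₀ (by positivity)]
      have h2 := mul_le_mul h1 (hup y) (mul_pos (by positivity) (radialPowLog_pos y)).le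
        (logRieszKernel_nonneg _ _ _)
      refine le_trans (le_of_eq ?_) h2
      have h3 := powLog_mul_powLog (b := α / 2) (b' := b * p) (c := β) (c' := 0) ht1
      rw [add_zero] at h3
      simp only [radialPowLog]
      rw [← h3]; ring
    have := exponents_of_integrable_radialPowLog hn hint
    rw [hfr] at this
    have hbp : b * p = (N - 2) * p / 2 := by simp only [hb]; ring
    refine ⟨by linarith [this.1], fun hβ => by linarith [this.2 hβ]⟩
  · have key : ∀ θ c₀ R₀ : ℝ, 0 < c₀ →
        (∀ x : 𝔼, R₀ ≤ ‖x‖ → ENNReal.ofReal (c₀ * radialPowLog 4 (θ / 2) β x)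
          ≤ kernelConv α β p u x) →
        (N : ℝ) ≤ θ + (N - 2) * q ∧ (-1 < β → (N : ℝ) = θ + (N - 2) * q → q * (β + 1) ≤ 1) := by
      intro θ c₀ R₀ hc₀ hconv
      have hineq : ∀ x, R₀ ≤ ‖x‖ →
          c₀ * radialPowLog 4 (θ / 2) β x * u x ^ q ≤ Δ (Δ u) x - lam * Δ u x := fun x hx =>
        le_trans (mul_le_mul_of_nonneg_right
          ((ENNReal.ofReal_le_iff_le_toReal (h.conv_lt_top x).ne).1 (hconv x hx))
          (Real.rpow_nonneg (h.nonneg x) _)) (h.ineq x)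
      -- The first pass uses the plain lower bound, without logarithm.
      have h1 := exponents_of_lower_bounds (κ := 0) hn hq hlam hc₀ hc h.contDiff h.nonneg hΔ hineq
        (fun x _ => by rw [hfr]; exact hlow x)
      rw [hfr] at h1
      refine ⟨by nlinarith [h1.1], fun hβ heq => ?_⟩
      have hexp : θ / 2 + b * q = (N : ℝ) / 2 := by simp only [hb]; linarith
      -- In the equality case the right-hand side has order at least `|x| ^ (-N) log ^ β |x|`. The
      -- improved bound feeds a second pass with `κ = β + 1`, giving `β + (β + 1) * (q - 1) ≤ 0`,
      -- that is `q * (β + 1) ≤ 1`.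
      obtain ⟨c₁, hc₁, R₁, hR₁⟩ := exists_log_improvement (R₀ := R₀) (c₀ := c₀ * c ^ q) hn hβ hlam
        (by positivity) h.contDiff h.nonneg hΔ (fun x hx => by
          refine le_trans ?_ (hineq x hx)
          have ht1 : 1 < 4 + ‖x‖ ^ 2 := by linarith [four_le_four_add_norm_sq x]
          have h2 := powLog_mul_powLog (b := θ / 2) (b' := b * q) (c := β) (c' := 0 * q) ht1
          rw [hfr, ← hexp]
          have h3 : c ^ q * powLog (b * q) (0 * q) (4 + ‖x‖ ^ 2) ≤ u x ^ q := by
            rw [← powLog_rpow ht1, ← Real.mul_rpow hc.le (powLog_pos ht1).le]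
            exact Real.rpow_le_rpow (mul_pos hc (powLog_pos ht1)).le (hlow x) (by linarith)
          refine le_trans (le_of_eq ?_) (mul_le_mul_of_nonneg_left h3
            (mul_pos hc₀ (radialPowLog_pos x)).le)
          simp only [radialPowLog]
          rw [zero_mul, add_zero] at h2
          rw [← h2, zero_mul]; ring)
      have h4 := exponents_of_lower_bounds (R₀ := max R₀ R₁) hn hq hlam hc₀ hc₁ h.contDiff h.nonneg
        hΔ (fun x hx => hineq x ((le_max_left _ _).trans hx))
        (fun x hx => hR₁ x ((le_max_right _ _).trans hx))
      rw [hfr] at h4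
      have h5 := h4.2 (by nlinarith)
      nlinarith
    intro θ hθ
    rcases hθ with rfl | rfl
    -- `θ = α`: integrate only over the unit ball, where `4 + ‖y‖ ^ 2 ≤ 5` and `x - y` is comparable
    -- to `x`.
    · set m := c ^ p * (5 : ℝ) ^ (-(b * p)) with hm
      have hm0 : 0 < m := by positivity
      set ω := volume.real (Metric.closedBall (0 : 𝔼) 1)
      have hω : 0 < ω := ENNReal.toReal_pos
        (Metric.measure_closedBall_pos volume _ one_pos).ne'
        (isCompact_closedBall _ _).measure_lt_top.ne
      refine key θ (k * m * ω) 4 (by positivity) fun x hx => ?_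
      have h1 := mul_volume_le_kernelConv (α := θ) (β := β) (p := p) (u := u) (x := x)
        (s := Metric.closedBall 0 1) (m := k * radialPowLog 4 (θ / 2) β x * m)
        measurableSet_closedBall (fun y hy => ?_)
      · refine le_trans (le_of_eq ?_) h1
        rw [show volume (Metric.closedBall (0 : 𝔼) 1) = ENNReal.ofReal ω from
          (ENNReal.ofReal_toReal (isCompact_closedBall _ _).measure_lt_top.ne).symm,
          ← ENNReal.ofReal_mul (mul_nonneg (mul_pos hk (radialPowLog_pos x)).le hm0.le)]
        congr 1; ring
      · rw [mem_closedBall_zero_iff] at hy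
        have h2 := norm_sub_norm_le x y
        have h3 := norm_sub_le x y
        refine mul_le_mul (hK x (x - y) hx (by linarith) (by linarith)) ?_ hm0.le
          (logRieszKernel_nonneg _ _ _)
        refine le_trans ?_ (hup y)
        rw [hm]
        refine mul_le_mul_of_nonneg_left ?_ (by positivity)
        simp only [radialPowLog, powLog_zero]
        refine Real.rpow_le_rpow_of_nonpos (by positivity) ?_ (by nlinarith)
        nlinarith [norm_nonneg y]
    -- Second value of `θ`: integrate over the ball about `-x` of radius `‖x‖ / 2`, on which both
    -- `y` and `x - y` are comparable to `x`; its volume supplies the factor `|x| ^ N`.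
    · obtain ⟨k', hk', hcomp⟩ := powLog_comparable (b * p) 0
      set ω := volume.real (Metric.ball (0 : 𝔼) 1)
      have hω : 0 < ω := ENNReal.toReal_pos
        (Metric.measure_ball_pos volume _ one_pos).ne' measure_ball_lt_top.ne
      have hθ2 : (α + (N - 2) * p - N) / 2 = α / 2 + b * p + -(N / 2) := by simp only [hb]; ring
      refine key _ (k * (c ^ p * k') * (ω * 4 ^ (-(N : ℝ)))) 4 (by positivity) fun x hx => ?_
      have hx0 : 0 < ‖x‖ := by linarith
      have ht1 : 1 < 4 + ‖x‖ ^ 2 := by linarith [four_le_four_add_norm_sq x]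
      have h1 := mul_volume_le_kernelConv (α := α) (β := β) (p := p) (u := u) (x := x)
        (s := Metric.ball (-x) (‖x‖ / 2))
        (m := k * radialPowLog 4 (α / 2) β x * (c ^ p * (k' * radialPowLog 4 (b * p) 0 x)))
        measurableSet_ball (fun y hy => ?_)
      · refine le_trans ?_ h1
        rw [Measure.addHaar_ball volume _ (by positivity),
          show volume (Metric.ball (0 : 𝔼) 1) = ENNReal.ofReal ω from
          (ENNReal.ofReal_toReal measure_ball_lt_top.ne).symm, hfr,
          ← ENNReal.ofReal_mul (by positivity), ← ENNReal.ofReal_mul (by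
            have := radialPowLog_pos (b := α / 2) (c := β) x
            have := radialPowLog_pos (b := b * p) (c := 0) x
            positivity)]
        refine ENNReal.ofReal_le_ofReal ?_
        rw [hθ2]
        have e1 := powLog_mul_powLog (b := α / 2 + b * p) (b' := -(N / 2)) (c := β) (c' := 0) ht1
        have e2 := powLog_mul_powLog (b := α / 2) (b' := b * p) (c := β) (c' := 0) ht1
        rw [add_zero] at e1 e2
        have h4 : powLog (-(N / 2)) 0 (4 + ‖x‖ ^ 2) * 4 ^ (-(N : ℝ)) ≤ (‖x‖ / 2) ^ N := by
          rw [powLog_zero, neg_neg, Real.rpow_neg (by norm_num), Real.rpow_natCast]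
          simp only
          rw [show (N : ℝ) / 2 = 1 / 2 * N by ring, Real.rpow_mul_natCast (by linarith),
            ← Real.sqrt_eq_rpow, ← inv_pow, ← mul_pow]
          refine pow_le_pow_left₀ (by positivity) ?_ _
          have : Real.sqrt (4 + ‖x‖ ^ 2) ≤ 2 * ‖x‖ := by
            rw [Real.sqrt_le_left (by positivity)]; nlinarith
          linarith
        simp only [radialPowLog]
        rw [← e1, ← e2]
        have p1 := powLog_pos (b := α / 2) (c := β) ht1
        have p2 := powLog_pos (b := b * p) (c := 0) ht1
        have h5 := mul_le_mul_of_nonneg_left h4 (by positivity :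
          0 ≤ k * (c ^ p * k') * ω * (powLog (α / 2) β (4 + ‖x‖ ^ 2)
            * powLog (b * p) 0 (4 + ‖x‖ ^ 2)))
        linarith
      · rw [Metric.mem_ball, dist_eq_norm, sub_neg_eq_add] at hy
        have e1 : x - y = (2 : ℝ) • x - (y + x) := by rw [two_smul]; abel
        have e2 : ‖(2 : ℝ) • x‖ = 2 * ‖x‖ := by rw [norm_smul]; norm_num
        have h2 := norm_sub_norm_le ((2 : ℝ) • x) (y + x)
        have h3 := norm_sub_le ((2 : ℝ) • x) (y + x)
        rw [← e1, e2] at h2 h3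
        have h4 := norm_sub_norm_le (y + x) x
        have h5 := norm_sub_norm_le x (y + x)
        rw [show x - (y + x) = -y by abel, norm_neg] at h5
        rw [add_sub_cancel_right] at h4
        have h6 : ‖y‖ ≤ 3 / 2 * ‖x‖ := by
          have := norm_sub_le (y + x) x
          rw [add_sub_cancel_right] at this
          linarith
        refine mul_le_mul (hK x (x - y) hx (by linarith) (by linarith)) ?_ (by
            have := radialPowLog_pos (b := b * p) (c := 0) x
            positivity)
          (logRieszKernel_nonneg _ _ _)
        refine le_trans (mul_le_mul_of_nonneg_left ?_ (by positivity)) (hup y)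
        refine hcomp _ _ (by nlinarith) ?_ ?_
        · nlinarith [norm_nonneg y]
        · nlinarith [norm_nonneg y]

/-- The problem is translation invariant, so a point of positivity can be moved to the origin. -/
theorem HasNonnegSolutionPPlus.exponents (hN : 3 ≤ N) {α β p q : ℝ}
    (h : HasNonnegSolutionPPlus N α β p q) (hp : 1 ≤ p) (hq : 1 ≤ q) :
    ((N : ℝ) ≤ α + (N - 2) * p ∧ (-1 ≤ β → (N : ℝ) < α + (N - 2) * p)) ∧
    ∀ θ ∈ ({α, α + (N - 2) * p - N} : Set ℝ),
      (N : ℝ) ≤ θ + (N - 2) * q ∧ (-1 < β → (N : ℝ) = θ + (N - 2) * q → q * (β + 1) ≤ 1) := by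
  obtain ⟨lam, hlam, u, hu, hne⟩ := h
  obtain ⟨a, ha⟩ := Function.ne_iff.1 hne
  exact (hu.comp_add_right a).exponents hN hp hq hlam
    (by simpa using lt_of_le_of_ne (hu.nonneg a) (Ne.symm ha))

end Necessity

/-! ### Upper bounds for radial integrals. -/

section RadialIntegrals

open Module Filter Topology

variable {E : Type*} [NormedAddCommGroup E] [InnerProductSpace ℝ E] [FiniteDimensional ℝ E]
  [MeasurableSpace E] [BorelSpace E]

/-- Integration in polar coordinates over a radially symmetric set. -/
theorem integrable_radial_and_integral_le (hn : 1 ≤ finrank ℝ E) {f h : ℝ → ℝ} {s : Set ℝ}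
    (hs : MeasurableSet s) (hf : Measurable f) (hf0 : ∀ r, 0 ≤ f r)
    (hfh : ∀ r ∈ Set.Ioi 0 ∩ s, r ^ (finrank ℝ E - 1) * f r ≤ h r)
    (hh : IntegrableOn h (Set.Ioi 0 ∩ s)) :
    Integrable (fun y : E => s.indicator f ‖y‖) ∧
      ∫ y : E, s.indicator f ‖y‖ ≤ (finrank ℝ E * volume.real (Metric.ball (0 : E) 1)) *
        ∫ r in Set.Ioi 0 ∩ s, h r := by
  have : Nontrivial E := nontrivial_of_finrank_pos (R := ℝ) (by omega)
  have e : (fun r : ℝ => r ^ (finrank ℝ E - 1) • s.indicator f r)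
      = s.indicator fun r => r ^ (finrank ℝ E - 1) * f r := by
    ext r
    by_cases hr : r ∈ s <;> simp [hr]
  have hm : MeasurableSet (Set.Ioi (0 : ℝ) ∩ s) := measurableSet_Ioi.inter hs
  have hi : IntegrableOn (fun r => r ^ (finrank ℝ E - 1) * f r) (Set.Ioi 0 ∩ s) := by
    refine Integrable.mono' hh (((measurable_id.pow_const _).mul hf).aestronglyMeasurable) ?_
    refine (ae_restrict_iff' hm).2 (ae_of_all _ fun r hr => ?_)
    have : 0 ≤ r := le_of_lt hr.1
    rw [Real.norm_of_nonneg (mul_nonneg (by positivity) (hf0 r))]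
    exact hfh r hr
  constructor
  · rw [integrable_fun_norm_addHaar volume (f := s.indicator f), e,
      IntegrableOn, integrable_indicator_iff hs, IntegrableOn, Measure.restrict_restrict hs,
      Set.inter_comm]
    exact hi
  · rw [integral_fun_norm_addHaar volume (s.indicator f), e, setIntegral_indicator hs,
      nsmul_eq_mul, smul_eq_mul, ← mul_assoc]
    refine mul_le_mul_of_nonneg_left (setIntegral_mono_on hi hh hm hfh) ?_
    have : 0 ≤ volume.real (Metric.ball (0 : E) 1) := measureReal_nonneg
    positivity

/-- The power `|z| ^ (-a)` is integrable near the origin for `a < n`. -/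
theorem exists_integral_norm_rpow_le (hn : 1 ≤ finrank ℝ E) {a : ℝ} (ha : a < finrank ℝ E) :
    ∃ C > 0, ∀ ρ > 0, Integrable (fun z : E => (Set.Iic ρ).indicator (fun r => r ^ (-a)) ‖z‖) ∧
      ∫ z : E, (Set.Iic ρ).indicator (fun r => r ^ (-a)) ‖z‖ ≤ C * ρ ^ ((finrank ℝ E : ℝ) - a) := by
  set n : ℝ := (finrank ℝ E : ℝ) with hn_def
  set ω := volume.real (Metric.ball (0 : E) 1)
  have hω : 0 ≤ ω := measureReal_nonneg
  have hna : 0 < n - a := by linarith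
  refine ⟨n * ω / (n - a) + 1, by positivity, fun ρ hρ => ?_⟩
  have hS : Set.Ioi (0 : ℝ) ∩ Set.Iic ρ = Set.Ioc 0 ρ := Set.Ioi_inter_Iic
  have hint : IntervalIntegrable (fun r : ℝ => r ^ (n - 1 - a)) volume 0 ρ :=
    intervalIntegral.intervalIntegrable_rpow' (by linarith)
  -- The absolute value makes the profile non-negative on negative reals too; on norms nothing
  -- changes.
  have key := integrable_radial_and_integral_le (E := E) hn (f := fun r => |r| ^ (-a))
    (h := fun r => r ^ (n - 1 - a)) (s := Set.Iic ρ) measurableSet_Iic (by fun_prop)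
    (fun r => by positivity) (fun r hr => ?_) (by
      rw [hS]; exact (intervalIntegrable_iff_integrableOn_Ioc_of_le hρ.le).1 hint)
  · have e : ∀ z : E, (Set.Iic ρ).indicator (fun r : ℝ => |r| ^ (-a)) ‖z‖
        = (Set.Iic ρ).indicator (fun r => r ^ (-a)) ‖z‖ := fun z => by
      simp [Set.indicator]
    simp only [e] at key
    refine ⟨key.1, key.2.trans ?_⟩
    rw [hS, ← intervalIntegral.integral_of_le hρ.le, integral_rpow (Or.inl (by linarith)),
      show n - 1 - a + 1 = n - a by ring, Real.zero_rpow hna.ne', sub_zero]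
    have : n * ω * (ρ ^ (n - a) / (n - a)) = n * ω / (n - a) * ρ ^ (n - a) := by ring
    rw [this]
    have := Real.rpow_nonneg hρ.le (n - a)
    linarith
  · have hr0 : 0 < r := hr.1
    simp only [abs_of_pos hr0]
    rw [← Real.rpow_natCast, ← Real.rpow_add hr0, Nat.cast_sub hn, ← hn_def]
    refine le_of_eq ?_
    congr 1; push_cast; ring

/-- From `r ^ (n - 2) ≤ (4 + r ^ 2) ^ (n / 2 - 1)`. For `c + 1 ≠ 0` the right side has the primitive
`log (4 + r ^ 2) ^ (c + 1) / (2 * (c + 1))`, so the critical integrals become explicit. -/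
theorem pow_mul_powLog_le {n : ℕ} (hn : 2 ≤ n) {c r : ℝ} (hr : 0 < r) :
    r ^ (n - 1) * powLog (n / 2) c (4 + r ^ 2) ≤ r * powLog 1 c (4 + r ^ 2) := by
  have ht0 : 0 < 4 + r ^ 2 := by positivity
  have ht1 : 1 < 4 + r ^ 2 := by nlinarith
  have h1 := powLog_mul_powLog (b := (n : ℝ) / 2 - 1) (b' := 1) (c := 0) (c' := c) ht1
  rw [sub_add_cancel, zero_add] at h1
  rw [← h1, show n - 1 = (n - 2) + 1 by omega, pow_succ]
  have h2 : r ^ (n - 2) * powLog ((n : ℝ) / 2 - 1) 0 (4 + r ^ 2) ≤ 1 := by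
    have e2 : Real.sqrt (4 + r ^ 2) ^ (n - 2) = (4 + r ^ 2) ^ ((n : ℝ) / 2 - 1) := by
      rw [Real.sqrt_eq_rpow, ← Real.rpow_mul_natCast ht0.le]
      congr 1
      rw [Nat.cast_sub hn]
      push_cast; ring
    have h3 : r ^ (n - 2) ≤ Real.sqrt (4 + r ^ 2) ^ (n - 2) :=
      pow_le_pow_left₀ hr.le (Real.le_sqrt_of_sq_le (by linarith)) _
    rw [powLog_zero]
    simp only
    rw [Real.rpow_neg ht0.le, ← e2]
    have : 0 < Real.sqrt (4 + r ^ 2) ^ (n - 2) := pow_pos (Real.sqrt_pos.2 ht0) _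
    rw [← div_eq_mul_inv, div_le_one this]
    exact h3
  have h4 := powLog_pos (b := 1) (c := c) ht1
  have h5 := mul_le_mul_of_nonneg_right h2 (mul_pos hr h4).le
  linarith

theorem hasDerivAt_log_rpow_comp {c : ℝ} (hc : c + 1 ≠ 0) (r : ℝ) :
    HasDerivAt (fun r : ℝ => Real.log (4 + r ^ 2) ^ (c + 1) / (2 * (c + 1)))
      (r * powLog 1 c (4 + r ^ 2)) r := by
  have h1 : HasDerivAt (fun y : ℝ => 4 + y ^ 2) (2 * r) r := by
    simpa using (hasDerivAt_pow 2 r).const_add (4 : ℝ)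
  have hl : Real.log (4 + r ^ 2) ≠ 0 := (Real.log_pos (by nlinarith [sq_nonneg r])).ne'
  have ht : (4 + r ^ 2) ≠ 0 := by positivity
  refine (((h1.log ht).rpow_const (p := c + 1) (Or.inl hl)).div_const (2 * (c + 1))).congr_deriv ?_
  rw [powLog, Real.rpow_neg_one, add_sub_cancel_right]
  field_simp

theorem measurable_powLog (b c : ℝ) : Measurable (powLog b c) :=
  (measurable_id.pow_const _).mul (Real.measurable_log.pow_const _)

theorem measurable_powLog_comp (b c : ℝ) : Measurable fun r : ℝ => powLog b c (4 + r ^ 2) :=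
  (measurable_powLog b c).comp ((measurable_id.pow_const 2).const_add 4)

theorem powLog_comp_nonneg (b c r : ℝ) : 0 ≤ powLog b c (4 + r ^ 2) :=
  (powLog_pos (by nlinarith [sq_nonneg r])).le

/-- The integral of `(4 + |y| ^ 2) ^ (-n / 2)` over a ball grows logarithmically. -/
theorem exists_integral_ball_powLog_le (hn : 2 ≤ finrank ℝ E) :
    ∃ C > 0, ∀ ρ > 0,
      Integrable (fun y : E => (Set.Iic ρ).indicator
        (fun r => powLog ((finrank ℝ E : ℝ) / 2) 0 (4 + r ^ 2)) ‖y‖) ∧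
      ∫ y : E, (Set.Iic ρ).indicator (fun r => powLog ((finrank ℝ E : ℝ) / 2) 0 (4 + r ^ 2)) ‖y‖
        ≤ C * Real.log (4 + ρ ^ 2) := by
  set ω := volume.real (Metric.ball (0 : E) 1)
  have hω : 0 ≤ ω := measureReal_nonneg
  refine ⟨finrank ℝ E * ω + 1, by positivity, fun ρ hρ => ?_⟩
  have hS : Set.Ioi (0 : ℝ) ∩ Set.Iic ρ = Set.Ioc 0 ρ := Set.Ioi_inter_Iic
  have hder := fun r => hasDerivAt_log_rpow_comp (c := 0) (by norm_num) r
  have hcont : Continuous fun r : ℝ => r * powLog 1 0 (4 + r ^ 2) := by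
    rw [powLog_zero]
    exact continuous_id.mul (Continuous.rpow_const (by fun_prop) fun r => Or.inl (by positivity))
  have hint : IntervalIntegrable (fun r : ℝ => r * powLog 1 0 (4 + r ^ 2)) volume 0 ρ :=
    hcont.intervalIntegrable _ _
  have key := integrable_radial_and_integral_le (E := E) (by omega) (s := Set.Iic ρ)
    measurableSet_Iic (measurable_powLog_comp ((finrank ℝ E : ℝ) / 2) 0)
    (powLog_comp_nonneg _ _) (h := fun r => r * powLog 1 0 (4 + r ^ 2))
    (fun r hr => pow_mul_powLog_le hn hr.1) (by
      rw [hS]; exact (intervalIntegrable_iff_integrableOn_Ioc_of_le hρ.le).1 hint)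
  refine ⟨key.1, key.2.trans ?_⟩
  rw [hS, ← intervalIntegral.integral_of_le hρ.le,
    intervalIntegral.integral_eq_sub_of_hasDerivAt (fun r _ => hder r) hint]
  have h4 : 0 < Real.log 4 := Real.log_pos (by norm_num)
  have hL : 0 < Real.log (4 + ρ ^ 2) := Real.log_pos (by nlinarith)
  norm_num
  rw [← sub_div]
  have h5 : (Real.log (4 + ρ ^ 2) - Real.log 4) / 2 ≤ Real.log (4 + ρ ^ 2) := by linarith
  have h6 := mul_le_mul_of_nonneg_left h5 (by positivity : 0 ≤ finrank ℝ E * ω)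
  linarith

/-- Tail integrals of `(4 + |y| ^ 2) ^ (-n / 2) (log (4 + |y| ^ 2)) ^ c` with `c < -1`. -/
theorem exists_integral_compl_ball_powLog_le (hn : 2 ≤ finrank ℝ E) {c : ℝ} (hc : c < -1) :
    ∃ C > 0, ∀ ρ, 0 ≤ ρ →
      Integrable (fun y : E => (Set.Ioi ρ).indicator
        (fun r => powLog ((finrank ℝ E : ℝ) / 2) c (4 + r ^ 2)) ‖y‖) ∧
      ∫ y : E, (Set.Ioi ρ).indicator (fun r => powLog ((finrank ℝ E : ℝ) / 2) c (4 + r ^ 2)) ‖y‖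
        ≤ C * Real.log (4 + ρ ^ 2) ^ (c + 1) := by
  set ω := volume.real (Metric.ball (0 : E) 1)
  have hω : 0 ≤ ω := measureReal_nonneg
  have hc1 : 0 < -(c + 1) := by linarith
  refine ⟨finrank ℝ E * ω / (2 * -(c + 1)) + 1, by positivity, fun ρ hρ => ?_⟩
  have hS : Set.Ioi (0 : ℝ) ∩ Set.Ioi ρ = Set.Ioi ρ :=
    Set.inter_eq_right.2 (Set.Ioi_subset_Ioi hρ)
  have hder := fun r => hasDerivAt_log_rpow_comp (c := c) (by linarith) r
  have hlim : Tendsto (fun r : ℝ => Real.log (4 + r ^ 2) ^ (c + 1) / (2 * (c + 1))) atTop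
      (𝓝 0) := by
    have hT : Tendsto (fun y : ℝ => 4 + y ^ 2) atTop atTop :=
      tendsto_atTop_add_const_left _ _ (tendsto_pow_atTop two_ne_zero)
    have h1 := ((tendsto_rpow_neg_atTop hc1).comp (Real.tendsto_log_atTop.comp hT)).div_const
      (2 * (c + 1))
    simpa [Function.comp_def] using h1
  have hpos : ∀ r ∈ Set.Ioi ρ, 0 ≤ r * powLog 1 c (4 + r ^ 2) := fun r hr =>
    mul_nonneg (hρ.trans (le_of_lt hr)) (powLog_comp_nonneg _ _ _)
  have key := integrable_radial_and_integral_le (E := E) (by omega) (s := Set.Ioi ρ)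
    measurableSet_Ioi (measurable_powLog_comp ((finrank ℝ E : ℝ) / 2) c)
    (powLog_comp_nonneg _ _) (h := fun r => r * powLog 1 c (4 + r ^ 2))
    (fun r hr => pow_mul_powLog_le hn hr.1) (by
      rw [hS]
      exact integrableOn_Ioi_deriv_of_nonneg' (fun r _ => hder r) hpos hlim)
  refine ⟨key.1, key.2.trans ?_⟩
  rw [hS, integral_Ioi_of_hasDerivAt_of_nonneg' (fun r _ => hder r) hpos hlim]
  have hL : 0 < Real.log (4 + ρ ^ 2) ^ (c + 1) :=
    Real.rpow_pos_of_pos (Real.log_pos (by nlinarith)) _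
  have e : (finrank ℝ E * ω) * (0 - Real.log (4 + ρ ^ 2) ^ (c + 1) / (2 * (c + 1)))
      = finrank ℝ E * ω / (2 * -(c + 1)) * Real.log (4 + ρ ^ 2) ^ (c + 1) := by
    have : c + 1 ≠ 0 := by linarith
    field_simp
    ring
  rw [e]
  linarith

end RadialIntegrals

/-! ### Upper bound for the convolution with a decaying function. -/

section ConvolutionEstimate

open Module Filter Topology

variable {N : ℕ}

local notation "𝔼" => EuclideanSpace ℝ (Fin N)

/-- Concavity of the logarithm, in the form of Bernoulli's inequality. -/
theorem mul_log_one_add_le {r ρ : ℝ} (hr : 0 ≤ r) (hρ : 0 < ρ) (h : r ≤ ρ) :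
    r / ρ * Real.log (1 + ρ) ≤ Real.log (1 + r) := by
  rw [← Real.log_rpow (by linarith)]
  refine Real.log_le_log (by positivity) ?_
  have := rpow_one_add_le_one_add_mul_self (s := ρ) (p := r / ρ) (by linarith) (by positivity)
    (by rw [div_le_one hρ]; exact h)
  rwa [div_mul_cancel₀ _ hρ.ne'] at this

/-- Because `β < 0`, concavity bounds the kernel above: the singularity at `0` worsens from `α` to
`α - β`, but the full factor `log ^ β` at the scale of `x` is kept, which is what the critical case
needs. -/
theorem logRieszKernel_le {α β : ℝ} (hβ : β < 0) (x z : 𝔼)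
    (hz : ‖z‖ ≤ 6 * Real.sqrt (4 + ‖x‖ ^ 2)) :
    logRieszKernel α β z ≤ 12 ^ (-β) * radialPowLog 4 (β / 2) β x * ‖z‖ ^ (-(α - β)) := by
  have hP := radialPowLog_pos (b := β / 2) (c := β) x
  rcases (norm_nonneg z).eq_or_lt with h0 | h0
  -- At `z = 0` the kernel vanishes, by the convention `0 ^ β = 0` for `β ≠ 0`.
  · rw [logRieszKernel, ← h0]
    simp only [add_zero, Real.log_one, Real.zero_rpow hβ.ne, mul_zero]
    have := Real.rpow_nonneg (le_refl (0 : ℝ)) (-(α - β))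
    positivity
  · set T := 4 + ‖x‖ ^ 2 with hT
    have hT4 : 4 ≤ T := four_le_four_add_norm_sq x
    have hT0 : 0 < T := by linarith
    have hs : 0 < Real.sqrt T := Real.sqrt_pos.2 hT0
    have hL : 0 < Real.log T := Real.log_pos (by linarith)
    have h1 := mul_log_one_add_le h0.le (by positivity : 0 < 6 * Real.sqrt T) hz
    have h2 : Real.log T / 2 ≤ Real.log (1 + 6 * Real.sqrt T) := by
      rw [← Real.log_sqrt hT0.le]
      exact Real.log_le_log hs (by linarith)
    have h3 : ‖z‖ / (12 * Real.sqrt T) * Real.log T ≤ Real.log (1 + ‖z‖) := by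
      refine le_trans ?_ (le_trans (mul_le_mul_of_nonneg_left h2 (by positivity)) h1)
      refine le_of_eq ?_
      field_simp
      norm_num
    have h4 := Real.rpow_le_rpow_of_nonpos (by positivity) h3 hβ.le
    have e1 : (‖z‖ / (12 * Real.sqrt T) * Real.log T) ^ β
        = 12 ^ (-β) * (T ^ (-(β / 2)) * Real.log T ^ β) * ‖z‖ ^ β := by
      rw [Real.mul_rpow (by positivity) hL.le, Real.div_rpow h0.le (by positivity),
        Real.mul_rpow (by norm_num) hs.le, Real.sqrt_eq_rpow, ← Real.rpow_mul hT0.le,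
        Real.rpow_neg (by norm_num), Real.rpow_neg hT0.le, show 1 / 2 * β = β / 2 by ring]
      field_simp
    rw [e1] at h4
    have h5 := mul_le_mul_of_nonneg_left h4 (Real.rpow_nonneg h0.le (-α))
    refine h5.trans (le_of_eq ?_)
    rw [show -(α - β) = -α + β by ring, Real.rpow_add h0, radialPowLog, powLog]
    ring

theorem logRieszKernel_le_of_comparable {α β : ℝ} (hβ : β < 0) (hαβ : 0 ≤ α - β) (x z : 𝔼)
    (h1 : (1 + ‖x‖) / 2 ≤ ‖z‖) (h2 : ‖z‖ ≤ 2 * (1 + ‖x‖)) :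
    logRieszKernel α β z ≤ 12 ^ (-β) * 4 ^ (α - β) * radialPowLog 4 (α / 2) β x := by
  have hx := norm_nonneg x
  have hT0 : 0 < 4 + ‖x‖ ^ 2 := by positivity
  have hs : 0 < Real.sqrt (4 + ‖x‖ ^ 2) := Real.sqrt_pos.2 hT0
  have hs1 : 1 + ‖x‖ ≤ 2 * Real.sqrt (4 + ‖x‖ ^ 2) := by
    nlinarith [Real.sq_sqrt hT0.le, sq_nonneg (‖x‖ - 1)]
  have hs2 : Real.sqrt (4 + ‖x‖ ^ 2) ≤ 2 * (1 + ‖x‖) := by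
    rw [Real.sqrt_le_left (by positivity)]; nlinarith
  refine (logRieszKernel_le (α := α) hβ x z (by linarith)).trans ?_
  have h3 : ‖z‖ ^ (-(α - β)) ≤ (Real.sqrt (4 + ‖x‖ ^ 2) / 4) ^ (-(α - β)) :=
    Real.rpow_le_rpow_of_nonpos (by positivity) (by linarith) (by linarith)
  have e1 : (Real.sqrt (4 + ‖x‖ ^ 2) / 4) ^ (-(α - β))
      = 4 ^ (α - β) * powLog ((α - β) / 2) 0 (4 + ‖x‖ ^ 2) := by
    rw [Real.div_rpow hs.le (by norm_num), Real.sqrt_eq_rpow, ← Real.rpow_mul hT0.le, powLog_zero,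
      Real.rpow_neg (by norm_num : (0 : ℝ) ≤ 4)]
    simp only [div_inv_eq_mul]
    rw [mul_comm]; congr 2; ring
  rw [e1] at h3
  have hP := radialPowLog_pos (b := β / 2) (c := β) x
  have h4 := mul_le_mul_of_nonneg_left h3
    (by positivity : 0 ≤ 12 ^ (-β) * radialPowLog 4 (β / 2) β x)
  refine h4.trans (le_of_eq ?_)
  have h5 := powLog_mul_powLog (b := β / 2) (b' := (α - β) / 2) (c := β) (c' := 0)
    (show 1 < 4 + ‖x‖ ^ 2 by nlinarith)
  rw [add_zero, show β / 2 + (α - β) / 2 = α / 2 by ring] at h5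
  simp only [radialPowLog]
  rw [← h5]; ring

/-- According to the sign of `s - M`, the factor `t ^ (M - s)` is at most its value at `T` or at
most `1`. With `M = N / 2`, every decay rate is reduced to the one whose integral over balls is
logarithmic. -/
theorem powLog_zero_le_of_le {s M t T : ℝ} (ht : 4 ≤ t) (h : t ≤ T) :
    powLog s 0 t ≤ (1 + powLog (s - M) 0 T) * powLog M 0 t := by
  have ht1 : 1 < t := by linarith
  have h1 := powLog_mul_powLog (b := s - M) (b' := M) (c := 0) (c' := 0) ht1
  rw [sub_add_cancel, add_zero] at h1
  rw [← h1]
  refine mul_le_mul_of_nonneg_right ?_ (powLog_pos ht1).le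
  rcases le_total (s - M) 0 with h2 | h2
  · have : powLog (s - M) 0 t ≤ powLog (s - M) 0 T := by
      simp only [powLog_zero]
      exact Real.rpow_le_rpow (by linarith) h (by linarith)
    linarith
  · have h3 : powLog (s - M) 0 t ≤ 1 := by
      simp only [powLog_zero]
      exact Real.rpow_le_one_of_one_le_of_nonpos (by linarith) (by linarith)
    have := powLog_pos (b := s - M) (c := 0) (show 1 < T by linarith)
    linarith

theorem powLog_zero_le_of_le_mul {s t T : ℝ} (hs : 0 ≤ s) (ht : 0 < t) (hT : 0 < T)
    (h : T ≤ 16 * t) : powLog s 0 t ≤ 16 ^ s * powLog s 0 T := by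
  simp only [powLog_zero]
  rw [Real.rpow_neg hT.le, ← div_eq_mul_inv, ← Real.div_rpow (by norm_num) hT.le,
    Real.rpow_neg ht.le, ← Real.inv_rpow ht.le]
  refine Real.rpow_le_rpow (by positivity) ?_ hs
  rw [inv_le_comm₀ ht (by positivity), inv_div, div_le_iff₀ (by norm_num)]
  linarith

set_option maxHeartbeats 1000000 in
/-- Upper bound for the convolution of the kernel with a function of power decay. -/
theorem exists_kernelConv_le {α β σ d τ C₀ : ℝ} (hN : 3 ≤ N) (hβ : β < 0) (hαβ : 0 ≤ α - β)
    (hαN : α - β < N) (hσ : 0 ≤ σ) (hd : (N : ℝ) / 2 ≤ d) (hτ : τ < -1) (hC₀ : 0 < C₀)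
    (hC : ∀ x : 𝔼, radialPowLog 4 ((α + σ) / 2) β x ≤ C₀ * radialPowLog 4 d τ x) :
    ∃ C > 0, ∀ (p : ℝ) (u : 𝔼 → ℝ), (∀ y, 0 ≤ u y ^ p) →
      (∀ y, u y ^ p ≤ radialPowLog 4 (σ / 2) 0 y) → ∀ x, kernelConv α β p u x ≤
        ENNReal.ofReal (C * (radialPowLog 4 (α / 2) (β + 1) x
          + radialPowLog 4 ((α + σ - N) / 2) (β + 1) x
          + radialPowLog 4 (d - N / 2) (τ + 1) x)) := by
  have hfr : finrank ℝ 𝔼 = N := by simp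
  obtain ⟨A₁, hA₁, hA⟩ := exists_integral_ball_powLog_le (E := 𝔼) (by omega)
  obtain ⟨A₂, hA₂, hB⟩ := exists_integral_norm_rpow_le (E := 𝔼) (by omega) (a := α - β)
    (by rw [hfr]; exact hαN)
  obtain ⟨A₃, hA₃, hT⟩ := exists_integral_compl_ball_powLog_le (E := 𝔼) (by omega) hτ
  rw [hfr] at hA hB hT
  set K₁ : ℝ := 12 ^ (-β) * 4 ^ (α - β) with hK₁
  set K₂ : ℝ := 12 ^ (-β) with hK₂
  have hK₁0 : 0 < K₁ := by positivity
  have hK₂0 : 0 < K₂ := by positivity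
  set B₂ := K₂ * 16 ^ (σ / 2) * (A₂ * 6 ^ ((N : ℝ) - (α - β))) with hB₂
  have hB₂0 : 0 < B₂ := by positivity
  refine ⟨K₁ * (2 * A₁) + B₂ + K₁ * C₀ * A₃, by positivity, fun p u hu0 hu x => ?_⟩
  have hx0 := norm_nonneg x
  set T := 4 + ‖x‖ ^ 2 with hTdef
  have hT4 : 4 ≤ T := four_le_four_add_norm_sq x
  have hT1 : 1 < T := by linarith
  have hs : 0 < Real.sqrt T := Real.sqrt_pos.2 (by linarith)
  have hs1 : 1 + ‖x‖ ≤ 2 * Real.sqrt T := by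
    nlinarith [Real.sq_sqrt (by linarith : 0 ≤ T), sq_nonneg (‖x‖ - 1)]
  obtain ⟨iA, bA⟩ := hA (1 + ‖x‖) (by positivity)
  obtain ⟨iB, bB⟩ := hB (6 * Real.sqrt T) (by positivity)
  obtain ⟨iC, bC⟩ := hT ‖x‖ hx0
  have iB' := iB.comp_sub_left x
  set fA : 𝔼 → ℝ := fun y => (Set.Iic (1 + ‖x‖)).indicator
    (fun r => powLog ((N : ℝ) / 2) 0 (4 + r ^ 2)) ‖y‖ with hfA
  set fB : 𝔼 → ℝ := fun y => (Set.Iic (6 * Real.sqrt T)).indicator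
    (fun r => r ^ (-(α - β))) ‖x - y‖ with hfB
  set fC : 𝔼 → ℝ := fun y => (Set.Ioi ‖x‖).indicator
    (fun r => powLog ((N : ℝ) / 2) τ (4 + r ^ 2)) ‖y‖ with hfC
  have fA0 : ∀ y, 0 ≤ fA y := fun y =>
    Set.indicator_nonneg (fun r _ => powLog_comp_nonneg _ _ r) _
  have fC0 : ∀ y, 0 ≤ fC y := fun y =>
    Set.indicator_nonneg (fun r _ => powLog_comp_nonneg _ _ r) _
  have fB0 : ∀ y, 0 ≤ fB y := fun y => by
    simp only [hfB, Set.indicator]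
    split_ifs <;> positivity
  have pP : ∀ b c, 0 < powLog b c T := fun b c => powLog_pos hT1
  set cA := K₁ * powLog (α / 2) β T * (1 + powLog (σ / 2 - N / 2) 0 T) with hcA
  set cB := K₂ * powLog (β / 2) β T * (16 ^ (σ / 2) * powLog (σ / 2) 0 T) with hcB
  set cC := K₁ * C₀ * powLog (d - N / 2) 0 T with hcC
  have cA0 : 0 ≤ cA := by have := pP (α / 2) β; have := pP (σ / 2 - N / 2) 0; positivity
  have cB0 : 0 ≤ cB := by have := pP (β / 2) β; have := pP (σ / 2) 0; positivity
  have cC0 : 0 ≤ cC := by have := pP (d - N / 2) 0; positivity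
  have hpt : ∀ y, logRieszKernel α β (x - y) * u y ^ p ≤ cA * fA y + cB * fB y + cC * fC y := by
    intro y
    have hy0 := norm_nonneg y
    have hty : 4 ≤ 4 + ‖y‖ ^ 2 := four_le_four_add_norm_sq y
    have n1 := norm_sub_norm_le x y
    have n2 := norm_sub_le x y
    have n3 := norm_sub_norm_le y x
    rw [norm_sub_rev y x] at n3
    have tA := mul_nonneg cA0 (fA0 y)
    have tB := mul_nonneg cB0 (fB0 y)
    have tC := mul_nonneg cC0 (fC0 y)
    have hK0 := logRieszKernel_nonneg α β (x - y)
    -- Three zones. For `y` small compared with `x`, the kernel has its size at `x` and the integral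
    -- of `fA` adds one logarithm. For `y` comparable to `x`, `u ^ p` has its size at `x` and `fB`
    -- integrates the singularity, using `α - β < N`. For `y` large, the kernel has its size at `y`
    -- and the tail of `fC` converges since `τ < -1`.
    rcases lt_or_ge (1 + ‖y‖) ((1 + ‖x‖) / 2) with hA' | hA'
    · have h1 := logRieszKernel_le_of_comparable hβ hαβ x (x - y) (by linarith) (by linarith)
      have h2 : u y ^ p ≤ (1 + powLog (σ / 2 - N / 2) 0 T) * fA y := by
        refine (hu y).trans ?_
        have : ‖y‖ ∈ Set.Iic (1 + ‖x‖) := by simp only [Set.mem_Iic]; linarith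
        simp only [hfA, Set.indicator_of_mem this]
        refine powLog_zero_le_of_le hty ?_
        simp only [hTdef]; nlinarith
      have h3 := mul_le_mul h1 h2 (hu0 y) (hK0.trans h1)
      have e : K₁ * radialPowLog 4 (α / 2) β x * ((1 + powLog (σ / 2 - N / 2) 0 T) * fA y)
          = cA * fA y := by rw [hcA, radialPowLog]; ring
      rw [e] at h3
      linarith
    · rcases le_or_gt (1 + ‖y‖) (2 * (1 + ‖x‖)) with hB' | hB'
      · have hz : ‖x - y‖ ≤ 6 * Real.sqrt T := by linarith
        have h1 := logRieszKernel_le (α := α) hβ x (x - y) hz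
        have h2 : u y ^ p ≤ 16 ^ (σ / 2) * powLog (σ / 2) 0 T := by
          refine (hu y).trans ?_
          refine powLog_zero_le_of_le_mul (by linarith) (by linarith) (by linarith) ?_
          have hxy : ‖x‖ ≤ 2 * ‖y‖ + 1 := by linarith
          simp only [hTdef]
          nlinarith [sq_nonneg (‖y‖ - 1)]
        have h3 := mul_le_mul h1 h2 (hu0 y) (hK0.trans h1)
        have hm : ‖x - y‖ ∈ Set.Iic (6 * Real.sqrt T) := hz
        have e : K₂ * radialPowLog 4 (β / 2) β x * ‖x - y‖ ^ (-(α - β))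
            * (16 ^ (σ / 2) * powLog (σ / 2) 0 T) = cB * fB y := by
          simp only [hfB, Set.indicator_of_mem hm, hcB, radialPowLog]; ring
        rw [e] at h3
        linarith
      · have h1 := logRieszKernel_le_of_comparable hβ hαβ y (x - y) (by linarith) (by linarith)
        have h3 := mul_le_mul h1 (hu y) (hu0 y) (hK0.trans h1)
        have hm : ‖y‖ ∈ Set.Ioi ‖x‖ := by simp only [Set.mem_Ioi]; linarith
        have hty1 : 1 < 4 + ‖y‖ ^ 2 := by linarith
        have e1 := powLog_mul_powLog (b := α / 2) (b' := σ / 2) (c := β) (c' := 0) hty1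
        rw [add_zero, ← add_div] at e1
        have e2 := powLog_mul_powLog (b := d - N / 2) (b' := (N : ℝ) / 2) (c := 0) (c' := τ) hty1
        rw [zero_add, sub_add_cancel] at e2
        have h4 : powLog (d - N / 2) 0 (4 + ‖y‖ ^ 2) ≤ powLog (d - N / 2) 0 T := by
          simp only [powLog_zero]
          refine Real.rpow_le_rpow_of_nonpos (by linarith) ?_ (by linarith)
          have : ‖x‖ ≤ ‖y‖ := le_of_lt hm
          simp only [hTdef]; gcongr
        have h5 : powLog ((α + σ) / 2) β (4 + ‖y‖ ^ 2) ≤ C₀ * powLog d τ (4 + ‖y‖ ^ 2) := hC y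
        have h6 : logRieszKernel α β (x - y) * u y ^ p ≤ cC * fC y := by
          refine h3.trans ?_
          simp only [hfC, Set.indicator_of_mem hm, radialPowLog]
          calc K₁ * powLog (α / 2) β (4 + ‖y‖ ^ 2) * powLog (σ / 2) 0 (4 + ‖y‖ ^ 2)
              = K₁ * powLog ((α + σ) / 2) β (4 + ‖y‖ ^ 2) := by rw [← e1]; ring
            _ ≤ K₁ * (C₀ * powLog d τ (4 + ‖y‖ ^ 2)) := by gcongr
            _ = K₁ * C₀ * powLog (N / 2) τ (4 + ‖y‖ ^ 2)
                * powLog (d - N / 2) 0 (4 + ‖y‖ ^ 2) := by rw [← e2]; ring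
            _ ≤ K₁ * C₀ * powLog (N / 2) τ (4 + ‖y‖ ^ 2) * powLog (d - N / 2) 0 T :=
                mul_le_mul_of_nonneg_left h4
                  (mul_nonneg (by positivity) (powLog_comp_nonneg _ _ _))
            _ = _ := by rw [hcC]; ring
        linarith
  have iAB : Integrable fun y => cA * fA y + cB * fB y :=
    (iA.const_mul cA).add (iB'.const_mul cB)
  have iAll : Integrable fun y => cA * fA y + cB * fB y + cC * fC y :=
    iAB.add (iC.const_mul cC)
  have hle : kernelConv α β p u x
      ≤ ENNReal.ofReal (∫ y, (cA * fA y + cB * fB y + cC * fC y)) := by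
    rw [ofReal_integral_eq_lintegral_ofReal iAll (ae_of_all _ fun y =>
      add_nonneg (add_nonneg (mul_nonneg cA0 (fA0 y)) (mul_nonneg cB0 (fB0 y)))
        (mul_nonneg cC0 (fC0 y)))]
    exact lintegral_mono fun y => ENNReal.ofReal_le_ofReal (hpt y)
  refine hle.trans (ENNReal.ofReal_le_ofReal ?_)
  rw [integral_add iAB (iC.const_mul cC),
    integral_add (iA.const_mul cA) (iB'.const_mul cB), integral_const_mul, integral_const_mul,
    integral_const_mul]
  have eB : ∫ y, fB y = ∫ z : 𝔼, (Set.Iic (6 * Real.sqrt T)).indicator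
      (fun r => r ^ (-(α - β))) ‖z‖ :=
    integral_sub_left_eq_self (fun z : 𝔼 => (Set.Iic (6 * Real.sqrt T)).indicator
      (fun r => r ^ (-(α - β))) ‖z‖) volume x
  rw [← eB] at bB
  have hL1 : Real.log (4 + (1 + ‖x‖) ^ 2) ≤ 2 * powLog 0 1 T := by
    have h1 : Real.log (4 + (1 + ‖x‖) ^ 2) ≤ Real.log (T ^ 2) := by
      refine Real.log_le_log (by positivity) ?_
      simp only [hTdef]; nlinarith [sq_nonneg (‖x‖ - 1), sq_nonneg (‖x‖ ^ 2)]
    rw [Real.log_pow] at h1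
    simpa [powLog] using h1
  have m1 : powLog (α / 2) β T * powLog 0 1 T = powLog (α / 2) (β + 1) T := by
    rw [powLog_mul_powLog hT1, add_zero]
  have m2 : powLog (α / 2) β T * powLog (σ / 2 - N / 2) 0 T * powLog 0 1 T
      = powLog ((α + σ - N) / 2) (β + 1) T := by
    rw [powLog_mul_powLog hT1, powLog_mul_powLog hT1]
    congr 1 <;> ring
  have m3 : powLog (d - N / 2) 0 T * powLog 0 (τ + 1) T = powLog (d - N / 2) (τ + 1) T := by
    rw [powLog_mul_powLog hT1, add_zero, zero_add]
  have m4 : powLog (β / 2) β T * powLog (σ / 2) 0 T * powLog (-(N - (α - β)) / 2) 0 T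
      = powLog ((α + σ - N) / 2) β T := by
    rw [powLog_mul_powLog hT1, powLog_mul_powLog hT1]
    congr 1 <;> ring
  have m5 : powLog ((α + σ - N) / 2) β T ≤ powLog ((α + σ - N) / 2) (β + 1) T :=
    powLog_le_powLog hT4 le_rfl (by linarith)
  have m6 : (6 * Real.sqrt T) ^ ((N : ℝ) - (α - β))
      = 6 ^ ((N : ℝ) - (α - β)) * powLog (-(N - (α - β)) / 2) 0 T := by
    rw [Real.mul_rpow (by norm_num) hs.le, Real.sqrt_eq_rpow, ← Real.rpow_mul (by linarith),
      powLog_zero]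
    congr 2; ring
  have m7 : Real.log (4 + ‖x‖ ^ 2) ^ (τ + 1) = powLog 0 (τ + 1) T := by simp [powLog, hTdef]
  have tA : cA * ∫ y, fA y ≤ K₁ * (2 * A₁) * (powLog (α / 2) (β + 1) T
      + powLog ((α + σ - N) / 2) (β + 1) T) := by
    calc cA * ∫ y, fA y ≤ cA * (A₁ * (2 * powLog 0 1 T)) :=
          mul_le_mul_of_nonneg_left (bA.trans (mul_le_mul_of_nonneg_left hL1 hA₁.le)) cA0
      _ = _ := by rw [hcA, ← m1, ← m2]; ring
  have tB : cB * ∫ y, fB y ≤ B₂ * powLog ((α + σ - N) / 2) (β + 1) T := by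
    calc cB * ∫ y, fB y ≤ cB * (A₂ * (6 * Real.sqrt T) ^ ((N : ℝ) - (α - β))) :=
          mul_le_mul_of_nonneg_left bB cB0
      _ = B₂ * powLog ((α + σ - N) / 2) β T := by rw [m6, hcB, hB₂, ← m4]; ring
      _ ≤ _ := mul_le_mul_of_nonneg_left m5 hB₂0.le
  have tC : cC * ∫ y, fC y ≤ K₁ * C₀ * A₃ * powLog (d - N / 2) (τ + 1) T := by
    rw [m7] at bC
    calc cC * ∫ y, fC y ≤ cC * (A₃ * powLog 0 (τ + 1) T) := mul_le_mul_of_nonneg_left bC cC0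
      _ = _ := by rw [hcC, ← m3]; ring
  simp only [radialPowLog]
  have p1 := pP (α / 2) (β + 1)
  have p2 := pP ((α + σ - N) / 2) (β + 1)
  have p3 := pP (d - N / 2) (τ + 1)
  have k1 : 0 < K₁ * (2 * A₁) := by positivity
  have k2 : 0 < K₁ * C₀ * A₃ := by positivity
  refine (add_le_add (add_le_add tA tB) tC).trans ?_
  generalize K₁ * (2 * A₁) = a at *
  generalize K₁ * C₀ * A₃ = c at *
  change a * (powLog (α / 2) (β + 1) T + powLog ((α + σ - N) / 2) (β + 1) T)
    + B₂ * powLog ((α + σ - N) / 2) (β + 1) T + c * powLog (d - N / 2) (τ + 1) T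
    ≤ (a + B₂ + c) * (powLog (α / 2) (β + 1) T + powLog ((α + σ - N) / 2) (β + 1) T
      + powLog (d - N / 2) (τ + 1) T)
  generalize powLog (α / 2) (β + 1) T = q1 at *
  generalize powLog ((α + σ - N) / 2) (β + 1) T = q2 at *
  generalize powLog (d - N / 2) (τ + 1) T = q3 at *
  have r1 := mul_pos k1 p3
  have r2 := mul_pos hB₂0 p1
  have r3 := mul_pos hB₂0 p3
  have r4 := mul_pos k2 p1
  have r5 := mul_pos k2 p2
  linarith

end ConvolutionEstimate

/-! ### Construction of solutions. -/

section Existence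

open Laplacian InnerProductSpace Module Filter Topology

/-- Any strict gain of power absorbs any power of the logarithm. -/
theorem exists_powLog_le_mul {b b' : ℝ} (c c' : ℝ) (h : b' < b) :
    ∃ C > 0, ∀ t, 4 ≤ t → powLog b c t ≤ C * powLog b' c' t := by
  suffices H : ∃ C > 0, ∀ t, 4 ≤ t → powLog (b - b') (c - c') t ≤ C by
    obtain ⟨C, hC, H⟩ := H
    refine ⟨C, hC, fun t ht => ?_⟩
    have ht1 : 1 < t := by linarith
    have h1 := powLog_mul_powLog (b := b - b') (b' := b') (c := c - c') (c' := c') ht1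
    rw [sub_add_cancel, sub_add_cancel] at h1
    rw [← h1]
    exact mul_le_mul_of_nonneg_right (H t ht) (powLog_pos ht1).le
  have hδ : 0 < b - b' := by linarith
  generalize b - b' = δ at *
  generalize c - c' = k at *
  have hle : ∀ t, 4 ≤ t → ∀ k ≤ 0, powLog δ k t ≤ 1 := fun t ht k hk => by
    refine (powLog_le_powLog ht hδ.le hk).trans ?_
    simp [powLog]
  rcases le_or_gt k 0 with hk | hk
  · exact ⟨1, one_pos, fun t ht => hle t ht k hk⟩
  · refine ⟨(k / δ) ^ k, by positivity, fun t ht => ?_⟩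
    have ht0 : 0 < t := by linarith
    have hl := one_le_log_of_four_le ht
    have h1 := Real.log_le_rpow_div ht0.le (ε := δ / k) (by positivity)
    have h2 := Real.rpow_le_rpow (by linarith) h1 hk.le
    rw [Real.div_rpow (by positivity) (by positivity), ← Real.rpow_mul ht0.le,
      div_mul_cancel₀ _ hk.ne'] at h2
    have h3 := mul_le_mul_of_nonneg_left h2 (Real.rpow_nonneg ht0.le (-δ))
    refine h3.trans (le_of_eq ?_)
    rw [Real.rpow_neg ht0.le, Real.div_rpow hδ.le hk.le, Real.div_rpow hk.le hδ.le]
    have := Real.rpow_pos_of_pos ht0 δ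
    field_simp

variable {E : Type*} [NormedAddCommGroup E] [InnerProductSpace ℝ E] [FiniteDimensional ℝ E]

/-- The span of the functions `radialPowLog 4 b c` with `B ≤ b` and `c ≤ 0`. -/
noncomputable def powLogSpan (E : Type*) [NormedAddCommGroup E] (B : ℝ) : Submodule ℝ (E → ℝ) :=
  Submodule.span ℝ {f | ∃ b c : ℝ, B ≤ b ∧ c ≤ 0 ∧ f = radialPowLog 4 b c}

omit [InnerProductSpace ℝ E] [FiniteDimensional ℝ E] in
theorem radialPowLog_mem_powLogSpan {B b c : ℝ} (hb : B ≤ b) (hc : c ≤ 0) :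
    (radialPowLog 4 b c : E → ℝ) ∈ powLogSpan E B :=
  Submodule.subset_span ⟨b, c, hb, hc, rfl⟩

omit [FiniteDimensional ℝ E] in
theorem contDiff_of_mem_powLogSpan {B : ℝ} {f : E → ℝ} {n : WithTop ℕ∞} (hf : f ∈ powLogSpan E B) :
    ContDiff ℝ n f := by
  induction hf using Submodule.span_induction with
  | mem f hf =>
    obtain ⟨b, c, -, -, rfl⟩ := hf
    exact contDiff_radialPowLog (by norm_num) (Or.inr (by norm_num))
  | zero => exact contDiff_const
  | add f g _ _ hf hg => exact hf.add hg
  | smul a f _ hf => exact hf.const_smul a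

/-- Each term of the explicit Laplacian gains at least one power and never raises the logarithmic
exponent. Two applications bound `Δ (Δ u)` by `t ^ (-(b + 2))`, `t = 4 + ‖x‖ ^ 2`, with no
computation. -/
theorem laplacian_mem_powLogSpan {B : ℝ} {f : E → ℝ} (hf : f ∈ powLogSpan E B) :
    Δ f ∈ powLogSpan E (B + 1) := by
  have hcd : ∀ {f : E → ℝ}, f ∈ powLogSpan E B → ContDiff ℝ 2 f := fun hf =>
    contDiff_of_mem_powLogSpan hf
  induction hf using Submodule.span_induction with
  | mem f hf =>
    obtain ⟨b, c, hb, hc, rfl⟩ := hf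
    have e := funext fun x => laplacian_radialPowLog (E := E) (b := b) (c := c) (A := 4)
      (by norm_num) (Or.inr (by norm_num)) x
    rw [e]
    have hm : ∀ i j : ℝ, 1 ≤ i → j ≤ 0 → (fun x : E => radialPowLog 4 (b + i) (c + j) x)
        ∈ powLogSpan E (B + 1) := fun i j hi hj =>
      radialPowLog_mem_powLogSpan (by linarith) (by linarith)
    have m1 := hm 1 0 le_rfl le_rfl
    have m2 := hm 1 (-1) le_rfl (by norm_num)
    have m3 := hm 1 (-2) le_rfl (by norm_num)
    have m4 := hm 2 0 (by norm_num) le_rfl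
    have m5 := hm 2 (-1) (by norm_num) (by norm_num)
    have m6 := hm 2 (-2) (by norm_num) (by norm_num)
    simp only [add_zero, ← sub_eq_add_neg] at m1 m2 m3 m4 m5 m6
    have := Submodule.sub_mem _ (Submodule.add_mem _ (Submodule.add_mem _
      (Submodule.smul_mem _ (4 * b * (b + 1) - 2 * finrank ℝ E * b) m1)
      (Submodule.smul_mem _ ((2 * finrank ℝ E - 4 * (2 * b + 1)) * c) m2))
      (Submodule.smul_mem _ (4 * c * (c - 1)) m3))
      (Submodule.smul_mem _ (4 * 4 : ℝ) (Submodule.add_mem _ (Submodule.sub_mem _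
        (Submodule.smul_mem _ (b * (b + 1)) m4) (Submodule.smul_mem _ ((2 * b + 1) * c) m5))
        (Submodule.smul_mem _ (c * (c - 1)) m6)))
    exact this
  | zero =>
    have : Δ (0 : E → ℝ) = 0 := laplacian_const (c := (0 : ℝ))
    rw [this]; exact Submodule.zero_mem _
  | add f g hf' hg' hf hg =>
    have : Δ (f + g) = Δ f + Δ g := funext fun x =>
      ContDiffAt.laplacian_add (hcd hf').contDiffAt (hcd hg').contDiffAt
    rw [this]; exact Submodule.add_mem _ hf hg
  | smul a f hf' hf =>
    have : Δ (a • f) = a • Δ f := funext fun x => laplacian_smul a (hcd hf').contDiffAt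
    rw [this]; exact Submodule.smul_mem _ a hf

omit [InnerProductSpace ℝ E] [FiniteDimensional ℝ E] in
theorem exists_bound_of_mem_powLogSpan {B : ℝ} {f : E → ℝ} (hf : f ∈ powLogSpan E B) :
    ∃ C ≥ 0, ∀ x, |f x| ≤ C * radialPowLog 4 B 0 x := by
  induction hf using Submodule.span_induction with
  | mem f hf =>
    obtain ⟨b, c, hb, hc, rfl⟩ := hf
    refine ⟨1, zero_le_one, fun x => ?_⟩
    rw [abs_of_pos (radialPowLog_pos x), one_mul]
    exact powLog_le_powLog (four_le_four_add_norm_sq x) hb hc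
  | zero => exact ⟨0, le_rfl, fun x => by simp⟩
  | add f g _ _ hf hg =>
    obtain ⟨C, hC, hf⟩ := hf
    obtain ⟨D, hD, hg⟩ := hg
    refine ⟨C + D, by positivity, fun x => (abs_add_le _ _).trans ?_⟩
    rw [add_mul]
    exact add_le_add (hf x) (hg x)
  | smul a f _ hf =>
    obtain ⟨C, hC, hf⟩ := hf
    refine ⟨|a| * C, by positivity, fun x => ?_⟩
    rw [Pi.smul_apply, smul_eq_mul, abs_mul, mul_assoc]
    exact mul_le_mul_of_nonneg_left (hf x) (abs_nonneg a)

variable {N : ℕ}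

local notation "𝔼" => EuclideanSpace ℝ (Fin N)

theorem kernelConv_smul {α β p ε : ℝ} (hε : 0 ≤ ε) {u : 𝔼 → ℝ} (hu : ∀ x, 0 ≤ u x) (x : 𝔼) :
    kernelConv α β p (ε • u) x = ENNReal.ofReal (ε ^ p) * kernelConv α β p u x := by
  unfold kernelConv
  rw [← lintegral_const_mul' _ _ ENNReal.ofReal_ne_top]
  refine lintegral_congr fun y => ?_
  rw [← ENNReal.ofReal_mul (Real.rpow_nonneg hε _), Pi.smul_apply, smul_eq_mul,
    Real.mul_rpow hε (hu y)]
  congr 1; ring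

/-- A decaying supersolution of the right order, suitably scaled, is a solution for large `lam`. -/
theorem hasNonnegSolutionPPlus_of_supersolution {α β p q b c C : ℝ} (hp : 1 ≤ p) (hq : 1 ≤ q)
    {u h : 𝔼 → ℝ} (hu : u ∈ powLogSpan 𝔼 b) (hu0 : ∀ x, 0 ≤ u x) (hne : u ≠ 0) (hc : 0 < c)
    (hh : ∀ x, c * radialPowLog 4 (b + 2) 0 x ≤ h x) (hΔ : ∀ x, c * h x ≤ -Δ u x)
    (hconv : ∀ x, kernelConv α β p u x < ∞)
    (hle : ∀ x, (kernelConv α β p u x).toReal * u x ^ q ≤ C * h x) :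
    HasNonnegSolutionPPlus N α β p q := by
  have h2 := laplacian_mem_powLogSpan (laplacian_mem_powLogSpan hu)
  obtain ⟨D, hD, hDb⟩ := exists_bound_of_mem_powLogSpan h2
  rw [show b + 1 + 1 = b + 2 by ring] at hDb
  have hh0 : ∀ x, 0 < h x := fun x => (mul_pos hc (radialPowLog_pos x)).trans_le (hh x)
  -- Then `-lam * Δ u ≥ (D / c + 1) * h`: the part `D / c * h` absorbs the bilaplacian and one full
  -- `h` remains.
  set lam := (D / c + 1) / c with hlam
  have hlam0 : 0 < lam := by positivity
  have hmain : ∀ x, h x ≤ Δ (Δ u) x - lam * Δ u x := fun x => by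
    have h3 : D * radialPowLog 4 (b + 2) 0 x ≤ D / c * h x := by
      rw [div_mul_eq_mul_div, le_div_iff₀ hc]
      nlinarith [mul_le_mul_of_nonneg_left (hh x) hD]
    have h4 := neg_le_of_abs_le (hDb x)
    have h5 := mul_le_mul_of_nonneg_left (hΔ x) hlam0.le
    have h6 : lam * (c * h x) = (D / c + 1) * h x := by rw [hlam]; field_simp
    linarith
  -- As `p, q ≥ 1`, scaling by `ε` multiplies the nonlinear side by at most `ε ^ 2` and the linear
  -- side by `ε`, which beats the constant `C`.
  set ε := 1 / (|C| + 1) with hε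
  have hε0 : 0 < ε := by positivity
  have hε1 : ε ≤ 1 := by
    rw [hε, div_le_one (by positivity)]
    linarith [abs_nonneg C]
  have hu4 : ContDiff ℝ 4 u := contDiff_of_mem_powLogSpan hu
  have hu2 : ContDiff ℝ 2 u := contDiff_of_mem_powLogSpan hu
  have e1 : Δ (ε • u) = ε • Δ u := funext fun x => laplacian_smul ε hu2.contDiffAt
  have e2 : Δ (ε • Δ u) = ε • Δ (Δ u) := funext fun x =>
    laplacian_smul ε (contDiff_of_mem_powLogSpan (laplacian_mem_powLogSpan hu)).contDiffAt
  refine ⟨lam, hlam0, ε • u, ⟨hu4.const_smul ε, fun x => mul_nonneg hε0.le (hu0 x), fun x => ?_,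
    fun x => ?_⟩, smul_ne_zero hε0.ne' hne⟩
  · rw [kernelConv_smul hε0.le hu0]
    exact ENNReal.mul_lt_top ENNReal.ofReal_lt_top (hconv x)
  · rw [kernelConv_smul hε0.le hu0, ENNReal.toReal_mul, ENNReal.toReal_ofReal (by positivity), e1,
      e2]
    simp only [Pi.smul_apply, smul_eq_mul]
    rw [Real.mul_rpow hε0.le (hu0 x)]
    have h3 : ε ^ p * ε ^ q * C ≤ ε := by
      have h4 : ε ^ p ≤ ε := by
        simpa using Real.rpow_le_rpow_of_exponent_ge hε0 hε1 hp
      have h5 : ε ^ q ≤ ε := by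
        simpa using Real.rpow_le_rpow_of_exponent_ge hε0 hε1 hq
      calc ε ^ p * ε ^ q * C ≤ ε ^ p * ε ^ q * (|C| + 1) := by
            have := le_abs_self C
            gcongr; linarith
        _ ≤ ε * ε * (|C| + 1) := by gcongr
        _ = ε := by rw [hε]; field_simp
    calc ε ^ p * (kernelConv α β p u x).toReal * (ε ^ q * u x ^ q)
        = ε ^ p * ε ^ q * ((kernelConv α β p u x).toReal * u x ^ q) := by ring
      _ ≤ ε ^ p * ε ^ q * (C * h x) := mul_le_mul_of_nonneg_left (hle x) (by positivity)
      _ = ε ^ p * ε ^ q * C * h x := by ring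
      _ ≤ ε * h x := mul_le_mul_of_nonneg_right h3 (hh0 x).le
      _ ≤ ε * (Δ (Δ u) x - lam * Δ u x) := mul_le_mul_of_nonneg_left (hmain x) hε0.le
      _ = _ := by ring

/-- Slower decay and stronger singularity dominate the kernel. -/
theorem exists_kernelConv_le_mul_kernelConv (hN : 1 ≤ N) (α β p : ℝ) {ε : ℝ} (hε : 0 < ε) :
    ∃ C > 0, ∀ (u : 𝔼 → ℝ), (∀ y, 0 ≤ u y) → ∀ x, kernelConv α β p u x ≤
      ENNReal.ofReal C * kernelConv (α - ε) (min β 0 - ε) p u x := by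
  set γ := β - (min β 0 - ε) with hγ
  have hγε : ε ≤ γ := by
    have := min_le_left β 0
    linarith
  have hγ0 : 0 < γ := by linarith
  set C := 1 + 2 ^ ε * (γ / ε) ^ γ with hC
  have hC0 : 0 < C := by positivity
  have hC1 : 1 ≤ C := by
    have : 0 ≤ 2 ^ ε * (γ / ε) ^ γ := by positivity
    linarith
  -- For `r ≤ 1` use `log (1 + r) ≤ r` and `γ ≥ ε`; for `r ≥ 1` the logarithm is below any power.
  have hlog : ∀ r : ℝ, 0 < r → Real.log (1 + r) ^ γ ≤ C * r ^ ε := by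
    intro r hr
    have hl0 : 0 ≤ Real.log (1 + r) := Real.log_nonneg (by linarith)
    rcases le_total r 1 with h1 | h1
    · have h2 : Real.log (1 + r) ≤ r := by
        have := Real.log_le_sub_one_of_pos (show 0 < 1 + r by linarith)
        linarith
      calc Real.log (1 + r) ^ γ ≤ r ^ γ := Real.rpow_le_rpow hl0 h2 hγ0.le
        _ ≤ r ^ ε := Real.rpow_le_rpow_of_exponent_ge hr h1 hγε
        _ ≤ C * r ^ ε := le_mul_of_one_le_left (by positivity) hC1
    · have h2 := Real.log_le_rpow_div (show 0 ≤ 1 + r by linarith) (ε := ε / γ) (by positivity)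
      calc Real.log (1 + r) ^ γ ≤ ((1 + r) ^ (ε / γ) / (ε / γ)) ^ γ :=
            Real.rpow_le_rpow hl0 h2 hγ0.le
        _ = (1 + r) ^ ε * (γ / ε) ^ γ := by
            rw [div_eq_mul_inv, inv_div, Real.mul_rpow (by positivity) (by positivity),
              ← Real.rpow_mul (by linarith), div_mul_cancel₀ _ hγ0.ne']
        _ ≤ (2 * r) ^ ε * (γ / ε) ^ γ := by
            gcongr; linarith
        _ = 2 ^ ε * (γ / ε) ^ γ * r ^ ε := by
            rw [Real.mul_rpow (by norm_num) hr.le]; ring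
        _ ≤ C * r ^ ε := by gcongr; linarith
  have hK : ∀ z : 𝔼, z ≠ 0 →
      logRieszKernel α β z ≤ C * logRieszKernel (α - ε) (min β 0 - ε) z := by
    intro z hz
    have hr : 0 < ‖z‖ := norm_pos_iff.2 hz
    have hl : 0 < Real.log (1 + ‖z‖) := Real.log_pos (by linarith)
    unfold logRieszKernel
    rw [show β = γ + (min β 0 - ε) by rw [hγ]; ring, Real.rpow_add hl,
      show -(α - ε) = -α + ε by ring, Real.rpow_add hr,
      show min (γ + (min β 0 - ε)) 0 - ε = min β 0 - ε by rw [hγ]; congr 2; ring]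
    have h1 := mul_le_mul_of_nonneg_left (hlog _ hr) (by positivity :
      0 ≤ ‖z‖ ^ (-α) * Real.log (1 + ‖z‖) ^ (min β 0 - ε))
    linarith
  refine ⟨C, hC0, fun u hu x => ?_⟩
  unfold kernelConv
  rw [← lintegral_const_mul' _ _ ENNReal.ofReal_ne_top]
  have : Nontrivial 𝔼 := nontrivial_of_finrank_pos (R := ℝ) (by simp; omega)
  -- The kernel comparison can fail at `z = 0`, where the values are conventional, for instance if
  -- `α = β = 0`.
  have hae : ∀ᵐ y : 𝔼, y ≠ x := by
    simp [ae_iff]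
  refine lintegral_mono_ae ?_
  filter_upwards [hae] with y hy
  rw [← ENNReal.ofReal_mul hC0.le, ← mul_assoc]
  exact ENNReal.ofReal_le_ofReal (mul_le_mul_of_nonneg_right (hK _ (sub_ne_zero.2 hy.symm))
    (Real.rpow_nonneg (hu y) _))

/-- Existence in the subcritical range. -/
theorem hasNonnegSolutionPPlus_of_lt (hN : 3 ≤ N) {α β p q : ℝ} (hp : 1 ≤ p) (hq : 1 ≤ q)
    (hα : 0 ≤ α) (hαN : α < N) (hβ : α - N < β) (h1 : (N : ℝ) < α + (N - 2) * p)
    (h2 : (N : ℝ) < α + (N - 2) * q) (h3 : 2 * (N : ℝ) < α + (N - 2) * (p + q)) :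
    HasNonnegSolutionPPlus N α β p q := by
  have hN' : (3 : ℝ) ≤ N := by exact_mod_cast hN
  have hfr : finrank ℝ 𝔼 = N := by simp
  -- At `ε = 0` these are `N > 2` and the three strict hypotheses, so by continuity they survive a
  -- small loss in every exponent.
  obtain ⟨ε, hε, hb, g1, g2, g3⟩ : ∃ ε > 0, 0 < ((N : ℝ) - 2) / 2 - ε ∧
      0 < α / 2 + (((N : ℝ) - 2) / 2 - ε) * p - 3 / 2 * ε - N / 2 ∧
      0 < α / 2 - 3 / 2 * ε + (((N : ℝ) - 2) / 2 - ε) * q - ((((N : ℝ) - 2) / 2 - ε) + 1) ∧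
      0 < α / 2 + (((N : ℝ) - 2) / 2 - ε) * p - N / 2 - 3 / 2 * ε
        + (((N : ℝ) - 2) / 2 - ε) * q - ((((N : ℝ) - 2) / 2 - ε) + 1) := by
    have hev : ∀ {g : ℝ → ℝ}, Continuous g → 0 < g 0 → ∀ᶠ ε in 𝓝[>] (0 : ℝ), 0 < g ε :=
      fun hg h0 => (hg.continuousAt.eventually (lt_mem_nhds h0)).filter_mono nhdsWithin_le_nhds
    have H : ∀ᶠ ε in 𝓝[>] (0 : ℝ), ε > 0 := eventually_mem_nhdsWithin
    refine (H.and ((hev ?_ ?_).and ((hev ?_ ?_).and ((hev ?_ ?_).and (hev ?_ ?_))))).exists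
    all_goals first | fun_prop | nlinarith
  set b := ((N : ℝ) - 2) / 2 - ε with hb_def
  -- The two losses cancel in `α' - β' = α - min β 0`, so the singularity of the new kernel stays
  -- below `N`, while `β' < 0` as the convolution estimate requires.
  set α' := α - ε with hα'
  set β' := min β 0 - ε with hβ'
  have hβ0 : min β 0 ≤ 0 := min_le_right _ _
  have hβ1 : α - N < min β 0 := lt_min hβ (by linarith)
  set d := (α' + 2 * (b * p)) / 2 with hd
  obtain ⟨C₀, hC₀, hpl⟩ := exists_powLog_le_mul (b := d) (b' := d - ε) β' (-2) (by linarith)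
  obtain ⟨C, hC, hconv⟩ := exists_kernelConv_le (N := N) (α := α') (β := β') (σ := 2 * (b * p))
    (d := d - ε) (τ := -2) (C₀ := C₀) hN (by linarith) (by linarith) (by linarith) (by positivity)
    (by rw [hd, hα']; linarith) (by norm_num) hC₀ (fun x => hpl _ (four_le_four_add_norm_sq x))
  obtain ⟨C₁, hC₁, hker⟩ := exists_kernelConv_le_mul_kernelConv (N := N) (by omega) α β p hε
  obtain ⟨C₂, hC₂, hl₂⟩ := exists_powLog_le_mul (b := α' / 2) (b' := α' / 2 - ε) (β' + 1) 0
    (by linarith)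
  obtain ⟨C₃, hC₃, hl₃⟩ := exists_powLog_le_mul (b := (α' + 2 * (b * p) - N) / 2)
    (b' := d - ε - N / 2) (β' + 1) 0 (by rw [hd]; linarith)
  set u : 𝔼 → ℝ := radialPowLog 4 b 0 with hu
  have hupos : ∀ x, 0 < u x := radialPowLog_pos
  have ht1 : ∀ x : 𝔼, 1 < 4 + ‖x‖ ^ 2 := fun x => by linarith [four_le_four_add_norm_sq x]
  have hur : ∀ (r : ℝ) (x : 𝔼), u x ^ r = radialPowLog 4 (b * r) 0 x := fun r x => by
    simp only [hu, radialPowLog]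
    rw [powLog_rpow (ht1 x), zero_mul]
  set D := C₁ * (C * (C₂ + C₃ + 1)) with hD
  have hkc : ∀ x, kernelConv α β p u x ≤ ENNReal.ofReal (D * (radialPowLog 4 (α' / 2 - ε) 0 x
      + radialPowLog 4 (d - ε - N / 2) 0 x)) := by
    intro x
    have k1 := hconv p u (fun y => (Real.rpow_pos_of_pos (hupos y) _).le) (fun y => by
      rw [hur, mul_div_cancel_left₀ _ two_ne_zero]) x
    refine (hker u (fun y => (hupos y).le) x).trans ?_
    refine (mul_le_mul_right k1 _).trans ?_
    rw [← ENNReal.ofReal_mul hC₁.le]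
    refine ENNReal.ofReal_le_ofReal ?_
    rw [hD, mul_assoc, mul_assoc]
    refine mul_le_mul_of_nonneg_left (mul_le_mul_of_nonneg_left ?_ hC.le) hC₁.le
    have m1 := hl₂ _ (four_le_four_add_norm_sq x)
    have m2 := hl₃ _ (four_le_four_add_norm_sq x)
    have m3 : powLog (d - ε - N / 2) (-2 + 1) (4 + ‖x‖ ^ 2) ≤ powLog (d - ε - N / 2) 0 (4 + ‖x‖ ^ 2) :=
      powLog_le_powLog (four_le_four_add_norm_sq x) le_rfl (by norm_num)
    have p1 := powLog_pos (b := α' / 2 - ε) (c := 0) (ht1 x)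
    have p2 := powLog_pos (b := d - ε - N / 2) (c := 0) (ht1 x)
    simp only [radialPowLog]
    nlinarith [mul_pos hC₂ p2, mul_pos hC₃ p1]
  have hD0 : 0 < D := by positivity
  -- The second entry is the leading coefficient of `-Δ u`, positive because `b` is below the
  -- critical value `(N - 2) / 2`.
  set c := min 1 (2 * (N - 2 * (b + 1)) * b) with hc
  have hc0 : 0 < c := lt_min one_pos (by
    have : 0 < (N : ℝ) - 2 * (b + 1) := by rw [hb_def]; linarith
    positivity)
  refine hasNonnegSolutionPPlus_of_supersolution (b := b) (c := c) (C := D * 2) (u := u)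
    (h := radialPowLog 4 (b + 1) 0) hp hq (radialPowLog_mem_powLogSpan le_rfl le_rfl)
    (fun x => (hupos x).le) (fun h => (hupos 0).ne' (congrFun h 0)) hc0 (fun x => ?_) (fun x => ?_)
    (fun x => (hkc x).trans_lt ENNReal.ofReal_lt_top) (fun x => ?_)
  · have m1 : radialPowLog 4 (b + 2) 0 x ≤ radialPowLog 4 (b + 1) 0 x :=
      powLog_le_powLog (four_le_four_add_norm_sq x) (by linarith) le_rfl
    have m2 := radialPowLog_pos (b := b + 2) (c := 0) x
    have m3 : c ≤ 1 := min_le_left _ _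
    nlinarith
  · rw [hu, laplacian_radialPowLog (by norm_num) (Or.inl rfl), hfr]
    have m2 := radialPowLog_pos (b := b + 2) (c := 0) x
    have m3 := radialPowLog_pos (b := b + 1) (c := 0) x
    have m4 : c ≤ 2 * (N - 2 * (b + 1)) * b := min_le_right _ _
    have m5 := mul_le_mul_of_nonneg_right m4 m3.le
    have m6 : 0 < b * (b + 1) * radialPowLog 4 (b + 2) 0 x := by positivity
    linarith
  · have m1 := ENNReal.toReal_mono ENNReal.ofReal_ne_top (hkc x)
    have p1 := radialPowLog_pos (b := α' / 2 - ε) (c := 0) x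
    have p2 := radialPowLog_pos (b := d - ε - N / 2) (c := 0) x
    rw [ENNReal.toReal_ofReal (by positivity)] at m1
    have p3 := radialPowLog_pos (b := b * q) (c := 0) x
    rw [hur]
    refine (mul_le_mul_of_nonneg_right m1 p3.le).trans ?_
    have q1 : radialPowLog 4 (α' / 2 - ε) 0 x * radialPowLog 4 (b * q) 0 x
        ≤ radialPowLog 4 (b + 1) 0 x := by
      simp only [radialPowLog]
      rw [powLog_mul_powLog (ht1 x)]
      exact powLog_le_powLog (four_le_four_add_norm_sq x) (by rw [hα']; linarith) (by norm_num)
    have q2 : radialPowLog 4 (d - ε - N / 2) 0 x * radialPowLog 4 (b * q) 0 x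
        ≤ radialPowLog 4 (b + 1) 0 x := by
      simp only [radialPowLog]
      rw [powLog_mul_powLog (ht1 x)]
      exact powLog_le_powLog (four_le_four_add_norm_sq x) (by rw [hd, hα']; linarith) (by norm_num)
    have q3 := mul_le_mul_of_nonneg_left (add_le_add q1 q2) hD0.le
    linarith

/-- Existence in the critical range for rapidly decaying logarithmic factors. -/
theorem hasNonnegSolutionPPlus_of_le (hN : 3 ≤ N) {α β p q : ℝ} (hp : 1 ≤ p) (hq : 1 ≤ q)
    (hα : 0 ≤ α) (hβ : α - N < β) (hβ2 : β < -2) (h1 : (N : ℝ) ≤ α + (N - 2) * p)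
    (h2 : (N : ℝ) ≤ α + (N - 2) * q) (h3 : 2 * (N : ℝ) ≤ α + (N - 2) * (p + q)) :
    HasNonnegSolutionPPlus N α β p q := by
  have hN' : (3 : ℝ) ≤ N := by exact_mod_cast hN
  have hfr : finrank ℝ 𝔼 = N := by simp
  set b := ((N : ℝ) - 2) / 2 with hb_def
  have hb : 0 < b := by rw [hb_def]; linarith
  have hNb : (N : ℝ) = 2 * (b + 1) := by rw [hb_def]; ring
  -- The correction `Q` carries `log ^ s`, so the leading part of `Δ Q` is `-4 * b * s` times the
  -- profile with `log ^ (β + 1)`, exactly the size of the convolution term. `β < -2` means `s < 0`,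
  -- which makes this part positive and keeps `Q` below `P`.
  set s := β + 2 with hs_def
  have hs : s < 0 := by linarith
  obtain ⟨C, hC, hconv⟩ := exists_kernelConv_le (N := N) (α := α) (β := β) (σ := 2 * (b * p))
    (d := (α + 2 * (b * p)) / 2) (τ := β) (C₀ := 1) hN (by linarith) (by linarith) (by linarith)
    (by positivity) (by rw [hb_def]; linarith) (by linarith) one_pos (fun x => by rw [one_mul])
  set S := b * (b + 1) + (2 * b + 1) * -s + s * (s - 1) with hS
  have hss : 0 < s * (s - 1) := mul_pos_of_neg_of_neg hs (by linarith)
  have hbs : 0 < (2 * b + 1) * -s := mul_pos (by positivity) (by linarith)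
  have hS0 : 0 < S := by positivity
  -- `S` bounds the lower-order coefficients in `Δ Q`; with this `m` they use at most half of the
  -- positive remainder `16 * b * (b + 1)` in `-Δ P`. It also gives `m ≤ 1 / 2`, hence `u > 0`.
  set m := b * (b + 1) / (2 * S) with hm_def
  have hm : 0 < m := by positivity
  have hmS : m * S = b * (b + 1) / 2 := by rw [hm_def]; field_simp
  have hm2 : m ≤ 1 / 2 := by
    rw [hm_def, div_le_iff₀ (by positivity)]
    linarith
  have ht4 : ∀ x : 𝔼, 4 ≤ 4 + ‖x‖ ^ 2 := four_le_four_add_norm_sq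
  have ht1 : ∀ x : 𝔼, 1 < 4 + ‖x‖ ^ 2 := fun x => by linarith [ht4 x]
  set P : 𝔼 → ℝ := radialPowLog 4 b 0 with hP
  set Q : 𝔼 → ℝ := radialPowLog 4 b s with hQ
  have hPpos : ∀ x, 0 < P x := radialPowLog_pos
  have hQpos : ∀ x, 0 < Q x := radialPowLog_pos
  have hQP : ∀ x, Q x ≤ P x := fun x => powLog_le_powLog (ht4 x) le_rfl hs.le
  set u : 𝔼 → ℝ := P - m • Q with hu
  have hux : ∀ x, u x = P x - m * Q x := fun x => rfl
  have hupos : ∀ x, 0 < u x := fun x => by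
    have := mul_le_mul hm2 (hQP x) (hQpos x).le (by norm_num)
    rw [hux]; linarith [hPpos x]
  have huP : ∀ x, u x ≤ P x := fun x => by
    have := mul_pos hm (hQpos x)
    rw [hux]; linarith
  have hur : ∀ r : ℝ, 0 ≤ r → ∀ x : 𝔼, u x ^ r ≤ radialPowLog 4 (b * r) 0 x := fun r hr x => by
    refine (Real.rpow_le_rpow (hupos x).le (huP x) hr).trans (le_of_eq ?_)
    simp only [hP, radialPowLog]
    rw [powLog_rpow (ht1 x), zero_mul]
  have hkc := hconv p u (fun y => (Real.rpow_pos_of_pos (hupos y) _).le) (fun y => by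
    rw [mul_div_cancel_left₀ _ two_ne_zero]; exact hur p (by linarith) y)
  obtain ⟨C₁, hC₁, hl₁⟩ := exists_powLog_le_mul (b := b + 2) (b' := b + 1) 0 (β + 1)
    (by linarith)
  set c := min (1 / C₁) (m * (4 * b * -s)) with hc
  have hc0 : 0 < c := lt_min (by positivity) (by
    have : 0 < -s := by linarith
    positivity)
  refine hasNonnegSolutionPPlus_of_supersolution (b := b) (c := c) (C := C * 3) (u := u)
    (h := radialPowLog 4 (b + 1) (β + 1)) hp hq
    (Submodule.sub_mem _ (radialPowLog_mem_powLogSpan le_rfl le_rfl)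
      (Submodule.smul_mem _ _ (radialPowLog_mem_powLogSpan le_rfl hs.le)))
    (fun x => (hupos x).le) (fun h => (hupos 0).ne' (congrFun h 0)) hc0 (fun x => ?_) (fun x => ?_)
    (fun x => (hkc x).trans_lt ENNReal.ofReal_lt_top) (fun x => ?_)
  · have m2 := radialPowLog_pos (b := b + 2) (c := 0) x
    have m3 : c ≤ 1 / C₁ := min_le_left _ _
    calc c * radialPowLog 4 (b + 2) 0 x ≤ 1 / C₁ * radialPowLog 4 (b + 2) 0 x :=
          mul_le_mul_of_nonneg_right m3 m2.le
      _ ≤ 1 / C₁ * (C₁ * radialPowLog 4 (b + 1) (β + 1) x) :=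
          mul_le_mul_of_nonneg_left (hl₁ _ (ht4 x)) (by positivity)
      _ = _ := by field_simp
  · have hPc : ContDiff ℝ 2 P := contDiff_radialPowLog (by norm_num) (Or.inl rfl)
    have hQc : ContDiff ℝ 2 Q := contDiff_radialPowLog (by norm_num) (Or.inr (by norm_num))
    have hmQ : ContDiff ℝ 2 (m • Q) := hQc.const_smul m
    rw [hu, ContDiffAt.laplacian_sub hPc.contDiffAt hmQ.contDiffAt,
      laplacian_smul m hQc.contDiffAt, hP, hQ,
      laplacian_radialPowLog (by norm_num) (Or.inl rfl),
      laplacian_radialPowLog (by norm_num) (Or.inr (by norm_num)), hfr, hNb, smul_eq_mul,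
      show β + 1 = s - 1 by rw [hs_def]; ring]
    have r1 := radialPowLog_pos (b := b + 1) (c := s - 1) x
    have r2 := radialPowLog_pos (b := b + 1) (c := s - 2) x
    have r3 := radialPowLog_pos (b := b + 2) (c := s - 1) x
    have o1 : radialPowLog 4 (b + 2) s x ≤ radialPowLog 4 (b + 2) 0 x :=
      powLog_le_powLog (ht4 x) le_rfl hs.le
    have o2 : radialPowLog 4 (b + 2) (s - 1) x ≤ radialPowLog 4 (b + 2) 0 x :=
      powLog_le_powLog (ht4 x) le_rfl (by linarith)
    have o3 : radialPowLog 4 (b + 2) (s - 2) x ≤ radialPowLog 4 (b + 2) 0 x :=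
      powLog_le_powLog (ht4 x) le_rfl (by linarith)
    have r0 := radialPowLog_pos (b := b + 2) (c := 0) x
    have m4 : c ≤ m * (4 * b * -s) := min_le_right _ _
    have m5 := mul_le_mul_of_nonneg_right m4 r1.le
    have q1 := mul_le_mul_of_nonneg_left o1 (by positivity : 0 ≤ m * (b * (b + 1)))
    have q2 := mul_le_mul_of_nonneg_left o2 (mul_pos hm hbs).le
    have q3 := mul_le_mul_of_nonneg_left o3 (mul_pos hm hss).le
    have q4 := mul_pos hm (mul_pos hss r2)
    have q5 : m * S * radialPowLog 4 (b + 2) 0 x = b * (b + 1) / 2 * radialPowLog 4 (b + 2) 0 x := by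
      rw [hmS]
    have q6 : 0 < b * (b + 1) * radialPowLog 4 (b + 2) 0 x := by positivity
    rw [hS] at q5
    linarith
  · have m1 := ENNReal.toReal_mono ENNReal.ofReal_ne_top (hkc x)
    have p1 := radialPowLog_pos (b := α / 2) (c := β + 1) x
    have p2 := radialPowLog_pos (b := (α + 2 * (b * p) - N) / 2) (c := β + 1) x
    have p4 := radialPowLog_pos (b := (α + 2 * (b * p)) / 2 - N / 2) (c := β + 1) x
    rw [ENNReal.toReal_ofReal (by positivity)] at m1
    have p3 := radialPowLog_pos (b := b * q) (c := 0) x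
    refine (mul_le_mul m1 (hur q (by linarith) x) (Real.rpow_pos_of_pos (hupos x) _).le
      (by positivity)).trans ?_
    have key : ∀ e : ℝ, b + 1 ≤ e + b * q → radialPowLog 4 e (β + 1) x
        * radialPowLog 4 (b * q) 0 x ≤ radialPowLog 4 (b + 1) (β + 1) x := fun e he => by
      simp only [radialPowLog]
      rw [powLog_mul_powLog (ht1 x)]
      exact powLog_le_powLog (ht4 x) he (by linarith)
    have q1 := key (α / 2) (by rw [hb_def]; linarith)
    have q2 := key ((α + 2 * (b * p) - N) / 2) (by rw [hb_def]; linarith)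
    have q3 := key ((α + 2 * (b * p)) / 2 - N / 2) (by rw [hb_def]; linarith)
    have q4 := mul_le_mul_of_nonneg_left (add_le_add (add_le_add q1 q2) q3) hC.le
    linarith

end Existence

/-! ### The two equivalences. -/

theorem mainTheorem5 (N : ℕ) (hN : 3 ≤ N) (p q α β : ℝ) (hp : 1 ≤ p) (hq : 1 ≤ q)
    (hα₀ : 0 ≤ α) (hαN : α < (N : ℝ)) (hβ : α - (N : ℝ) < β) :
    (β < -2 →
      (HasNonnegSolutionPPlus N α β p q ↔
        ((N : ℝ) - α) / ((N : ℝ) - 2) ≤ p ∧ ((N : ℝ) - α) / ((N : ℝ) - 2) ≤ q ∧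
          (2 * (N : ℝ) - α) / ((N : ℝ) - 2) ≤ p + q)) ∧
    (-1 + 1 / q < β →
      (HasNonnegSolutionPPlus N α β p q ↔
        ((N : ℝ) - α) / ((N : ℝ) - 2) < p ∧ ((N : ℝ) - α) / ((N : ℝ) - 2) < q ∧
          (2 * (N : ℝ) - α) / ((N : ℝ) - 2) < p + q)) := by
  have hN' : (3 : ℝ) ≤ N := by exact_mod_cast hN
  have hN2 : 0 < (N : ℝ) - 2 := by linarith
  have hq0 : 0 < q := by linarith
  simp only [div_le_iff₀ hN2, div_lt_iff₀ hN2]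
  refine ⟨fun hβ2 => ⟨fun h => ?_, fun ⟨h1, h2, h3⟩ => ?_⟩,
    fun hβ1 => ⟨fun h => ?_, fun ⟨h1, h2, h3⟩ => ?_⟩⟩
  · obtain ⟨h1, h2⟩ := h.exponents hN hp hq
    have h3 := (h2 α (by simp)).1
    have h4 := (h2 (α + (N - 2) * p - N) (by simp)).1
    exact ⟨by linarith [h1.1], by linarith, by linarith⟩
  · exact hasNonnegSolutionPPlus_of_le hN hp hq hα₀ hβ hβ2 (by linarith) (by linarith) (by linarith)
  · have hβ3 : -1 < β := by
      have : 0 < 1 / q := by positivity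
      linarith
    -- The hypothesis `β > -1 + 1 / q` negates precisely the condition imposed by equality, so both
    -- inequalities in `θ` become strict.
    have hqβ : ¬ q * (β + 1) ≤ 1 := by
      rw [not_le, mul_comm, ← div_lt_iff₀ hq0]
      linarith
    obtain ⟨h1, h2⟩ := h.exponents hN hp hq
    have h3 := h2 α (by simp)
    have h4 := h2 (α + (N - 2) * p - N) (by simp)
    have h5 := lt_of_le_of_ne h3.1 fun e => hqβ (h3.2 hβ3 e)
    have h6 := lt_of_le_of_ne h4.1 fun e => hqβ (h4.2 hβ3 e)
    have h7 := h1.2 hβ3.le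
    exact ⟨by linarith, by linarith, by linarith⟩
  · exact hasNonnegSolutionPPlus_of_lt hN hp hq hα₀ hαN hβ (by linarith) (by linarith)
      (by linarith)
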